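/- Let $M$ be a compact Riemannian manifold (without boundary) of dimension $n$, and let $x\colon M\to\mathbb R^N$ be a smooth isometric embedding with mean curvature function $H=\frac1n\left|\sum_{i=1}^n \mathrm{II}(e_i,e_i)\right|$, where $\mathrm{II}$ is the second fundamental form and $(e_i)$ a local orthonormal frame of $TM$. Let $S$ be a Dirac bundle over $M$, that is, a smooth real or complex vector bundle with a Euclidean, respectively Hermitian, fibre metric $\langle\cdot,\cdot\rangle$, a metric connection $\nabla$ and a Clifford multiplication $TM\otimes S\to S$, $v\cdot v\cdot\sigma=-|v|^2\sigma$, such that $\langle v\cdot\sigma,\tau\rangle+\langle\sigma,v\cdot\tau\rangle=0$ and $\nabla_v(Y\cdot\sigma)=(\nabla_vY)\cdot\sigma+Y\cdot\nabla_v\sigma$ for vector fields $Y$ and sections $\sigma$, where $\nabla_v Y$ is the Levi-Civita derivative (in the complex case the Clifford multiplication and $\nabla$ are complex linear on $S$). Let $D=\sum_i e_i\cdot\nabla_{e_i}$ be its Dirac operator and $\mathfrak R=\sum_{i<j}e_i\cdot e_j\cdot R_{e_i,e_j}$, with $R_{X,Y}=[\nabla_X,\nabla_Y]-\nabla_{[X,Y]}$,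 its curvature morphism. Let $\{\lambda_j;\varphi_j\}_{j\ge1}$ be a spectral resolution of $D^2$: the $\varphi_j$ are smooth sections that form an orthonormal basis of $L^2(S)$ (over the scalar field of $S$), $D^2\varphi_j=\lambda_j\varphi_j$, and $\lambda_1\le\lambda_2\le\cdots$. Suppose that $R\in\mathbb R$ satisfies $\operatorname{Re}\int_M\langle\mathfrak R\varphi_i,\varphi_i\rangle\ge R$ for all $i$, and put $\eta_i=\lambda_i+\frac14n^2\sup_MH^2-R$. Then $$\sum_{i=1}^n(\eta_{i+1}-\eta_1)\le4\eta_1 .$$ -/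

import Mathlib

open Bundle Manifold MeasureTheory Filter
open scoped ContDiff ENNReal

noncomputable section

namespace DiracEigenvalues

/-! ### Riemannian geometry -/

section Riemannian

variable {n : ℕ} (M : Type*) [TopologicalSpace M] [ChartedSpace (EuclideanSpace ℝ (Fin n)) M]
  [RiemannianBundle (fun x : M ↦ TangentSpace (𝓡 n) x)]

variable {M} in
/-- The Gram matrix `g(∂ᵢ, ∂ⱼ)` of the coordinate vector fields of the chart at `p`, at the point
of `M` with coordinates `y`. -/
def gramMatrix (p : M) (y : EuclideanSpace ℝ (Fin n)) : Matrix (Fin n) (Fin n) ℝ :=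
  let coordField (i : Fin n) : TangentSpace (𝓡 n) ((extChartAt (𝓡 n) p).symm y) :=
    mfderiv 𝓘(ℝ, EuclideanSpace ℝ (Fin n)) (𝓡 n) (extChartAt (𝓡 n) p).symm y
      (EuclideanSpace.single i (1 : ℝ))
  Matrix.of fun i j ↦ inner ℝ (coordField i) (coordField j)

variable {M} in
/-- The Riemannian volume of the domain of the chart at `p`: the image under the inverse chart of
`√det(gᵢⱼ) dy`. -/
def chartVolume [MeasurableSpace M] (p : M) : Measure M :=
  ((volume.restrict (extChartAt (𝓡 n) p).target).withDensity
    fun y ↦ ENNReal.ofReal (Real.sqrt (gramMatrix p y).det)).map (extChartAt (𝓡 n) p).symm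

/-- The Riemannian volume measure: the least measure dominating the volumes of all chart domains.
As those agree on overlaps, its restriction to a chart domain is `√det(gᵢⱼ) dy`. -/
def riemannianVolume [MeasurableSpace M] : Measure M := ⨆ p : M, chartVolume (n := n) p

instance (p : M) : FiniteDimensional ℝ (TangentSpace (𝓡 n) p) :=
  inferInstanceAs (FiniteDimensional ℝ (EuclideanSpace ℝ (Fin n)))

variable {M} in
/-- An orthonormal basis of the tangent space at `p`. The quantities below that are defined with
its help do not depend on the choice. -/
def frame (p : M) :
    OrthonormalBasis (Fin (Module.finrank ℝ (TangentSpace (𝓡 n) p))) ℝ (TangentSpace (𝓡 n) p) :=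
  stdOrthonormalBasis ℝ (TangentSpace (𝓡 n) p)

variable {M} {N : ℕ}

/-- Smooth isometric embeddings into Euclidean space. -/
structure IsIsometricEmbedding (x : M → EuclideanSpace ℝ (Fin N)) : Prop where
  smooth : ContMDiff (𝓡 n) 𝓘(ℝ, EuclideanSpace ℝ (Fin N)) ∞ x
  isEmbedding : Topology.IsEmbedding x
  inner_mvfderiv : ∀ (p : M) (u v : TangentSpace (𝓡 n) p),
    inner ℝ (mvfderiv (𝓡 n) x p u) (mvfderiv (𝓡 n) x p v) = inner ℝ u v

variable [IsManifold (𝓡 n) ∞ M]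

/-- The second fundamental form `II(u, v) = (D_u (dx V))^⊥`, where `V` is a vector field near `p`
with `V p = v`: the component normal to `dx(T_p M)`. -/
def secondFundamentalForm (x : M → EuclideanSpace ℝ (Fin N)) (p : M)
    (u v : TangentSpace (𝓡 n) p) : EuclideanSpace ℝ (Fin N) :=
  (LinearMap.range (mvfderiv (𝓡 n) x p).toLinearMap)ᗮ.starProjection
    (mvfderiv (𝓡 n)
      (fun q ↦ mvfderiv (𝓡 n) x q (FiberBundle.extend (EuclideanSpace ℝ (Fin n)) v q)) p u)

/-- The mean curvature vector field `∑ᵢ II(eᵢ, eᵢ)`. -/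
def meanCurvatureVector (x : M → EuclideanSpace ℝ (Fin N)) (p : M) : EuclideanSpace ℝ (Fin N) :=
  ∑ i, secondFundamentalForm (n := n) x p (frame p i) (frame p i)

/-- The mean curvature function `H = |∑ᵢ II(eᵢ, eᵢ)| / n`. -/
def meanCurvature (x : M → EuclideanSpace ℝ (Fin N)) (p : M) : ℝ :=
  ‖meanCurvatureVector (n := n) x p‖ / n

end Riemannian

/-! ### Dirac bundles -/

section Dirac

variable {n : ℕ} (𝕜 : Type*) [RCLike 𝕜]
  (M : Type*) [TopologicalSpace M] [ChartedSpace (EuclideanSpace ℝ (Fin n)) M]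
  [IsManifold (𝓡 n) ∞ M]
  [RiemannianBundle (fun x : M ↦ TangentSpace (𝓡 n) x)]
  [IsContMDiffRiemannianBundle (𝓡 n) ∞ (EuclideanSpace ℝ (Fin n))
    (fun x : M ↦ TangentSpace (𝓡 n) x)]
  (F : Type*) [NormedAddCommGroup F] [NormedSpace ℝ F] [FiniteDimensional ℝ F]
  (S : M → Type*) [TopologicalSpace (TotalSpace F S)] [∀ x, NormedAddCommGroup (S x)]
  [∀ x, InnerProductSpace ℝ (S x)] [FiberBundle F S] [VectorBundle ℝ F S]
  [ContMDiffVectorBundle ∞ F S (𝓡 n)] [IsContMDiffRiemannianBundle (𝓡 n) ∞ F S]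
  [∀ x, InnerProductSpace 𝕜 (S x)]

set_option synthInstance.maxHeartbeats 400000 in
/-- The structure of a Dirac bundle over the Riemannian manifold `M`, real (`𝕜 = ℝ`) or complex
(`𝕜 = ℂ`), on the smooth vector bundle `S` with fiber metric `inner 𝕜`. The real inner product on
the fibers induces the same norm, hence is the real part of `inner 𝕜`; in the real case the two
coincide. -/
structure DiracBundle where
  /-- The Levi-Civita connection of `M`. -/
  leviCivita : CovariantDerivative (𝓡 n) (EuclideanSpace ℝ (Fin n))
    (TangentSpace (𝓡 n) : M → Type _)
  leviCivita_smooth : CovariantDerivative.ContMDiffCovariantDerivative leviCivita ∞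
  leviCivita_torsion : leviCivita.torsion = 0
  leviCivita_metric : leviCivita.IsMetricCompatible
  /-- Scalar multiplication (by the imaginary unit, say) preserves smoothness of sections. -/
  smul_smooth : ∀ (a : 𝕜) (σ : ∀ x, S x) (p : M),
    ContMDiffAt (𝓡 n) ((𝓡 n).prod 𝓘(ℝ, F)) ∞ (fun x ↦ TotalSpace.mk' F x (σ x)) p →
    ContMDiffAt (𝓡 n) ((𝓡 n).prod 𝓘(ℝ, F)) ∞ (fun x ↦ TotalSpace.mk' F x (a • σ x)) p
  /-- Clifford multiplication by tangent vectors. By the universal property of Clifford algebras,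
  the relation `clifford_sq` makes each fiber of `S` a left module over the Clifford algebra of
  the tangent space. -/
  clifford : ∀ p : M, TangentSpace (𝓡 n) p →ₗ[ℝ] S p →ₗ[ℝ] S p
  clifford_smul : ∀ (p : M) (v : TangentSpace (𝓡 n) p) (a : 𝕜) (s : S p),
    clifford p v (a • s) = a • clifford p v s
  clifford_sq : ∀ (p : M) (v : TangentSpace (𝓡 n) p) (s : S p),
    clifford p v (clifford p v s) = -(‖v‖ ^ 2 • s)
  clifford_skew : ∀ (p : M) (v : TangentSpace (𝓡 n) p) (s t : S p),
    inner 𝕜 (clifford p v s) t + inner 𝕜 s (clifford p v t) = 0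
  clifford_smooth : ∀ (Y : ∀ x : M, TangentSpace (𝓡 n) x) (σ : ∀ x, S x) (p : M),
    ContMDiffAt (𝓡 n) ((𝓡 n).prod 𝓘(ℝ, EuclideanSpace ℝ (Fin n))) ∞
      (fun x ↦ TotalSpace.mk' (EuclideanSpace ℝ (Fin n)) x (Y x)) p →
    ContMDiffAt (𝓡 n) ((𝓡 n).prod 𝓘(ℝ, F)) ∞ (fun x ↦ TotalSpace.mk' F x (σ x)) p →
    ContMDiffAt (𝓡 n) ((𝓡 n).prod 𝓘(ℝ, F)) ∞
      (fun x ↦ TotalSpace.mk' F x (clifford x (Y x) (σ x))) p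
  /-- The connection of `S`; `conn σ p v` is `∇_v σ` at `p`. -/
  conn : CovariantDerivative (𝓡 n) F S
  conn_smooth : CovariantDerivative.ContMDiffCovariantDerivative conn ∞
  conn_metric : conn.IsMetricCompatible
  conn_smul : ∀ (a : 𝕜) (σ : ∀ x, S x) (p : M) (v : TangentSpace (𝓡 n) p),
    ContMDiffAt (𝓡 n) ((𝓡 n).prod 𝓘(ℝ, F)) ∞ (fun x ↦ TotalSpace.mk' F x (σ x)) p →
    conn (fun x ↦ a • σ x) p v = a • conn σ p v
  /-- `∇_v (Y · σ) = (∇_v Y) · σ + Y · ∇_v σ`. -/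
  conn_clifford : ∀ (Y : ∀ x : M, TangentSpace (𝓡 n) x) (σ : ∀ x, S x) (p : M)
      (v : TangentSpace (𝓡 n) p),
    ContMDiffAt (𝓡 n) ((𝓡 n).prod 𝓘(ℝ, EuclideanSpace ℝ (Fin n))) ∞
      (fun x ↦ TotalSpace.mk' (EuclideanSpace ℝ (Fin n)) x (Y x)) p →
    ContMDiffAt (𝓡 n) ((𝓡 n).prod 𝓘(ℝ, F)) ∞ (fun x ↦ TotalSpace.mk' F x (σ x)) p →
    conn (fun x ↦ clifford x (Y x) (σ x)) p v =
      clifford p (leviCivita Y p v) (σ p) + clifford p (Y p) (conn σ p v)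

namespace DiracBundle

variable {𝕜 M F S} (B : DiracBundle (n := n) 𝕜 M F S)

/-- The Dirac operator `D σ = ∑ᵢ eᵢ · ∇_{eᵢ} σ`. -/
def dirac (σ : ∀ x, S x) (p : M) : S p :=
  ∑ i, B.clifford p (frame p i) (B.conn σ p (frame p i))

/-- The curvature `R_{u,v} σ = ∇_U ∇_V σ - ∇_V ∇_U σ - ∇_{[U,V]} σ` at `p`, where `U` and `V` are
vector fields near `p` with `U p = u` and `V p = v`. -/
def curvature (σ : ∀ x, S x) (p : M) (u v : TangentSpace (𝓡 n) p) : S p :=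
  let U : ∀ x : M, TangentSpace (𝓡 n) x := FiberBundle.extend (EuclideanSpace ℝ (Fin n)) u
  let V : ∀ x : M, TangentSpace (𝓡 n) x := FiberBundle.extend (EuclideanSpace ℝ (Fin n)) v
  B.conn (fun x ↦ B.conn σ x (V x)) p u - B.conn (fun x ↦ B.conn σ x (U x)) p v
    - B.conn σ p (VectorField.mlieBracket (𝓡 n) U V p)

/-- The curvature morphism `ℜ σ = ∑_{i<j} eᵢ · eⱼ · R_{eᵢ,eⱼ} σ`. -/
def curvatureMorphism (σ : ∀ x, S x) (p : M) : S p :=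
  ∑ i, ∑ j ∈ Finset.Ioi i,
    B.clifford p (frame p i) (B.clifford p (frame p j) (B.curvature σ p (frame p i) (frame p j)))

variable [mM : MeasurableSpace M]

/-- A spectral resolution of `D²`: a nondecreasing sequence `ev` of reals and an orthonormal basis
`φ` of `L²(S)` (that is, an orthonormal sequence whose finite linear combinations are dense in the
space of measurable square integrable sections) of smooth sections with `D² φⱼ = evⱼ φⱼ`. -/
structure IsSpectralResolution (ev : ℕ → ℝ) (φ : ℕ → ∀ x, S x) : Prop where
  monotone : Monotone ev
  smooth : ∀ j, ContMDiff (𝓡 n) ((𝓡 n).prod 𝓘(ℝ, F)) ∞ (fun x ↦ TotalSpace.mk' F x (φ j x))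
  eigen : ∀ j p, B.dirac (B.dirac (φ j)) p = ev j • φ j p
  orthonormal : ∀ i j,
    ∫ p, inner 𝕜 (φ i p) (φ j p) ∂(riemannianVolume (n := n) M) = if i = j then 1 else 0
  dense : ∀ σ : ∀ x, S x,
    Measurable[mM, borel (TotalSpace F S)] (fun x ↦ TotalSpace.mk' F x (σ x)) →
    ∫⁻ p, ‖σ p‖ₑ ^ 2 ∂(riemannianVolume (n := n) M) < ⊤ →
    ∀ ε : ℝ≥0∞, 0 < ε → ∃ (s : Finset ℕ) (a : ℕ → 𝕜),
      ∫⁻ p, ‖σ p - ∑ j ∈ s, a j • φ j p‖ₑ ^ 2 ∂(riemannianVolume (n := n) M) < ε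

end DiracBundle

end Dirac

end DiracEigenvalues

end

/-!
Suppose that sections `ψᵢ = fᵢ φ₀`, with real functions `fᵢ`, are pairwise orthogonal and
orthogonal to `φ₀`, and put `uᵢ = [D², fᵢ] φ₀ = (D² - λ₀) ψᵢ`, so that
`uᵢ = -(2 ∇_{grad fᵢ} φ₀ + Δfᵢ φ₀)`. Integration by parts shows that
`aᵢ = Re ⟪uᵢ, ψᵢ⟫ = ∫ |grad fᵢ|² |φ₀|²`. If `|grad fᵢ| ≤ 1` and `∑ᵢ |grad fᵢ|² = n`, the weights
`aᵢ` lie in `[0, 1]` and have sum `n`. Expanding the normalized `ψᵢ` in eigensections and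
counting the `i`-th of them `aᵢ` times, one gets, as in Ky Fan's inequality, that the sum of the
`n` smallest of the numbers `λₖ - λ₀` with `k ≥ 1` is at most `∑ᵢ aᵢ² / ‖ψᵢ‖² ≤ ∑ᵢ ‖uᵢ‖²`.

The `fᵢ` are the coordinate functions of the immersion, with the origin moved to the centre of mass
of the measure `|φ₀|² dvol` and the axes turned to the principal axes of its second moment. As the
immersion is isometric, `∑ᵢ ‖uᵢ‖² = 4 ‖∇φ₀‖² + n² ∫ H² |φ₀|²`: the cross terms vanish since
`Δx` is normal, and `|Δx|² = n² H²`. By the Weitzenböck formula `D² = ∇*∇ + ℜ`,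
`‖∇φ₀‖² = λ₀ - ∫ ⟪ℜ φ₀, φ₀⟫`.
-/

noncomputable section

namespace DiracEigenvalues

section Spectral

variable {𝕜 W ι : Type*} [RCLike 𝕜] [SeminormedAddCommGroup W] [InnerProductSpace 𝕜 W]

lemma norm_sub_sum_inner_smul_le {φ : ι → W} (hφ : Orthonormal 𝕜 φ) (e : W) (a : ι → 𝕜)
    {s t : Finset ι} (hst : s ⊆ t) :
    ‖e - ∑ k ∈ t, inner 𝕜 (φ k) e • φ k‖ ≤ ‖e - ∑ k ∈ s, a k • φ k‖ := by
  set P := ∑ k ∈ t, inner 𝕜 (φ k) e • φ k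
  have orth (c : ι → 𝕜) {r : Finset ι} (hr : r ⊆ t) :
      inner 𝕜 (∑ k ∈ r, c k • φ k) (e - P) = 0 := by
    rw [sum_inner]
    refine Finset.sum_eq_zero fun k hk ↦ ?_
    rw [inner_smul_left, inner_sub_right, hφ.inner_right_sum _ (hr hk), sub_self, mul_zero]
  have pythagoras := norm_add_sq (𝕜 := 𝕜) (P - ∑ k ∈ s, a k • φ k) (e - P)
  rw [inner_sub_left, orth _ subset_rfl, orth _ hst, sub_zero, map_zero, mul_zero, add_zero,
    add_comm _ (e - P), sub_add_sub_cancel] at pythagoras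
  exact (sq_le_sq₀ (norm_nonneg _) (norm_nonneg _)).1
    (pythagoras ▸ le_add_of_nonneg_left (sq_nonneg _))

lemma hasSum_inner_smul {φ : ι → W} (hφ : Orthonormal 𝕜 φ) {e : W}
    (he : e ∈ closure (Submodule.span 𝕜 (Set.range φ) : Set W)) :
    HasSum (fun k ↦ inner 𝕜 (φ k) e • φ k) e := by
  rw [HasSum, SummationFilter.unconditional_filter, Metric.tendsto_nhds]
  intro ε hε
  obtain ⟨y, hy, hey⟩ := Metric.mem_closure_iff.1 he ε hε
  obtain ⟨a, ha : ∑ k ∈ a.support, a k • φ k = y⟩ :=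
    Finsupp.mem_span_range_iff_exists_finsupp.1 hy
  filter_upwards [eventually_ge_atTop a.support] with t ht
  rw [dist_comm, dist_eq_norm]
  refine (norm_sub_sum_inner_smul_le hφ e a ht).trans_lt ?_
  rwa [ha, ← dist_eq_norm]

lemma hasSum_inner_mul_inner_of_mem_closure {φ : ι → W} (hφ : Orthonormal 𝕜 φ) (u : W) {e : W}
    (he : e ∈ closure (Submodule.span 𝕜 (Set.range φ) : Set W)) :
    HasSum (fun k ↦ inner 𝕜 u (φ k) * inner 𝕜 (φ k) e) (inner 𝕜 u e) := by
  simpa only [innerSL_apply_apply, inner_smul_right, mul_comm] using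
    (innerSL 𝕜 u).hasSum (hasSum_inner_smul hφ he)

lemma sum_norm_inner_sq_div_le [Fintype ι] {ψ : ι → W}
    (hψ : Pairwise fun i j ↦ inner 𝕜 (ψ i) (ψ j) = 0) (v : W) :
    ∑ i, ‖inner 𝕜 (ψ i) v‖ ^ 2 / ‖ψ i‖ ^ 2 ≤ ‖v‖ ^ 2 := by
  classical
  let e (i : {i // ‖ψ i‖ ≠ 0}) : W := ((‖ψ i‖⁻¹ : ℝ) : 𝕜) • ψ i
  have he : Orthonormal 𝕜 e := by
    refine ⟨fun i ↦ ?_, fun i j hij ↦ ?_⟩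
    · rw [norm_smul, RCLike.norm_ofReal, abs_inv, abs_norm, inv_mul_cancel₀ i.2]
    · beta_reduce
      rw [inner_smul_left, inner_smul_right, hψ (Subtype.val_injective.ne hij), mul_zero, mul_zero]
  have hterm (i : {i // ‖ψ i‖ ≠ 0}) :
      ‖inner 𝕜 (e i) v‖ ^ 2 = ‖inner 𝕜 (ψ i) v‖ ^ 2 / ‖ψ i‖ ^ 2 := by
    rw [inner_smul_left, norm_mul, RCLike.norm_conj, RCLike.norm_ofReal, abs_inv, abs_norm,
      mul_pow, inv_pow, div_eq_inv_mul]
  calc ∑ i, ‖inner 𝕜 (ψ i) v‖ ^ 2 / ‖ψ i‖ ^ 2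
      = ∑ i with ‖ψ i‖ ≠ 0, ‖inner 𝕜 (ψ i) v‖ ^ 2 / ‖ψ i‖ ^ 2 := by
        refine (Finset.sum_filter_of_ne fun i _ hi ↦ ?_).symm
        exact fun h0 ↦ hi (by rw [h0, zero_pow two_ne_zero, div_zero])
    _ = ∑ i, ‖inner 𝕜 (e i) v‖ ^ 2 := by
        simp only [hterm]
        exact Finset.sum_subtype _ (by simp) fun i ↦ ‖inner 𝕜 (ψ i) v‖ ^ 2 / ‖ψ i‖ ^ 2
    _ ≤ ‖v‖ ^ 2 := he.sum_inner_products_le v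

lemma sum_sub_mul_norm_inner_sq_le {φ : ℕ → W} (hφ : Orthonormal 𝕜 φ) {μ : ℕ → ℝ}
    (hμ : Monotone μ) {ψ u : W} (hψ : ψ ∈ closure (Submodule.span 𝕜 (Set.range φ) : Set W))
    (hu : ∀ k, inner 𝕜 (φ k) u = μ k * inner 𝕜 (φ k) ψ) (m : ℕ) :
    ∑ k ∈ Finset.range m, (μ k - μ m) * ‖inner 𝕜 (φ k) ψ‖ ^ 2 ≤
      RCLike.re (inner 𝕜 u ψ) - μ m * ‖ψ‖ ^ 2 := by
  have hsum (w : W) := RCLike.hasSum_re 𝕜 (hasSum_inner_mul_inner_of_mem_closure hφ w hψ)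
  have hu' (k : ℕ) : RCLike.re (inner 𝕜 u (φ k) * inner 𝕜 (φ k) ψ) =
      μ k * ‖inner 𝕜 (φ k) ψ‖ ^ 2 := by
    rw [← inner_conj_symm, hu, map_mul (starRingEnd 𝕜), RCLike.conj_ofReal, mul_assoc,
      RCLike.conj_mul, RCLike.re_ofReal_mul]
    norm_cast
  have hψ' (k : ℕ) : RCLike.re (inner 𝕜 ψ (φ k) * inner 𝕜 (φ k) ψ) = ‖inner 𝕜 (φ k) ψ‖ ^ 2 := by
    rw [← inner_conj_symm, RCLike.conj_mul]
    norm_cast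
  have h := (hsum u).sub ((hsum ψ).mul_left (μ m))
  simp only [hu', hψ', inner_self_eq_norm_sq, ← sub_mul] at h
  refine sum_le_hasSum _ (fun k hk ↦ ?_) h
  exact mul_nonneg (sub_nonneg.2 (hμ (by simpa using hk))) (sq_nonneg _)

lemma sum_sub_mul_sum_div_mul_norm_inner_sq_le [Fintype ι] {φ : ℕ → W} (hφ : Orthonormal 𝕜 φ)
    {μ : ℕ → ℝ} (hμ : Monotone μ) {ψ u : ι → W}
    (hψ : ∀ i, ψ i ∈ closure (Submodule.span 𝕜 (Set.range φ) : Set W))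
    (hu : ∀ i k, inner 𝕜 (φ k) (u i) = μ k * inner 𝕜 (φ k) (ψ i))
    (hnonneg : ∀ i, 0 ≤ RCLike.re (inner 𝕜 (u i) (ψ i))) (m : ℕ) :
    ∑ k ∈ Finset.range m, (μ k - μ m) *
        ∑ i, RCLike.re (inner 𝕜 (u i) (ψ i)) / ‖ψ i‖ ^ 2 * ‖inner 𝕜 (φ k) (ψ i)‖ ^ 2 ≤
      ∑ i, (RCLike.re (inner 𝕜 (u i) (ψ i)) ^ 2 / ‖ψ i‖ ^ 2
        - μ m * RCLike.re (inner 𝕜 (u i) (ψ i))) := by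
  simp only [Finset.mul_sum]
  rw [Finset.sum_comm]
  refine Finset.sum_le_sum fun i _ ↦ ?_
  have hi := mul_le_mul_of_nonneg_left (sum_sub_mul_norm_inner_sq_le hφ hμ (hψ i) (hu i) m)
    (div_nonneg (hnonneg i) (sq_nonneg ‖ψ i‖))
  rw [Finset.mul_sum] at hi
  refine (Finset.sum_congr rfl fun k _ ↦ mul_left_comm _ _ _).trans_le (hi.trans_eq ?_)
  rcases eq_or_ne ‖ψ i‖ 0 with h | h
  · have hle : RCLike.re (inner 𝕜 (u i) (ψ i)) ≤ ‖u i‖ * ‖ψ i‖ := re_inner_le_norm _ _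
    have hzero : RCLike.re (inner 𝕜 (u i) (ψ i)) = 0 :=
      (hnonneg i).antisymm' (by simpa [h] using hle)
    simp [hzero]
  · field_simp

/-- The weights `aᵢ = Re ⟪uᵢ, ψᵢ⟫ ≤ 1` make this a Ky Fan inequality for the operator
`ψᵢ ↦ uᵢ`: the variational principle is applied to the `ψᵢ / ‖ψᵢ‖`, the `i`-th of them counted
`aᵢ` times. -/
lemma sum_eigenvalue_le_sum_norm_sq [Fintype ι] {φ : ℕ → W} (hφ : Orthonormal 𝕜 φ) {μ : ℕ → ℝ}
    (hμ : Monotone μ) {ψ u : ι → W}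
    (hψ : ∀ i, ψ i ∈ closure (Submodule.span 𝕜 (Set.range φ) : Set W))
    (hu : ∀ i k, inner 𝕜 (φ k) (u i) = μ k * inner 𝕜 (φ k) (ψ i))
    (horth : Pairwise fun i j ↦ inner 𝕜 (ψ i) (ψ j) = 0) (h0 : ∀ i, inner 𝕜 (φ 0) (ψ i) = 0)
    (hnonneg : ∀ i, 0 ≤ RCLike.re (inner 𝕜 (u i) (ψ i)))
    (hle : ∀ i, RCLike.re (inner 𝕜 (u i) (ψ i)) ≤ 1) {n : ℕ}
    (hsum : ∑ i, RCLike.re (inner 𝕜 (u i) (ψ i)) = n) :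
    ∑ k ∈ Finset.range n, μ (k + 1) ≤ ∑ i, ‖u i‖ ^ 2 := by
  set a : ι → ℝ := fun i ↦ RCLike.re (inner 𝕜 (u i) (ψ i))
  set A : ℕ → ℝ := fun k ↦ ∑ i, a i / ‖ψ i‖ ^ 2 * ‖inner 𝕜 (φ k) (ψ i)‖ ^ 2
  have A_zero : A 0 = 0 := by simp [A, h0]
  have A_le (k : ℕ) : A k ≤ 1 := by
    calc A k ≤ ∑ i, ‖inner 𝕜 (ψ i) (φ k)‖ ^ 2 / ‖ψ i‖ ^ 2 := by
          refine Finset.sum_le_sum fun i _ ↦ ?_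
          rw [norm_inner_symm, ← mul_div_right_comm]
          gcongr
          exact mul_le_of_le_one_left (sq_nonneg _) (hle i)
      _ ≤ 1 := by simpa [hφ.norm_eq_one] using sum_norm_inner_sq_div_le horth (φ k)
  have kyFan := sum_sub_mul_sum_div_mul_norm_inner_sq_le hφ hμ hψ hu hnonneg (n + 1)
  calc ∑ k ∈ Finset.range n, μ (k + 1)
      = ∑ k ∈ Finset.range n, (μ (k + 1) - μ (n + 1)) + μ (n + 1) * ∑ i, a i := by
        rw [hsum, Finset.sum_sub_distrib, Finset.sum_const, Finset.card_range, nsmul_eq_mul]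
        ring
    _ ≤ ∑ k ∈ Finset.range (n + 1), (μ k - μ (n + 1)) * A k + μ (n + 1) * ∑ i, a i := by
        rw [Finset.sum_range_succ', A_zero, mul_zero, add_zero]
        gcongr with k hk
        exact le_mul_of_le_one_right
          (sub_nonpos.2 (hμ (by simpa using (Finset.mem_range.1 hk).le))) (A_le _)
    _ ≤ ∑ i, a i ^ 2 / ‖ψ i‖ ^ 2 := by
        rw [Finset.sum_sub_distrib, ← Finset.mul_sum] at kyFan
        linarith
    _ ≤ ∑ i, ‖u i‖ ^ 2 := by
        refine Finset.sum_le_sum fun i _ ↦ div_le_of_le_mul₀ (sq_nonneg _) (sq_nonneg _) ?_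
        rw [← mul_pow]
        exact pow_le_pow_left₀ (hnonneg i) (re_inner_le_norm _ _) 2

end Spectral

section Determinant

open Matrix

variable {E ι : Type*} [NormedAddCommGroup E] [NormedSpace ℝ E] [Fintype ι] [DecidableEq ι]
  {A : E → Matrix ι ι ℝ} {y : E}

lemma exists_hasFDerivAt_det (hA : ∀ i j, DifferentiableAt ℝ (fun y ↦ A y i j) y) :
    ∃ L : E →L[ℝ] ℝ, HasFDerivAt (fun y ↦ (A y).det) L y ∧
      ∀ v, L v = trace (adjugate (A y) * of fun i j ↦ fderiv ℝ (fun y ↦ A y i j) y v) := by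
  let det' : ContinuousMultilinearMap ℝ (fun _ : ι ↦ ι → ℝ) ℝ :=
    ⟨(detRowAlternating (n := ι) (R := ℝ)).toMultilinearMap, Continuous.matrix_det continuous_id⟩
  have hA' : HasFDerivAt (fun y i ↦ A y i) _ y :=
    hasFDerivAt_pi.2 fun i ↦ hasFDerivAt_pi.2 fun j ↦ (hA i j).hasFDerivAt
  refine ⟨_, (det'.hasFDerivAt (A y)).comp y hA', fun v ↦ ?_⟩
  have hrow (i : ι) : ((A y).updateRow i fun j ↦ fderiv ℝ (fun y ↦ A y i j) y v).det =
      ∑ j, fderiv ℝ (fun y ↦ A y i j) y v * adjugate (A y) j i := by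
    rw [← cramer_transpose_apply, cramer_eq_adjugate_mulVec, ← adjugate_transpose]
    simp only [mulVec, dotProduct, transpose_apply, mul_comm]
  rw [trace_mul_comm]
  refine (ContinuousMultilinearMap.linearDeriv_apply _ _ _).trans ?_
  exact Finset.sum_congr rfl fun i _ ↦ hrow i

/-- `Γ` plays the role of the matrix of Christoffel symbols of a metric connection in the
direction `v`. -/
lemma fderiv_sqrt_det (hA : ∀ i j, DifferentiableAt ℝ (fun y ↦ A y i j) y) (h0 : 0 < (A y).det)
    {v : E} {Γ : Matrix ι ι ℝ}
    (hΓ : ∀ i j, fderiv ℝ (fun y ↦ A y i j) y v = (Γᵀ * A y + A y * Γ) i j) :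
    fderiv ℝ (fun y ↦ √(A y).det) y v = √(A y).det * trace Γ := by
  obtain ⟨L, hL, hLv⟩ := exists_hasFDerivAt_det hA
  have htrace : L v = 2 * (A y).det * trace Γ := by
    rw [hLv, show (of fun i j ↦ fderiv ℝ (fun y ↦ A y i j) y v) = Γᵀ * A y + A y * Γ from
      Matrix.ext hΓ, mul_add, trace_add, ← mul_assoc, ← mul_assoc, adjugate_mul, trace_mul_comm,
      ← mul_assoc, mul_adjugate, smul_one_mul, smul_one_mul, trace_smul, trace_smul,
      trace_transpose, smul_eq_mul]
    ring
  have hs : √(A y).det * √(A y).det = (A y).det := Real.mul_self_sqrt h0.le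
  have hs0 : √(A y).det ≠ 0 := (Real.sqrt_pos.2 h0).ne'
  rw [(hL.sqrt h0.ne').fderiv, _root_.smul_apply, htrace, smul_eq_mul]
  field_simp
  rw [sq, hs]

end Determinant

section DualFrames

variable {E W ι κ : Type*} [NormedAddCommGroup E] [InnerProductSpace ℝ E] [AddCommGroup W]
  [Module ℝ W] [Fintype ι] [Fintype κ] {z z' : ι → E}

lemma sum_bilin_eq_of_dual (hz : ∀ u, ∑ i, inner ℝ (z' i) u • z i = u)
    (e : OrthonormalBasis κ ℝ E) (T : E →ₗ[ℝ] E →ₗ[ℝ] W) :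
    ∑ i, T (z i) (z' i) = ∑ j, T (e j) (e j) := by
  calc ∑ i, T (z i) (z' i) = ∑ i, ∑ j, inner ℝ (z' i) (e j) • T (z i) (e j) := by
        refine Finset.sum_congr rfl fun i _ ↦ ?_
        conv_lhs => rw [← e.sum_repr' (z' i)]
        simp only [map_sum, map_smul, real_inner_comm]
    _ = ∑ j, T (∑ i, inner ℝ (z' i) (e j) • z i) (e j) := by
        rw [Finset.sum_comm]
        simp only [map_sum, map_smul, LinearMap.sum_apply, LinearMap.smul_apply]
    _ = ∑ j, T (e j) (e j) := by simp only [hz]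

lemma trace_eq_sum_inner_of_dual (hz : ∀ u, ∑ i, inner ℝ (z' i) u • z i = u)
    [FiniteDimensional ℝ E] (f : E →ₗ[ℝ] E) :
    LinearMap.trace ℝ E f = ∑ i, inner ℝ (z' i) (f (z i)) := by
  rw [f.trace_eq_sum_inner (stdOrthonormalBasis ℝ E)]
  have h := sum_bilin_eq_of_dual hz (stdOrthonormalBasis ℝ E) ((innerₗ E).comp f)
  simp only [LinearMap.comp_apply, innerₗ_apply_apply, real_inner_comm] at h ⊢
  exact h.symm

lemma sum_inner_gram_inv_smul {ι E : Type*} [Fintype ι] [DecidableEq ι] [NormedAddCommGroup E]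
    [InnerProductSpace ℝ E] (b : Module.Basis ι ℝ E) (u : E) :
    ∑ i, inner ℝ (∑ j, (Matrix.gram ℝ b)⁻¹ i j • b j) u • b i = u := by
  have hunit : IsUnit (Matrix.gram ℝ b).det :=
    (Matrix.posDef_gram_of_linearIndependent b.linearIndependent).det_pos.ne'.isUnit
  have hinv (i k : ι) :
      inner ℝ (∑ j, (Matrix.gram ℝ b)⁻¹ i j • b j) (b k) = (1 : Matrix ι ι ℝ) i k := by
    simp only [← Matrix.nonsing_inv_mul _ hunit, Matrix.mul_apply, sum_inner, real_inner_smul_left,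
      Matrix.gram_apply]
  conv_rhs => rw [← b.sum_repr u]
  have hrepr (i : ι) : inner ℝ (∑ j, (Matrix.gram ℝ b)⁻¹ i j • b j) u = b.repr u i := by
    conv_lhs => rw [← b.sum_repr u]
    simp only [inner_sum, real_inner_smul_right, hinv, Matrix.one_apply, mul_ite, mul_one,
      mul_zero, Finset.sum_ite_eq, Finset.mem_univ, if_true]
  simp only [hrepr]

end DualFrames

section Coordinates

open scoped Topology

variable {n : ℕ} {M : Type*} [TopologicalSpace M] [ChartedSpace (EuclideanSpace ℝ (Fin n)) M]

/-- The vector field with constant coefficients `w` in the chart at `c`. Away from the domain of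
that chart its values are meaningless. -/
def coordField (c : M) (w : EuclideanSpace ℝ (Fin n)) : Π q : M, TangentSpace (𝓡 n) q :=
  VectorField.mpullback (𝓡 n) 𝓘(ℝ, EuclideanSpace ℝ (Fin n)) (extChartAt (𝓡 n) c) fun _ ↦ w

variable (n) in
/-- Smoothness of a section of a vector bundle at a point. -/
abbrev IsSmoothAt (F : Type*) [NormedAddCommGroup F] [NormedSpace ℝ F] {S : M → Type*}
    [TopologicalSpace (TotalSpace F S)] [∀ p, TopologicalSpace (S p)] [FiberBundle F S]
    (σ : Π p, S p) (p : M) : Prop :=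
  ContMDiffAt (𝓡 n) ((𝓡 n).prod 𝓘(ℝ, F)) ∞ (fun q ↦ TotalSpace.mk' F q (σ q)) p

variable (n) in
/-- Smooth sections of a vector bundle. -/
abbrev IsSmooth (F : Type*) [NormedAddCommGroup F] [NormedSpace ℝ F] {S : M → Type*}
    [TopologicalSpace (TotalSpace F S)] [∀ p, TopologicalSpace (S p)] [FiberBundle F S]
    (σ : Π p, S p) : Prop :=
  ContMDiff (𝓡 n) ((𝓡 n).prod 𝓘(ℝ, F)) ∞ (fun q ↦ TotalSpace.mk' F q (σ q))

variable [IsManifold (𝓡 n) ∞ M]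

/-- Smoothness of a vector field at a point. -/
abbrev IsSmoothFieldAt (U : Π p : M, TangentSpace (𝓡 n) p) (p : M) : Prop :=
  IsSmoothAt n (EuclideanSpace ℝ (Fin n)) U p

/-- Smooth vector fields. -/
abbrev IsSmoothField (U : Π p : M, TangentSpace (𝓡 n) p) : Prop :=
  IsSmooth n (EuclideanSpace ℝ (Fin n)) U

variable {Y : Type*} [NormedAddCommGroup Y] [NormedSpace ℝ Y] {c : M}

lemma contMDiffAt_mvfderiv_apply {h : M → Y} (hh : ContMDiff (𝓡 n) 𝓘(ℝ, Y) ∞ h)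
    {U : Π p : M, TangentSpace (𝓡 n) p} {p : M} (hU : IsSmoothFieldAt U p) :
    ContMDiffAt (𝓡 n) 𝓘(ℝ, Y) ∞ (fun q ↦ mvfderiv (𝓡 n) h q (U q)) p :=
  ((contMDiff_snd_tangentBundle_modelSpace Y 𝓘(ℝ, Y)).comp
    (hh.contMDiff_tangentMap (m := ∞) (by simp))).contMDiffAt.comp p hU

lemma contMDiffAt_extChartAt_symm {y : EuclideanSpace ℝ (Fin n)}
    (hy : y ∈ (extChartAt (𝓡 n) c).target) :
    ContMDiffAt 𝓘(ℝ, EuclideanSpace ℝ (Fin n)) (𝓡 n) ∞ (extChartAt (𝓡 n) c).symm y :=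
  (contMDiffOn_extChartAt_symm c).contMDiffAt ((isOpen_extChartAt_target c).mem_nhds hy)

lemma contDiffAt_comp_extChartAt_symm {y : EuclideanSpace ℝ (Fin n)}
    (hy : y ∈ (extChartAt (𝓡 n) c).target) {h : M → Y}
    (hh : ContMDiffAt (𝓡 n) 𝓘(ℝ, Y) ∞ h ((extChartAt (𝓡 n) c).symm y)) :
    ContDiffAt ℝ ∞ (h ∘ (extChartAt (𝓡 n) c).symm) y :=
  (hh.comp y (contMDiffAt_extChartAt_symm hy)).contDiffAt

lemma coordField_extChartAt_symm {y : EuclideanSpace ℝ (Fin n)}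
    (hy : y ∈ (extChartAt (𝓡 n) c).target) (w : EuclideanSpace ℝ (Fin n)) :
    coordField c w ((extChartAt (𝓡 n) c).symm y) =
      mfderiv 𝓘(ℝ, EuclideanSpace ℝ (Fin n)) (𝓡 n) (extChartAt (𝓡 n) c).symm y w := by
  have hcomp := mfderiv_extChartAt_comp_mfderivWithin_extChartAt_symm (I := 𝓡 n) hy
  have hinv := isInvertible_mfderiv_extChartAt (I := 𝓡 n) ((extChartAt (𝓡 n) c).map_target hy)
  simp only [modelWithCornersSelf_coe, Set.range_id, mfderivWithin_univ] at hcomp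
  refine Eq.trans ?_ (hinv.inverse_apply_self _)
  exact congrArg _ (DFunLike.congr_fun hcomp w).symm

lemma mvfderiv_coordField {y : EuclideanSpace ℝ (Fin n)} (hy : y ∈ (extChartAt (𝓡 n) c).target)
    {h : M → Y} (hh : MDifferentiableAt (𝓡 n) 𝓘(ℝ, Y) h ((extChartAt (𝓡 n) c).symm y))
    (w : EuclideanSpace ℝ (Fin n)) :
    mvfderiv (𝓡 n) h ((extChartAt (𝓡 n) c).symm y) (coordField c w _) =
      fderiv ℝ (h ∘ (extChartAt (𝓡 n) c).symm) y w := by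
  rw [coordField_extChartAt_symm hy, ← mfderiv_eq_fderiv]
  exact (mfderiv_comp_apply y hh
    ((contMDiffAt_extChartAt_symm hy).mdifferentiableAt (by simp)) w).symm

variable {q : M} (hq : q ∈ (extChartAt (𝓡 n) c).source)

include hq

lemma isSmoothFieldAt_coordField (w : EuclideanSpace ℝ (Fin n)) :
    IsSmoothFieldAt (coordField c w) q := by
  have hconst : ContMDiffAt 𝓘(ℝ, EuclideanSpace ℝ (Fin n))
      (𝓘(ℝ, EuclideanSpace ℝ (Fin n)).prod 𝓘(ℝ, EuclideanSpace ℝ (Fin n))) ∞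
      (fun z ↦ (⟨z, w⟩ : TangentBundle 𝓘(ℝ, EuclideanSpace ℝ (Fin n))
        (EuclideanSpace ℝ (Fin n)))) (extChartAt (𝓡 n) c q) :=
    contMDiffAt_vectorSpace_iff_contDiffAt.2 contDiffAt_const
  exact ContMDiffAt.mpullback_vectorField_preimage (n := ∞) hconst
    (contMDiffAt_extChartAt' (by rwa [extChartAt_source] at hq))
    (isInvertible_mfderiv_extChartAt hq) (by simp)

lemma bijective_coordField :
    Function.Bijective fun w : EuclideanSpace ℝ (Fin n) ↦ coordField c w q := by
  obtain ⟨e, he⟩ := isInvertible_mfderiv_extChartAt hq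
  have h : (fun w : EuclideanSpace ℝ (Fin n) ↦ coordField c w q) = e.symm :=
    congrArg DFunLike.coe ((congrArg ContinuousLinearMap.inverse he.symm).trans
      (ContinuousLinearMap.inverse_equiv e))
  exact h ▸ e.symm.bijective

lemma mlieBracket_coordField (v w : EuclideanSpace ℝ (Fin n)) :
    VectorField.mlieBracket (𝓡 n) (coordField c v) (coordField c w) q = 0 := by
  have : IsManifold (𝓡 n) (minSmoothness ℝ 2) M :=
    IsManifold.of_le (n := ∞) (by simpa using ENat.LEInfty.out)
  have h (v : EuclideanSpace ℝ (Fin n)) :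
      MDifferentiableAt 𝓘(ℝ, EuclideanSpace ℝ (Fin n)) (𝓘(ℝ, EuclideanSpace ℝ (Fin n)).tangent)
      (fun z ↦ (⟨z, v⟩ : TangentBundle 𝓘(ℝ, EuclideanSpace ℝ (Fin n))
        (EuclideanSpace ℝ (Fin n)))) (extChartAt (𝓡 n) c q) :=
    (contMDiffAt_vectorSpace_iff_contDiffAt (n := 1).2
      contDiffAt_const).mdifferentiableAt (by simp)
  refine (VectorField.mpullback_mlieBracket (n := ∞) (h v) (h w)
    (contMDiffAt_extChartAt' (by rwa [extChartAt_source] at hq))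
    (by simpa using ENat.LEInfty.out)).symm.trans ?_
  refine (congrArg (mfderiv (𝓡 n) 𝓘(ℝ, EuclideanSpace ℝ (Fin n))
    (extChartAt (𝓡 n) c) q).inverse ?_).trans (map_zero _)
  refine (congrFun VectorField.mlieBracketWithin_eq_lieBracketWithin _).trans ?_
  have hzero : VectorField.lieBracketWithin ℝ (fun _ ↦ v) (fun _ ↦ w) Set.univ
      (extChartAt (𝓡 n) c q) = 0 := by simp [VectorField.lieBracketWithin]
  exact hzero

lemma mvfderiv_mvfderiv_coordField {h : M → Y} (hh : ContMDiff (𝓡 n) 𝓘(ℝ, Y) ∞ h)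
    (v w : EuclideanSpace ℝ (Fin n)) :
    mvfderiv (𝓡 n) (fun r ↦ mvfderiv (𝓡 n) h r (coordField c w r)) q (coordField c v q) =
      mvfderiv (𝓡 n) (fun r ↦ mvfderiv (𝓡 n) h r (coordField c v r)) q (coordField c w q) := by
  obtain ⟨y, hy, rfl⟩ : ∃ y ∈ (extChartAt (𝓡 n) c).target, (extChartAt (𝓡 n) c).symm y = q :=
    ⟨_, (extChartAt (𝓡 n) c).map_source hq, (extChartAt (𝓡 n) c).left_inv hq⟩
  have hsmooth : ContDiffAt ℝ ∞ (h ∘ (extChartAt (𝓡 n) c).symm) y :=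
    contDiffAt_comp_extChartAt_symm hy (hh _)
  have hsecond (v w : EuclideanSpace ℝ (Fin n)) :
      mvfderiv (𝓡 n) (fun r ↦ mvfderiv (𝓡 n) h r (coordField c w r))
        ((extChartAt (𝓡 n) c).symm y) (coordField c v _) =
      fderiv ℝ (fderiv ℝ (h ∘ (extChartAt (𝓡 n) c).symm)) y v w := by
    have hfirst := contMDiffAt_mvfderiv_apply hh (isSmoothFieldAt_coordField hq w)
    rw [mvfderiv_coordField hy (hfirst.mdifferentiableAt (by simp))]
    have heq : (fun r ↦ mvfderiv (𝓡 n) h r (coordField c w r)) ∘ (extChartAt (𝓡 n) c).symm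
        =ᶠ[𝓝 y] fun z ↦ fderiv ℝ (h ∘ (extChartAt (𝓡 n) c).symm) z w := by
      filter_upwards [(isOpen_extChartAt_target c).mem_nhds hy] with z hz
      exact mvfderiv_coordField hz ((hh _).mdifferentiableAt (by simp)) w
    have hderiv : DifferentiableAt ℝ (fderiv ℝ (h ∘ (extChartAt (𝓡 n) c).symm)) y :=
      (hsmooth.fderiv_right (m := ∞) (by simp)).differentiableAt (by simp)
    rw [heq.fderiv_eq, fderiv_clm_apply hderiv (differentiableAt_const w)]
    simp
  rw [hsecond, hsecond]
  exact (hsmooth.isSymmSndFDerivAt (by simpa using ENat.LEInfty.out)).eq v w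

end Coordinates

section Frames

open scoped Topology

variable {n : ℕ} {M : Type*} [TopologicalSpace M] [ChartedSpace (EuclideanSpace ℝ (Fin n)) M]

lemma contMDiffAt_det {ι : Type*} [Fintype ι] [DecidableEq ι] {A : M → Matrix ι ι ℝ} {p : M}
    (hA : ∀ i j, ContMDiffAt (𝓡 n) 𝓘(ℝ, ℝ) ∞ (fun q ↦ A q i j) p) :
    ContMDiffAt (𝓡 n) 𝓘(ℝ, ℝ) ∞ (fun q ↦ (A q).det) p := by
  simp only [Matrix.det_apply']
  exact contMDiffAt_finsetSum fun s _ ↦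
    contMDiffAt_const.mul (contMDiffAt_finsetProd fun i _ ↦ hA (s i) i)

lemma contMDiffAt_matrix_inv_apply {ι : Type*} [Fintype ι] [DecidableEq ι] {A : M → Matrix ι ι ℝ}
    {p : M} (hA : ∀ i j, ContMDiffAt (𝓡 n) 𝓘(ℝ, ℝ) ∞ (fun q ↦ A q i j) p) (hp : (A p).det ≠ 0)
    (i j : ι) : ContMDiffAt (𝓡 n) 𝓘(ℝ, ℝ) ∞ (fun q ↦ (A q)⁻¹ i j) p := by
  simp only [Matrix.inv_def, Ring.inverse_eq_inv', Matrix.smul_apply, Matrix.adjugate_apply,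
    smul_eq_mul]
  refine ((contMDiffAt_det hA).inv₀ hp).mul (contMDiffAt_det fun k l ↦ ?_)
  simp only [Matrix.updateRow_apply]
  split_ifs
  exacts [contMDiffAt_const, hA k l]

variable [IsManifold (𝓡 n) ∞ M]

lemma exists_isSmooth_eventuallyEq [T2Space M] {F : Type*} [NormedAddCommGroup F] [NormedSpace ℝ F]
    {S : M → Type*} [TopologicalSpace (TotalSpace F S)] [∀ p, TopologicalSpace (S p)]
    [∀ p, AddCommGroup (S p)] [∀ p, Module ℝ (S p)] [FiberBundle F S] [VectorBundle ℝ F S]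
    {σ : Π p, S p} {p : M} (hσ : ∀ᶠ q in 𝓝 p, IsSmoothAt n F σ q) :
    ∃ τ : Π p, S p, IsSmooth n F τ ∧ ∀ᶠ q in 𝓝 p, τ q = σ q := by
  obtain ⟨s, hs, hopen, hp⟩ := mem_nhds_iff.1 hσ
  obtain ⟨f, -, hf⟩ := (SmoothBumpFunction.nhds_basis_tsupport (I := 𝓡 n) p).mem_iff.1
    (hopen.mem_nhds hp)
  refine ⟨fun q ↦ f q • σ q, ContMDiffOn.smul_section_of_tsupport f.contMDiff.contMDiffOn hopen hf
    fun q hq ↦ ContMDiffAt.contMDiffWithinAt (hs hq), ?_⟩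
  filter_upwards [f.eventuallyEq_one] with q hq
  simp [hq]

/-- The `i`-th coordinate vector field of the chart at `c`. -/
abbrev coordFrame (c : M) (i : Fin n) : Π q : M, TangentSpace (𝓡 n) q :=
  coordField c (EuclideanSpace.single i 1)

lemma exists_basis_eq_coordFrame {c q : M} (hq : q ∈ (extChartAt (𝓡 n) c).source) :
    ∃ b : Module.Basis (Fin n) ℝ (TangentSpace (𝓡 n) q), ∀ i, b i = coordFrame c i q := by
  let e : EuclideanSpace ℝ (Fin n) ≃ₗ[ℝ] TangentSpace (𝓡 n) q := LinearEquiv.ofBijective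
    (mfderiv (𝓡 n) 𝓘(ℝ, EuclideanSpace ℝ (Fin n)) (extChartAt (𝓡 n) c) q).inverse.toLinearMap
    (bijective_coordField hq)
  refine ⟨(EuclideanSpace.basisFun (Fin n) ℝ).toBasis.map e, fun i ↦ ?_⟩
  exact congrArg e (EuclideanSpace.basisFun_apply (Fin n) ℝ i)

variable [RiemannianBundle (fun x : M ↦ TangentSpace (𝓡 n) x)]

/-- The `i`-th vector field of the frame dual to `coordFrame c`, that is, the gradient of the
`i`-th coordinate function of the chart at `c`. -/
def dualCoordFrame (c : M) (i : Fin n) : Π q : M, TangentSpace (𝓡 n) q :=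
  fun q ↦ ∑ j, (Matrix.gram ℝ fun k ↦ coordFrame c k q)⁻¹ i j • coordFrame c j q

lemma sum_inner_dualCoordFrame_smul {c q : M} (hq : q ∈ (extChartAt (𝓡 n) c).source)
    (u : TangentSpace (𝓡 n) q) :
    ∑ i, inner ℝ (dualCoordFrame c i q) u • coordFrame c i q = u := by
  obtain ⟨b, hb⟩ := exists_basis_eq_coordFrame hq
  simp only [dualCoordFrame, ← hb]
  exact sum_inner_gram_inv_smul b u

variable [IsContMDiffRiemannianBundle (𝓡 n) ∞ (EuclideanSpace ℝ (Fin n))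
  (fun x : M ↦ TangentSpace (𝓡 n) x)]

lemma isSmoothFieldAt_dualCoordFrame {c q : M} (hq : q ∈ (extChartAt (𝓡 n) c).source) (i : Fin n) :
    IsSmoothFieldAt (dualCoordFrame c i) q := by
  obtain ⟨b, hb⟩ := exists_basis_eq_coordFrame hq
  have hdet : (Matrix.gram ℝ fun k : Fin n ↦ coordFrame c k q).det ≠ 0 := by
    simp only [← hb]
    exact (Matrix.posDef_gram_of_linearIndependent b.linearIndependent).det_pos.ne'
  refine ContMDiffAt.sum_section fun j _ ↦ ContMDiffAt.smul_section
    (contMDiffAt_matrix_inv_apply (A := fun q ↦ Matrix.gram ℝ fun k : Fin n ↦ coordFrame c k q)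
      (fun k l ↦ ?_) hdet i j) (isSmoothFieldAt_coordField hq _)
  exact ContMDiffAt.inner_bundle (isSmoothFieldAt_coordField hq _)
    (isSmoothFieldAt_coordField hq _)

lemma exists_dual_frames [T2Space M] (p : M) :
    ∃ z z' : Fin n → Π q : M, TangentSpace (𝓡 n) q,
      (∀ i, IsSmoothField (z i)) ∧ (∀ i, IsSmoothField (z' i)) ∧
        ∀ᶠ q in 𝓝 p, ∀ u : TangentSpace (𝓡 n) q, ∑ i, inner ℝ (z' i q) u • z i q = u := by
  have hsource := extChartAt_source_mem_nhds (I := 𝓡 n) p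
  choose z hz hzeq using fun i ↦ exists_isSmooth_eventuallyEq
    (mem_of_superset hsource fun q hq ↦ isSmoothFieldAt_coordField hq (EuclideanSpace.single i 1))
  choose z' hz' hzeq' using fun i ↦ exists_isSmooth_eventuallyEq
    (mem_of_superset hsource fun q hq ↦ isSmoothFieldAt_dualCoordFrame hq i)
  refine ⟨z, z', hz, hz', ?_⟩
  filter_upwards [hsource, eventually_all.2 hzeq, eventually_all.2 hzeq'] with q hq h h' u
  simp only [h, h']
  exact sum_inner_dualCoordFrame_smul hq u

end Frames

section Connections

open scoped Topology

variable {n : ℕ} {M : Type*} [TopologicalSpace M] [ChartedSpace (EuclideanSpace ℝ (Fin n)) M]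
  {F : Type*} [NormedAddCommGroup F] [NormedSpace ℝ F] {S : M → Type*}
  [TopologicalSpace (TotalSpace F S)] [∀ x, NormedAddCommGroup (S x)]
  [∀ x, InnerProductSpace ℝ (S x)] [FiberBundle F S] {cov : CovariantDerivative (𝓡 n) F S}
  {σ τ : Π p, S p} {p : M}

lemma conn_smul_apply {f : M → ℝ} (hf : ContMDiffAt (𝓡 n) 𝓘(ℝ, ℝ) ∞ f p)
    (hσ : IsSmoothAt n F σ p) (u : TangentSpace (𝓡 n) p) :
    cov (fun q ↦ f q • σ q) p u = f p • cov σ p u + mvfderiv (𝓡 n) f p u • σ p :=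
  DFunLike.congr_fun (cov.isCovariantDerivativeOn.leibniz (x := p)
    (hσ.mdifferentiableAt (by simp)) (hf.mdifferentiableAt (by simp))) u

lemma conn_add_apply (hσ : IsSmoothAt n F σ p) (hτ : IsSmoothAt n F τ p)
    (u : TangentSpace (𝓡 n) p) : cov (fun q ↦ σ q + τ q) p u = cov σ p u + cov τ p u :=
  DFunLike.congr_fun (cov.isCovariantDerivativeOn.add (x := p)
    (hσ.mdifferentiableAt (by simp)) (hτ.mdifferentiableAt (by simp))) u

lemma conn_congr (hσ : IsSmoothAt n F σ p) (h : ∀ᶠ q in 𝓝 p, τ q = σ q) :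
    cov τ p = cov σ p := by
  have hτ : IsSmoothAt n F τ p :=
    hσ.congr_of_eventuallyEq (h.mono fun q hq ↦ congrArg (TotalSpace.mk' F q) hq)
  exact cov.isCovariantDerivativeOn.congr_of_eventuallyEq (hτ.mdifferentiableAt (by simp))
    (hσ.mdifferentiableAt (by simp)) univ_mem h

variable [VectorBundle ℝ F S]

lemma conn_sum_apply {ι : Type*} (s : Finset ι) {σ : ι → Π p, S p}
    (hσ : ∀ i, IsSmoothAt n F (σ i) p) (u : TangentSpace (𝓡 n) p) :
    cov (fun q ↦ ∑ i ∈ s, σ i q) p u = ∑ i ∈ s, cov (σ i) p u := by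
  classical
  induction s using Finset.induction_on with
  | empty =>
    simp only [Finset.sum_empty]
    exact DFunLike.congr_fun (congrFun cov.zero p) u
  | insert i s hi ih =>
    simp only [Finset.sum_insert hi]
    rw [conn_add_apply (hσ i) (ContMDiffAt.sum_section fun i _ ↦ hσ i), ih]

variable [IsManifold (𝓡 n) ∞ M]

lemma isSmoothAt_conn_apply (hcov : CovariantDerivative.ContMDiffCovariantDerivative cov ∞)
    (hσ : IsSmooth n F σ) {U : Π p : M, TangentSpace (𝓡 n) p} (hU : IsSmoothFieldAt U p) :
    IsSmoothAt n F (fun q ↦ cov σ q (U q)) p := by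
  have h := hcov.contMDiff.contMDiff (σ := σ) (contMDiffOn_univ.2 hσ)
  exact (contMDiffOn_univ.1 h p).clm_bundle_apply hU

lemma conn_coordField_comm {lc : CovariantDerivative (𝓡 n) (EuclideanSpace ℝ (Fin n))
    (TangentSpace (𝓡 n) : M → Type _)} (ht : lc.torsion = 0) {c q : M}
    (hq : q ∈ (extChartAt (𝓡 n) c).source) (v w : EuclideanSpace ℝ (Fin n)) :
    lc (coordField c w) q (coordField c v q) = lc (coordField c v) q (coordField c w q) := by
  have h := (lc.torsion_eq_zero_iff.1 ht)
    ((isSmoothFieldAt_coordField hq v).mdifferentiableAt (by simp))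
    ((isSmoothFieldAt_coordField hq w).mdifferentiableAt (by simp))
  rw [mlieBracket_coordField hq] at h
  exact sub_eq_zero.1 h

variable [ContMDiffVectorBundle ∞ F S (𝓡 n)] [FiniteDimensional ℝ F]
  [IsContMDiffRiemannianBundle (𝓡 n) ∞ F S]

instance : IsContMDiffRiemannianBundle (𝓡 n) 1 F S :=
  IsContMDiffRiemannianBundle.of_le (n := ∞) ENat.LEInfty.out

lemma mvfderiv_inner (hm : cov.IsMetricCompatible) (hσ : IsSmoothAt n F σ p)
    (hτ : IsSmoothAt n F τ p) (u : TangentSpace (𝓡 n) p) :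
    mvfderiv (𝓡 n) (fun q ↦ inner ℝ (σ q) (τ q)) p u
      = inner ℝ (cov σ p u) (τ p) + inner ℝ (σ p) (cov τ p u) := by
  simpa using hm.mvfderiv_inner_eq (FiberBundle.extend (EuclideanSpace ℝ (Fin n)) u)
    (hσ.mdifferentiableAt (by simp)) (hτ.mdifferentiableAt (by simp))

end Connections

section LeviCivita

open scoped Topology

variable {n : ℕ} {M : Type*} [TopologicalSpace M] [ChartedSpace (EuclideanSpace ℝ (Fin n)) M]
  [RiemannianBundle (fun x : M ↦ TangentSpace (𝓡 n) x)] {f : M → ℝ} {p : M}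

/-- The gradient of a function. -/
def gradient (f : M → ℝ) (p : M) : TangentSpace (𝓡 n) p :=
  ∑ i, mvfderiv (𝓡 n) f p (frame p i) • frame p i

lemma inner_gradient (u : TangentSpace (𝓡 n) p) :
    inner ℝ (gradient f p) u = mvfderiv (𝓡 n) f p u := by
  simp only [gradient, sum_inner, real_inner_smul_left]
  conv_rhs => rw [← (frame p).sum_repr' u]
  simp only [map_sum, map_smul, smul_eq_mul, mul_comm]

variable [IsManifold (𝓡 n) ∞ M]
  {lc : CovariantDerivative (𝓡 n) (EuclideanSpace ℝ (Fin n)) (TangentSpace (𝓡 n) : M → Type _)}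

/-- The divergence of a vector field with respect to a connection. -/
def divergence (lc : CovariantDerivative (𝓡 n) (EuclideanSpace ℝ (Fin n))
    (TangentSpace (𝓡 n) : M → Type _)) (U : Π p : M, TangentSpace (𝓡 n) p) (p : M) : ℝ :=
  LinearMap.trace ℝ (TangentSpace (𝓡 n) p) (lc U p)

/-- The Laplacian of a function, with the sign convention `Δf = div grad f`. -/
def laplacian (lc : CovariantDerivative (𝓡 n) (EuclideanSpace ℝ (Fin n))
    (TangentSpace (𝓡 n) : M → Type _)) (f : M → ℝ) (p : M) : ℝ :=
  divergence lc (gradient f) p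

lemma divergence_eq_sum_inner (U : Π p : M, TangentSpace (𝓡 n) p) (p : M) :
    divergence lc U p = ∑ i, inner ℝ (lc U p (frame p i)) (frame p i) :=
  ((lc U p).toLinearMap.trace_eq_sum_inner (frame p)).trans
    (Finset.sum_congr rfl fun _ _ ↦ real_inner_comm _ _)

lemma divergence_smul {U : Π p : M, TangentSpace (𝓡 n) p}
    (hf : ContMDiffAt (𝓡 n) 𝓘(ℝ, ℝ) ∞ f p) (hU : IsSmoothFieldAt U p) :
    divergence lc (fun q ↦ f q • U q) p = f p * divergence lc U p + mvfderiv (𝓡 n) f p (U p) := by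
  have h : (lc (fun q ↦ f q • U q) p : TangentSpace (𝓡 n) p →ₗ[ℝ] TangentSpace (𝓡 n) p) =
      f p • (lc U p : TangentSpace (𝓡 n) p →ₗ[ℝ] TangentSpace (𝓡 n) p) +
        (mvfderiv (𝓡 n) f p).toLinearMap.smulRight (U p) :=
    LinearMap.ext fun u ↦ conn_smul_apply hf hU u
  rw [divergence, h, map_add, map_smul, LinearMap.trace_smulRight]
  rfl

lemma divergence_sum {ι : Type*} (s : Finset ι) {U : ι → Π p : M, TangentSpace (𝓡 n) p}
    (hU : ∀ i, IsSmoothFieldAt (U i) p) :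
    divergence lc (fun q ↦ ∑ i ∈ s, U i q) p = ∑ i ∈ s, divergence lc (U i) p := by
  have h : (lc (fun q ↦ ∑ i ∈ s, U i q) p : TangentSpace (𝓡 n) p →ₗ[ℝ] TangentSpace (𝓡 n) p) =
      ∑ i ∈ s, (lc (U i) p : TangentSpace (𝓡 n) p →ₗ[ℝ] TangentSpace (𝓡 n) p) :=
    LinearMap.ext fun u ↦ (conn_sum_apply s hU u).trans (by simp)
  rw [divergence, h, map_sum]
  rfl

lemma divergence_congr {U V : Π p : M, TangentSpace (𝓡 n) p} (hV : IsSmoothFieldAt V p)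
    (h : ∀ᶠ q in 𝓝 p, U q = V q) : divergence lc U p = divergence lc V p := by
  rw [divergence, divergence, conn_congr hV h]

variable [IsContMDiffRiemannianBundle (𝓡 n) ∞ (EuclideanSpace ℝ (Fin n))
    (fun x : M ↦ TangentSpace (𝓡 n) x)]

lemma isSmoothField_gradient (hf : ContMDiff (𝓡 n) 𝓘(ℝ, ℝ) ∞ f) :
    IsSmoothField (gradient f : Π p : M, TangentSpace (𝓡 n) p) := by
  intro p
  have hsmooth : IsSmoothFieldAt
      (fun q ↦ ∑ i, mvfderiv (𝓡 n) f q (dualCoordFrame p i q) • coordFrame p i q) p :=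
    ContMDiffAt.sum_section fun i _ ↦ ContMDiffAt.smul_section
      (contMDiffAt_mvfderiv_apply hf
        (isSmoothFieldAt_dualCoordFrame (mem_extChartAt_source p) i))
      (isSmoothFieldAt_coordField (mem_extChartAt_source p) _)
  refine hsmooth.congr_of_eventuallyEq ?_
  filter_upwards [extChartAt_source_mem_nhds (I := 𝓡 n) p] with q hq
  conv_lhs => rw [← sum_inner_dualCoordFrame_smul hq (gradient f q)]
  simp only [real_inner_comm _ (dualCoordFrame p _ q), inner_gradient]

lemma inner_conn_gradient_comm (ht : lc.torsion = 0) (hm : lc.IsMetricCompatible)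
    (hf : ContMDiff (𝓡 n) 𝓘(ℝ, ℝ) ∞ f) (u w : TangentSpace (𝓡 n) p) :
    inner ℝ (lc (gradient f) p u) w = inner ℝ (lc (gradient f) p w) u := by
  have hp := mem_extChartAt_source (I := 𝓡 n) p
  obtain ⟨v, rfl⟩ := (bijective_coordField hp).surjective u
  obtain ⟨v', rfl⟩ := (bijective_coordField hp).surjective w
  have hleibniz (v v' : EuclideanSpace ℝ (Fin n)) :=
    mvfderiv_inner hm (isSmoothField_gradient hf p) (isSmoothFieldAt_coordField hp v')
      (coordField p v p)
  have h := mvfderiv_mvfderiv_coordField hp hf v v'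
  simp only [← inner_gradient (f := f)] at h
  rw [hleibniz, hleibniz, conn_coordField_comm ht hp] at h
  exact add_right_cancel h

end LeviCivita

section Density

open scoped Topology

lemma sqrt_det_gram {n : ℕ} {Y : Type*} [NormedAddCommGroup Y] [InnerProductSpace ℝ Y]
    (L : EuclideanSpace ℝ (Fin n) →ₗ[ℝ] Y) :
    √(Matrix.gram ℝ fun i ↦ L (EuclideanSpace.single i 1)).det = L.normDet := by
  have h := L.normDet_sq_eq_det_gram (EuclideanSpace.basisFun (Fin n) ℝ)
  rw [← Real.sqrt_sq (LinearMap.normDet_nonneg _)]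
  congr 1
  refine Eq.trans ?_ h.symm
  simp

variable {n : ℕ} {M : Type*} [TopologicalSpace M] [ChartedSpace (EuclideanSpace ℝ (Fin n)) M]
  [IsManifold (𝓡 n) ∞ M]

lemma coordField_change_of_charts {p q : M} {y : EuclideanSpace ℝ (Fin n)}
    (hy : y ∈ (extChartAt (𝓡 n) p).target)
    (hyq : (extChartAt (𝓡 n) p).symm y ∈ (extChartAt (𝓡 n) q).source)
    (w : EuclideanSpace ℝ (Fin n)) :
    coordField p w ((extChartAt (𝓡 n) p).symm y) =
      coordField q (fderiv ℝ (extChartAt (𝓡 n) q ∘ (extChartAt (𝓡 n) p).symm) y w)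
        ((extChartAt (𝓡 n) p).symm y) := by
  have hdiff : MDifferentiableAt (𝓡 n) 𝓘(ℝ, EuclideanSpace ℝ (Fin n)) (extChartAt (𝓡 n) q)
      ((extChartAt (𝓡 n) p).symm y) :=
    mdifferentiableAt_extChartAt (by rwa [extChartAt_source] at hyq)
  rw [← mvfderiv_coordField hy hdiff]
  exact ((isInvertible_mfderiv_extChartAt hyq).inverse_apply_self _).symm

variable [RiemannianBundle (fun x : M ↦ TangentSpace (𝓡 n) x)]

lemma gramMatrix_eq_gram_coordFrame {c : M} {y : EuclideanSpace ℝ (Fin n)}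
    (hy : y ∈ (extChartAt (𝓡 n) c).target) :
    gramMatrix c y =
      Matrix.gram ℝ fun i : Fin n ↦ coordFrame c i ((extChartAt (𝓡 n) c).symm y) := by
  exact Matrix.ext fun i j ↦ congrArg₂ (inner ℝ)
    (coordField_extChartAt_symm hy (EuclideanSpace.single i 1)).symm
    (coordField_extChartAt_symm hy (EuclideanSpace.single j 1)).symm

lemma det_gramMatrix_pos {c : M} {y : EuclideanSpace ℝ (Fin n)}
    (hy : y ∈ (extChartAt (𝓡 n) c).target) : 0 < (gramMatrix c y).det := by
  obtain ⟨b, hb⟩ := exists_basis_eq_coordFrame ((extChartAt (𝓡 n) c).map_target hy)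
  rw [gramMatrix_eq_gram_coordFrame hy]
  simp only [← hb]
  exact (Matrix.posDef_gram_of_linearIndependent b.linearIndependent).det_pos

lemma sqrt_det_gramMatrix_change_of_charts {p q : M} {y : EuclideanSpace ℝ (Fin n)}
    (hy : y ∈ (extChartAt (𝓡 n) p).target)
    (hyq : (extChartAt (𝓡 n) p).symm y ∈ (extChartAt (𝓡 n) q).source) :
    √(gramMatrix p y).det =
      |(fderiv ℝ (extChartAt (𝓡 n) q ∘ (extChartAt (𝓡 n) p).symm) y).det| *
        √(gramMatrix q (extChartAt (𝓡 n) q ((extChartAt (𝓡 n) p).symm y))).det := by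
  set r := (extChartAt (𝓡 n) p).symm y
  let L : EuclideanSpace ℝ (Fin n) →ₗ[ℝ] TangentSpace (𝓡 n) r :=
    (mfderiv (𝓡 n) 𝓘(ℝ, EuclideanSpace ℝ (Fin n)) (extChartAt (𝓡 n) q) r).inverse.toLinearMap
  let A := (fderiv ℝ (extChartAt (𝓡 n) q ∘ (extChartAt (𝓡 n) p).symm) y).toLinearMap
  have hp : √(gramMatrix p y).det = (L ∘ₗ A).normDet := by
    rw [← sqrt_det_gram, gramMatrix_eq_gram_coordFrame hy]
    exact congrArg (fun v ↦ √(Matrix.gram ℝ v).det)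
      (funext fun i ↦ coordField_change_of_charts hy hyq _)
  have hq : √(gramMatrix q (extChartAt (𝓡 n) q r)).det = L.normDet := by
    rw [← sqrt_det_gram, gramMatrix_eq_gram_coordFrame ((extChartAt (𝓡 n) q).map_source hyq),
      (extChartAt (𝓡 n) q).left_inv hyq]
    rfl
  rw [hp, hq, LinearMap.normDet_comp_of_finrank_eq _ _ rfl, LinearMap.normDet_eq_norm_det,
    mul_comm]
  rfl

variable [IsContMDiffRiemannianBundle (𝓡 n) ∞ (EuclideanSpace ℝ (Fin n))
    (fun x : M ↦ TangentSpace (𝓡 n) x)]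

lemma contDiffAt_gramMatrix_apply {c : M} {y : EuclideanSpace ℝ (Fin n)}
    (hy : y ∈ (extChartAt (𝓡 n) c).target) (i j : Fin n) :
    ContDiffAt ℝ ∞ (fun y ↦ gramMatrix c y i j) y := by
  have hq := (extChartAt (𝓡 n) c).map_target hy
  have hsmooth : ContMDiffAt (𝓡 n) 𝓘(ℝ, ℝ) ∞
      (fun q ↦ inner ℝ (coordFrame c i q) (coordFrame c j q)) ((extChartAt (𝓡 n) c).symm y) :=
    ContMDiffAt.inner_bundle (isSmoothFieldAt_coordField hq _) (isSmoothFieldAt_coordField hq _)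
  refine (contDiffAt_comp_extChartAt_symm hy hsmooth).congr_of_eventuallyEq ?_
  filter_upwards [(isOpen_extChartAt_target c).mem_nhds hy] with z hz
  rw [gramMatrix_eq_gram_coordFrame hz]
  rfl

lemma contDiffAt_sqrt_det_gramMatrix {c : M} {y : EuclideanSpace ℝ (Fin n)}
    (hy : y ∈ (extChartAt (𝓡 n) c).target) :
    ContDiffAt ℝ ∞ (fun y ↦ √(gramMatrix c y).det) y := by
  simp only [Matrix.det_apply']
  refine (ContDiffAt.sum fun s _ ↦ contDiffAt_const.mul
    (contDiffAt_prod fun i _ ↦ contDiffAt_gramMatrix_apply hy (s i) i)).sqrt ?_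
  rw [← Matrix.det_apply']
  exact (det_gramMatrix_pos hy).ne'

lemma continuousOn_sqrt_det_gramMatrix (c : M) :
    ContinuousOn (fun y ↦ √(gramMatrix c y).det) (extChartAt (𝓡 n) c).target :=
  fun _ hy ↦ (contDiffAt_sqrt_det_gramMatrix hy).continuousAt.continuousWithinAt

lemma aemeasurable_volumeDensity (c : M) :
    AEMeasurable (fun y ↦ ENNReal.ofReal (√(gramMatrix c y).det))
      (volume.restrict (extChartAt (𝓡 n) c).target) :=
  ((continuousOn_sqrt_det_gramMatrix c).aemeasurable
    (isOpen_extChartAt_target c).measurableSet).ennreal_ofReal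

end Density

section Volume

open scoped Topology

section Measurability

variable {n : ℕ} {M : Type*} [TopologicalSpace M] [ChartedSpace (EuclideanSpace ℝ (Fin n)) M]
  [MeasurableSpace M]

lemma chartVolume_le_riemannianVolume [RiemannianBundle (fun x : M ↦ TangentSpace (𝓡 n) x)]
    (c : M) :
    chartVolume (n := n) c ≤ riemannianVolume (n := n) M :=
  le_iSup (fun p : M ↦ chartVolume (n := n) p) c

variable [BorelSpace M]

lemma aemeasurable_extChartAt_symm (c : M) :
    AEMeasurable (extChartAt (𝓡 n) c).symm (volume.restrict (extChartAt (𝓡 n) c).target) :=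
  (continuousOn_extChartAt_symm c).aemeasurable (isOpen_extChartAt_target c).measurableSet

lemma measurableSet_image_extChartAt {c : M} {A : Set M} (hA : MeasurableSet A)
    (hc : A ⊆ (extChartAt (𝓡 n) c).source) : MeasurableSet (extChartAt (𝓡 n) c '' A) := by
  have hcont : Continuous fun y : (extChartAt (𝓡 n) c).target ↦ (extChartAt (𝓡 n) c).symm y :=
    continuousOn_iff_continuous_domRestrict.1 (continuousOn_extChartAt_symm c)
  have himage := (isOpen_extChartAt_target (I := 𝓡 n) c).measurableSet.subtype_image
    (hcont.measurable hA)
  rw [(extChartAt (𝓡 n) c).image_eq_target_inter_inv_preimage hc]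
  convert himage using 1
  ext y
  simp [and_comm]

variable [RiemannianBundle (fun x : M ↦ TangentSpace (𝓡 n) x)]

lemma aemeasurable_extChartAt_symm_withDensity (c : M) :
    AEMeasurable (extChartAt (𝓡 n) c).symm
      ((volume.restrict (extChartAt (𝓡 n) c).target).withDensity
        fun y ↦ ENNReal.ofReal (√(gramMatrix c y).det)) :=
  (aemeasurable_extChartAt_symm c).mono_ac (withDensity_absolutelyContinuous _ _)

lemma chartVolume_apply (c : M) {A : Set M} (hA : MeasurableSet A) :
    chartVolume (n := n) c A =
      ∫⁻ y in extChartAt (𝓡 n) c '' ((extChartAt (𝓡 n) c).source ∩ A),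
        ENNReal.ofReal (√(gramMatrix c y).det) := by
  have hnull := (aemeasurable_extChartAt_symm (n := n) c).nullMeasurable hA
  rw [chartVolume,
    Measure.map_apply_of_aemeasurable (aemeasurable_extChartAt_symm_withDensity c) hA,
    withDensity_apply₀ _ hnull, Measure.restrict_restrict₀ hnull,
    PartialEquiv.image_source_inter_eq', Set.inter_comm]

lemma chartVolume_compl_source (c : M) :
    chartVolume (n := n) c (extChartAt (𝓡 n) c).sourceᶜ = 0 := by
  rw [chartVolume_apply c (isOpen_extChartAt_source c).measurableSet.compl]
  simp

end Measurability

variable {n : ℕ} {M : Type*} [TopologicalSpace M] [ChartedSpace (EuclideanSpace ℝ (Fin n)) M]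
  [IsManifold (𝓡 n) ∞ M] [RiemannianBundle (fun x : M ↦ TangentSpace (𝓡 n) x)]
  [MeasurableSpace M] [BorelSpace M]

lemma chartVolume_eq_of_subset {p q : M} {A : Set M} (hA : MeasurableSet A)
    (hp : A ⊆ (extChartAt (𝓡 n) p).source) (hq : A ⊆ (extChartAt (𝓡 n) q).source) :
    chartVolume (n := n) p A = chartVolume (n := n) q A := by
  rw [chartVolume_apply p hA, chartVolume_apply q hA, Set.inter_eq_right.2 hp,
    Set.inter_eq_right.2 hq]
  set T := extChartAt (𝓡 n) q ∘ (extChartAt (𝓡 n) p).symm with hT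
  have hleft {r : M} (hr : r ∈ A) : T (extChartAt (𝓡 n) p r) = extChartAt (𝓡 n) q r := by
    rw [hT, Function.comp_apply, (extChartAt (𝓡 n) p).left_inv (hp hr)]
  have himage : extChartAt (𝓡 n) q '' A = T '' (extChartAt (𝓡 n) p '' A) := by
    rw [Set.image_image]
    exact Set.image_congr fun r hr ↦ (hleft hr).symm
  have hinj : Set.InjOn T (extChartAt (𝓡 n) p '' A) := by
    rintro _ ⟨r, hr, rfl⟩ _ ⟨s, hs, rfl⟩ h
    rw [hleft hr, hleft hs] at h
    rw [(extChartAt (𝓡 n) q).injOn (hq hr) (hq hs) h]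
  have hmem : ∀ y ∈ extChartAt (𝓡 n) p '' A, y ∈ (extChartAt (𝓡 n) p).target ∧
      (extChartAt (𝓡 n) p).symm y ∈ (extChartAt (𝓡 n) q).source := by
    rintro _ ⟨r, hr, rfl⟩
    rw [(extChartAt (𝓡 n) p).left_inv (hp hr)]
    exact ⟨(extChartAt (𝓡 n) p).map_source (hp hr), hq hr⟩
  have hderiv : ∀ y ∈ extChartAt (𝓡 n) p '' A,
      HasFDerivWithinAt T (fderiv ℝ T y) (extChartAt (𝓡 n) p '' A) y := fun y hy ↦
    ((contDiffAt_comp_extChartAt_symm (hmem y hy).1 (contMDiffAt_extChartAt'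
      (by simpa only [extChartAt_source] using (hmem y hy).2))).differentiableAt
      (by simp)).hasFDerivAt.hasFDerivWithinAt
  rw [himage, lintegral_image_eq_lintegral_abs_det_fderiv_mul volume
    (measurableSet_image_extChartAt hA hp) hderiv hinj]
  refine setLIntegral_congr_fun (measurableSet_image_extChartAt hA hp) fun y hy ↦ ?_
  rw [← ENNReal.ofReal_mul (abs_nonneg _),
    sqrt_det_gramMatrix_change_of_charts (hmem y hy).1 (hmem y hy).2]
  rfl

lemma riemannianVolume_le_add_restrict_compl (c : M) :
    riemannianVolume (n := n) M ≤ chartVolume (n := n) c +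
      (riemannianVolume (n := n) M).restrict (extChartAt (𝓡 n) c).sourceᶜ := by
  have hsource (q : M) : MeasurableSet (extChartAt (𝓡 n) q).source :=
    (isOpen_extChartAt_source q).measurableSet
  refine iSup_le fun q ↦ Measure.le_iff.2 fun A hA ↦ ?_
  rw [← measure_inter_add_sdiff A (hsource c), Measure.add_apply, Measure.restrict_apply hA]
  refine add_le_add ?_ (chartVolume_le_riemannianVolume q _)
  rw [← measure_inter_add_sdiff (A ∩ _) (hsource q),
    measure_mono_null (Set.sdiff_subset_compl _ _) (chartVolume_compl_source q), add_zero,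
    chartVolume_eq_of_subset (p := q) (q := c) ((hA.inter (hsource c)).inter (hsource q))
      Set.inter_subset_right (Set.inter_subset_left.trans Set.inter_subset_right)]
  exact measure_mono (Set.inter_subset_left.trans Set.inter_subset_left)

lemma restrict_riemannianVolume (c : M) :
    (riemannianVolume (n := n) M).restrict (extChartAt (𝓡 n) c).source =
      chartVolume (n := n) c := by
  have hsource : MeasurableSet (extChartAt (𝓡 n) c).source :=
    (isOpen_extChartAt_source c).measurableSet
  have hchart :
      (chartVolume (n := n) c).restrict (extChartAt (𝓡 n) c).source = chartVolume (n := n) c :=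
    Measure.restrict_eq_self_of_ae_mem (chartVolume_compl_source c)
  refine le_antisymm ?_ (hchart.symm.le.trans
    (Measure.restrict_mono_measure (chartVolume_le_riemannianVolume c) _))
  refine (Measure.restrict_mono_measure (riemannianVolume_le_add_restrict_compl c) _).trans ?_
  rw [Measure.restrict_add, hchart, Measure.restrict_restrict hsource, Set.inter_compl_self,
    Measure.restrict_empty, add_zero]

variable [IsContMDiffRiemannianBundle (𝓡 n) ∞ (EuclideanSpace ℝ (Fin n))
    (fun x : M ↦ TangentSpace (𝓡 n) x)]

instance : IsLocallyFiniteMeasure (riemannianVolume (n := n) M) where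
  finiteAtNhds p := by
    obtain ⟨K, hK, hKn, hKc⟩ := local_compact_nhds
      ((isOpen_extChartAt_target (I := 𝓡 n) p).mem_nhds (mem_extChartAt_target p))
    obtain ⟨C, hC⟩ := hKc.exists_bound_of_continuousOn
      ((continuousOn_sqrt_det_gramMatrix p).mono hKn)
    set U := (extChartAt (𝓡 n) p).source ∩ extChartAt (𝓡 n) p ⁻¹' interior K
    have hUopen : IsOpen U :=
      (continuousOn_extChartAt p).isOpen_inter_preimage (isOpen_extChartAt_source p) isOpen_interior
    have hUK : extChartAt (𝓡 n) p '' ((extChartAt (𝓡 n) p).source ∩ U) ⊆ K :=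
      Set.image_subset_iff.2 fun q hq ↦ interior_subset (s := K) hq.2.2
    refine ⟨U, hUopen.mem_nhds ⟨mem_extChartAt_source p, mem_interior_iff_mem_nhds.2 hK⟩, ?_⟩
    rw [← Measure.restrict_eq_self _ (Set.inter_subset_left : U ⊆ _), restrict_riemannianVolume,
      chartVolume_apply p hUopen.measurableSet]
    refine setLIntegral_lt_top_of_le_nnreal (ne_top_of_le_ne_top hKc.measure_lt_top.ne
      (measure_mono hUK)) ⟨C.toNNReal, fun y hy ↦ ?_⟩
    exact ENNReal.ofReal_le_ofReal ((Real.le_norm_self _).trans (hC y (hUK hy)))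

lemma setIntegral_extChartAt_source (c : M) {g : M → ℝ} (hg : Continuous g) :
    ∫ q in (extChartAt (𝓡 n) c).source, g q ∂(riemannianVolume (n := n) M) =
      ∫ y in (extChartAt (𝓡 n) c).target,
        √(gramMatrix c y).det * g ((extChartAt (𝓡 n) c).symm y) := by
  rw [restrict_riemannianVolume, chartVolume,
    integral_map (aemeasurable_extChartAt_symm_withDensity c) hg.aestronglyMeasurable,
    integral_withDensity_eq_integral_toReal_smul₀ (aemeasurable_volumeDensity c) (by simp)]
  simp only [smul_eq_mul, ENNReal.toReal_ofReal (Real.sqrt_nonneg _)]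

end Volume

section Divergence

open scoped Topology

variable {n : ℕ} {M : Type*} [TopologicalSpace M] [ChartedSpace (EuclideanSpace ℝ (Fin n)) M]
  [IsManifold (𝓡 n) ∞ M] [RiemannianBundle (fun x : M ↦ TangentSpace (𝓡 n) x)]
  [IsContMDiffRiemannianBundle (𝓡 n) ∞ (EuclideanSpace ℝ (Fin n))
    (fun x : M ↦ TangentSpace (𝓡 n) x)]
  {lc : CovariantDerivative (𝓡 n) (EuclideanSpace ℝ (Fin n)) (TangentSpace (𝓡 n) : M → Type _)}
  {c : M} {y : EuclideanSpace ℝ (Fin n)} {U : Π p : M, TangentSpace (𝓡 n) p}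

lemma fderiv_gramMatrix_apply (hm : lc.IsMetricCompatible)
    (hy : y ∈ (extChartAt (𝓡 n) c).target) (v : EuclideanSpace ℝ (Fin n)) (i j : Fin n) :
    fderiv ℝ (fun y ↦ gramMatrix c y i j) y v =
      inner ℝ (lc (coordFrame c i) ((extChartAt (𝓡 n) c).symm y) (coordField c v _))
        (coordFrame c j _) +
      inner ℝ (coordFrame c i _)
        (lc (coordFrame c j) ((extChartAt (𝓡 n) c).symm y) (coordField c v _)) := by
  have hq := (extChartAt (𝓡 n) c).map_target hy
  have hsmooth (i : Fin n) : IsSmoothFieldAt (coordFrame c i) ((extChartAt (𝓡 n) c).symm y) :=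
    isSmoothFieldAt_coordField hq _
  rw [← mvfderiv_inner hm (hsmooth i) (hsmooth j), mvfderiv_coordField hy
    ((ContMDiffAt.inner_bundle (hsmooth i) (hsmooth j)).mdifferentiableAt (by simp))]
  refine congrArg (fun L : _ →L[ℝ] ℝ ↦ L v) (EventuallyEq.fderiv_eq ?_)
  filter_upwards [(isOpen_extChartAt_target c).mem_nhds hy] with z hz
  rw [gramMatrix_eq_gram_coordFrame hz]
  rfl

lemma fderiv_sqrt_det_gramMatrix (ht : lc.torsion = 0) (hm : lc.IsMetricCompatible)
    (hy : y ∈ (extChartAt (𝓡 n) c).target) (k : Fin n) :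
    fderiv ℝ (fun y ↦ √(gramMatrix c y).det) y (EuclideanSpace.single k 1) =
      √(gramMatrix c y).det * divergence lc (coordFrame c k) ((extChartAt (𝓡 n) c).symm y) := by
  have hq := (extChartAt (𝓡 n) c).map_target hy
  set q := (extChartAt (𝓡 n) c).symm y
  -- The Christoffel symbols `Γˡₖᵢ`.
  let Γ : Matrix (Fin n) (Fin n) ℝ := Matrix.of fun l i ↦
    inner ℝ (dualCoordFrame c l q) (lc (coordFrame c i) q (coordFrame c k q))
  have hΓ (i j : Fin n) : fderiv ℝ (fun y ↦ gramMatrix c y i j) y (EuclideanSpace.single k 1) =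
      (Γ.transpose * gramMatrix c y + gramMatrix c y * Γ) i j := by
    have hconn (i : Fin n) :
        lc (coordFrame c i) q (coordFrame c k q) = ∑ l, Γ l i • coordFrame c l q :=
      (sum_inner_dualCoordFrame_smul hq _).symm
    rw [fderiv_gramMatrix_apply hm hy, hconn, hconn, gramMatrix_eq_gram_coordFrame hy]
    simp only [sum_inner, inner_sum, real_inner_smul_left, real_inner_smul_right,
      Matrix.add_apply, Matrix.mul_apply, Matrix.transpose_apply, Matrix.gram_apply, mul_comm]
    rfl
  have htrace : Γ.trace = divergence lc (coordFrame c k) q := by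
    rw [divergence, trace_eq_sum_inner_of_dual (sum_inner_dualCoordFrame_smul hq)]
    exact Finset.sum_congr rfl fun l _ ↦ congrArg _ (conn_coordField_comm ht hq _ _)
  rw [fderiv_sqrt_det (fun i j ↦ (contDiffAt_gramMatrix_apply hy i j).differentiableAt (by simp))
    (det_gramMatrix_pos hy) hΓ, htrace]

/-- The `i`-th component of a vector field `U` in the chart at `c`, multiplied by the volume density
of the chart. -/
def densityComponent (c : M) (U : Π p : M, TangentSpace (𝓡 n) p) (i : Fin n)
    (y : EuclideanSpace ℝ (Fin n)) : ℝ :=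
  √(gramMatrix c y).det * inner ℝ (dualCoordFrame c i ((extChartAt (𝓡 n) c).symm y)) (U _)

lemma contMDiffAt_inner_dualCoordFrame {q : M} (hq : q ∈ (extChartAt (𝓡 n) c).source)
    (hU : IsSmoothFieldAt U q) (i : Fin n) :
    ContMDiffAt (𝓡 n) 𝓘(ℝ, ℝ) ∞ (fun q ↦ inner ℝ (dualCoordFrame c i q) (U q)) q :=
  ContMDiffAt.inner_bundle (isSmoothFieldAt_dualCoordFrame hq i) hU

lemma contDiffAt_densityComponent (hy : y ∈ (extChartAt (𝓡 n) c).target)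
    (hU : IsSmoothFieldAt U ((extChartAt (𝓡 n) c).symm y)) (i : Fin n) :
    ContDiffAt ℝ ∞ (densityComponent c U i) y :=
  (contDiffAt_sqrt_det_gramMatrix hy).mul (contDiffAt_comp_extChartAt_symm hy
    (contMDiffAt_inner_dualCoordFrame ((extChartAt (𝓡 n) c).map_target hy) hU i))

lemma divergence_eq_sum_coordFrame {q : M} (hq : q ∈ (extChartAt (𝓡 n) c).source)
    (hU : IsSmoothFieldAt U q) :
    divergence lc U q = ∑ i, (inner ℝ (dualCoordFrame c i q) (U q) *
        divergence lc (coordFrame c i) q +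
      mvfderiv (𝓡 n) (fun q ↦ inner ℝ (dualCoordFrame c i q) (U q)) q (coordFrame c i q)) := by
  have hcoord := contMDiffAt_inner_dualCoordFrame hq hU
  have hframe (i : Fin n) : IsSmoothFieldAt (coordFrame c i) q := isSmoothFieldAt_coordField hq _
  have hterm (i : Fin n) : IsSmoothFieldAt
      (fun q ↦ inner ℝ (dualCoordFrame c i q) (U q) • coordFrame c i q) q :=
    ContMDiffAt.smul_section (hcoord i) (hframe i)
  rw [← divergence_congr hU (mem_of_superset ((isOpen_extChartAt_source c).mem_nhds hq)
    fun r hr ↦ sum_inner_dualCoordFrame_smul hr (U r)), divergence_sum _ hterm]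
  exact Finset.sum_congr rfl fun i _ ↦ divergence_smul (hcoord i) (hframe i)

lemma sum_fderiv_densityComponent (ht : lc.torsion = 0) (hm : lc.IsMetricCompatible)
    (hy : y ∈ (extChartAt (𝓡 n) c).target)
    (hU : IsSmoothFieldAt U ((extChartAt (𝓡 n) c).symm y)) :
    ∑ i, fderiv ℝ (densityComponent c U i) y (EuclideanSpace.single i 1) =
      √(gramMatrix c y).det * divergence lc U ((extChartAt (𝓡 n) c).symm y) := by
  have hq := (extChartAt (𝓡 n) c).map_target hy
  rw [divergence_eq_sum_coordFrame hq hU, Finset.mul_sum]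
  refine Finset.sum_congr rfl fun i _ ↦ ?_
  have hcoord := contMDiffAt_inner_dualCoordFrame hq hU i
  have hleibniz := fderiv_fun_mul
    ((contDiffAt_sqrt_det_gramMatrix hy).differentiableAt (by simp))
    ((contDiffAt_comp_extChartAt_symm hy hcoord).differentiableAt (by simp))
  rw [mvfderiv_coordField hy (hcoord.mdifferentiableAt (by simp))]
  refine (congrArg (fun L : _ →L[ℝ] ℝ ↦ L (EuclideanSpace.single i 1)) hleibniz).trans ?_
  simp only [add_apply, smul_apply, smul_eq_mul, fderiv_sqrt_det_gramMatrix ht hm hy,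
    Function.comp_apply]
  ring

lemma contMDiff_divergence (hs : CovariantDerivative.ContMDiffCovariantDerivative lc ∞)
    (hU : IsSmoothField U) : ContMDiff (𝓡 n) 𝓘(ℝ, ℝ) ∞ (divergence lc U) := by
  intro p
  have hsmooth : ContMDiffAt (𝓡 n) 𝓘(ℝ, ℝ) ∞
      (fun q ↦ ∑ i, inner ℝ (dualCoordFrame p i q) (lc U q (coordFrame p i q))) p :=
    contMDiffAt_finsetSum fun i _ ↦
      contMDiffAt_inner_dualCoordFrame (mem_extChartAt_source p)
        (isSmoothAt_conn_apply hs hU (isSmoothFieldAt_coordField (mem_extChartAt_source p) _)) i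
  refine hsmooth.congr_of_eventuallyEq ?_
  filter_upwards [extChartAt_source_mem_nhds (I := 𝓡 n) p] with q hq
  exact trace_eq_sum_inner_of_dual (sum_inner_dualCoordFrame_smul hq) _

end Divergence

section DivergenceTheorem

open scoped Topology

lemma integral_fderiv_eq_zero {E : Type*} [NormedAddCommGroup E] [NormedSpace ℝ E]
    [FiniteDimensional ℝ E] [MeasureSpace E] [BorelSpace E]
    [(volume : Measure E).IsAddHaarMeasure] {f : E → ℝ}
    (hf : ContDiff ℝ 1 f) (hc : HasCompactSupport f) (v : E) :
    Integrable (fun y ↦ fderiv ℝ f y v) ∧ ∫ y, fderiv ℝ f y v = 0 := by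
  have hf' : Continuous fun y ↦ fderiv ℝ f y v := by fun_prop
  have hint := hf'.integrable_of_hasCompactSupport (μ := volume) (hc.fderiv_apply ℝ v)
  have h := integral_mul_fderiv_eq_neg_fderiv_mul_of_integrable (μ := volume) (f := f)
    (g := fun _ ↦ (1 : ℝ)) (v := v) (by simpa using hint) (by simp)
    (by simpa using hf.continuous.integrable_of_hasCompactSupport hc)
    (fun y _ ↦ hf.differentiable one_ne_zero y) (fun y _ ↦ differentiableAt_const _)
  exact ⟨hint, by simpa using h⟩

lemma setIntegral_fderiv_eq_zero {E : Type*} [NormedAddCommGroup E] [NormedSpace ℝ E]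
    [FiniteDimensional ℝ E] [MeasureSpace E] [BorelSpace E]
    [(volume : Measure E).IsAddHaarMeasure] {f : E → ℝ} {Ω K : Set E} (hΩ : IsOpen Ω)
    (hK : IsCompact K) (hKΩ : K ⊆ Ω) (hf : ∀ y ∈ Ω, ContDiffAt ℝ 1 f y)
    (h0 : ∀ y ∈ Ω, y ∉ K → f y = 0) (v : E) :
    IntegrableOn (fun y ↦ fderiv ℝ f y v) Ω ∧ ∫ y in Ω, fderiv ℝ f y v = 0 := by
  have hzero (y : E) (hy : y ∉ K) : Ω.indicator f y = 0 := by
    by_cases hyΩ : y ∈ Ω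
    · rw [Set.indicator_of_mem hyΩ, h0 y hyΩ hy]
    · exact Set.indicator_of_notMem hyΩ f
  have hnear {y : E} (hy : y ∈ Ω) : Ω.indicator f =ᶠ[𝓝 y] f :=
    mem_of_superset (hΩ.mem_nhds hy) fun z hz ↦ Set.indicator_of_mem hz f
  have hfar {y : E} (hy : y ∉ K) : Ω.indicator f =ᶠ[𝓝 y] fun _ ↦ 0 :=
    mem_of_superset (hK.isClosed.isOpen_compl.mem_nhds hy) hzero
  have hsmooth : ContDiff ℝ 1 (Ω.indicator f) := contDiff_iff_contDiffAt.2 fun y ↦ by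
    by_cases hy : y ∈ Ω
    · exact (hf y hy).congr_of_eventuallyEq (hnear hy)
    · exact contDiffAt_const.congr_of_eventuallyEq (hfar fun h ↦ hy (hKΩ h))
  have heq : Set.EqOn (fun y ↦ fderiv ℝ (Ω.indicator f) y v) (fun y ↦ fderiv ℝ f y v) Ω :=
    fun y hy ↦ congrArg (fun L : E →L[ℝ] ℝ ↦ L v) (hnear hy).fderiv_eq
  obtain ⟨hint, h⟩ := integral_fderiv_eq_zero hsmooth (HasCompactSupport.intro hK hzero) v
  refine ⟨hint.integrableOn.congr_fun heq hΩ.measurableSet, ?_⟩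
  rw [← setIntegral_congr_fun hΩ.measurableSet heq,
    setIntegral_eq_integral_of_forall_compl_eq_zero fun y hy ↦ ?_, h]
  rw [(hfar fun h ↦ hy (hKΩ h)).fderiv_eq]
  simp

variable {n : ℕ} {M : Type*} [TopologicalSpace M] [CompactSpace M]
  [ChartedSpace (EuclideanSpace ℝ (Fin n)) M] [IsManifold (𝓡 n) ∞ M]
  [RiemannianBundle (fun x : M ↦ TangentSpace (𝓡 n) x)]
  [IsContMDiffRiemannianBundle (𝓡 n) ∞ (EuclideanSpace ℝ (Fin n))
    (fun x : M ↦ TangentSpace (𝓡 n) x)]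
  [MeasurableSpace M] [BorelSpace M]

lemma integrable_of_continuous {Y : Type*} [NormedAddCommGroup Y] [SecondCountableTopology Y]
    {g : M → Y} (hg : Continuous g) : Integrable g (riemannianVolume (n := n) M) := by
  have : IsFiniteMeasure (riemannianVolume (n := n) M) := CompactSpace.isFiniteMeasure
  obtain ⟨C, hC⟩ := isCompact_univ.exists_bound_of_continuousOn hg.continuousOn
  exact Integrable.of_bound hg.aestronglyMeasurable C (.of_forall fun p ↦ hC p trivial)

variable
  {lc : CovariantDerivative (𝓡 n) (EuclideanSpace ℝ (Fin n)) (TangentSpace (𝓡 n) : M → Type _)}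
  (hs : CovariantDerivative.ContMDiffCovariantDerivative lc ∞) (ht : lc.torsion = 0)
  (hm : lc.IsMetricCompatible)

include hs ht hm

lemma integral_divergence_of_eq_zero {U : Π p : M, TangentSpace (𝓡 n) p} (hU : IsSmoothField U)
    {c : M} {K : Set M} (hK : IsClosed K) (hKc : K ⊆ (extChartAt (𝓡 n) c).source)
    (h0 : ∀ q ∉ K, U q = 0) :
    ∫ q, divergence lc U q ∂(riemannianVolume (n := n) M) = 0 := by
  have hdiv (q : M) (hq : q ∉ (extChartAt (𝓡 n) c).source) : divergence lc U q = 0 := by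
    have hzero := divergence_smul (lc := lc) (contMDiffAt_const (c := (0 : ℝ))) (hU q)
    rw [divergence_congr (hU q) (mem_of_superset (hK.isOpen_compl.mem_nhds fun h ↦ hq (hKc h))
      fun r hr ↦ (zero_smul ℝ _).trans (h0 r hr).symm)] at hzero
    rw [hzero, mvfderiv_const]
    simp
  have hzero (i : Fin n) (y) (hy : y ∈ (extChartAt (𝓡 n) c).target)
      (hyK : y ∉ extChartAt (𝓡 n) c '' K) : densityComponent c U i y = 0 := by
    have hmem : (extChartAt (𝓡 n) c).symm y ∉ K := fun h ↦
      hyK ⟨_, h, (extChartAt (𝓡 n) c).right_inv hy⟩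
    rw [densityComponent, h0 _ hmem, inner_zero_right, mul_zero]
  have hcomp (i : Fin n) := setIntegral_fderiv_eq_zero (isOpen_extChartAt_target c)
    (hK.isCompact.image_of_continuousOn ((continuousOn_extChartAt c).mono hKc))
    (Set.image_subset_iff.2 fun q hq ↦ (extChartAt (𝓡 n) c).map_source (hKc hq))
    (fun y hy ↦ (contDiffAt_densityComponent hy (hU _) i).of_le (by exact ENat.LEInfty.out))
    (hzero i) (EuclideanSpace.single i 1)
  rw [← setIntegral_eq_integral_of_forall_compl_eq_zero hdiv,
    setIntegral_extChartAt_source c (contMDiff_divergence hs hU).continuous,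
    ← setIntegral_congr_fun (isOpen_extChartAt_target c).measurableSet
      fun y hy ↦ sum_fderiv_densityComponent ht hm hy (hU _),
    integral_finsetSum _ fun i _ ↦ (hcomp i).1]
  exact Finset.sum_eq_zero fun i _ ↦ (hcomp i).2

theorem integral_divergence [T2Space M] {U : Π p : M, TangentSpace (𝓡 n) p}
    (hU : IsSmoothField U) :
    ∫ q, divergence lc U q ∂(riemannianVolume (n := n) M) = 0 := by
  obtain ⟨t, hcover⟩ := isCompact_univ.elim_finite_subcover
    (fun p : M ↦ (extChartAt (𝓡 n) p).source) (fun p ↦ isOpen_extChartAt_source p)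
    (fun p _ ↦ Set.mem_iUnion.2 ⟨p, mem_extChartAt_source p⟩)
  obtain ⟨ρ, hρ⟩ := SmoothPartitionOfUnity.exists_isSubordinate (𝓡 n) (s := (Set.univ : Set M))
    isClosed_univ (fun p : t ↦ (extChartAt (𝓡 n) p.1).source)
    (fun p ↦ isOpen_extChartAt_source p.1) (by simpa [Set.iUnion_subtype] using hcover)
  have hρU (i : t) : IsSmoothField fun q ↦ ρ i q • U q :=
    ContMDiff.smul_section (ρ i).contMDiff hU
  have hsum (q : M) : ∑ i, ρ i q • U q = U q := by
    rw [← Finset.sum_smul, ← finsum_eq_sum_of_fintype, ρ.sum_eq_one (Set.mem_univ q), one_smul]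
  have hdiv (q : M) : divergence lc U q = ∑ i, divergence lc (fun q ↦ ρ i q • U q) q := by
    rw [← divergence_sum _ fun i ↦ hρU i q]
    exact divergence_congr (ContMDiffAt.sum_section fun i _ ↦ hρU i q)
      (.of_forall fun r ↦ (hsum r).symm)
  simp only [hdiv]
  rw [integral_finsetSum _ fun i _ ↦
    integrable_of_continuous (contMDiff_divergence hs (hρU i)).continuous]
  refine Finset.sum_eq_zero fun i _ ↦ integral_divergence_of_eq_zero hs ht hm (hρU i)
    (isClosed_tsupport (ρ i)) (hρ i) fun q hq ↦ ?_
  rw [image_eq_zero_of_notMem_tsupport hq, zero_smul]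

end DivergenceTheorem

/-! ### Maps to Euclidean space -/

lemma isSmoothFieldAt_extend {n : ℕ} {M : Type*} [TopologicalSpace M]
    [ChartedSpace (EuclideanSpace ℝ (Fin n)) M] [IsManifold (𝓡 n) ∞ M] {p : M}
    (w : TangentSpace (𝓡 n) p) :
    IsSmoothFieldAt (FiberBundle.extend (EuclideanSpace ℝ (Fin n)) w :
      Π q : M, TangentSpace (𝓡 n) q) p :=
  FiberBundle.contMDiffAt_extend (𝓡 n) (EuclideanSpace ℝ (Fin n)) w

section Immersions

variable {n N : ℕ} {M : Type*} [TopologicalSpace M] [ChartedSpace (EuclideanSpace ℝ (Fin n)) M]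
  {x : M → EuclideanSpace ℝ (Fin N)} {p : M}

/-- The coordinate function `⟨v, x⟩` of a map `x` to Euclidean space. -/
def coordFunction (x : M → EuclideanSpace ℝ (Fin N)) (v : EuclideanSpace ℝ (Fin N)) (q : M) : ℝ :=
  inner ℝ v (x q)

lemma contMDiff_coordFunction (hx : ContMDiff (𝓡 n) 𝓘(ℝ, EuclideanSpace ℝ (Fin N)) ∞ x)
    (v : EuclideanSpace ℝ (Fin N)) : ContMDiff (𝓡 n) 𝓘(ℝ, ℝ) ∞ (coordFunction x v) :=
  (innerSL ℝ v).contMDiff.comp hx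

lemma mvfderiv_inner_euclidean {f g : M → EuclideanSpace ℝ (Fin N)}
    (hf : ContMDiffAt (𝓡 n) 𝓘(ℝ, EuclideanSpace ℝ (Fin N)) ∞ f p)
    (hg : ContMDiffAt (𝓡 n) 𝓘(ℝ, EuclideanSpace ℝ (Fin N)) ∞ g p) (u : TangentSpace (𝓡 n) p) :
    mvfderiv (𝓡 n) (fun q ↦ inner ℝ (f q) (g q)) p u
      = inner ℝ (f p) (mvfderiv (𝓡 n) g p u) + inner ℝ (mvfderiv (𝓡 n) f p u) (g p) := by
  have hf' := (hf.mdifferentiableAt (by simp)).hasMFDerivAt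
  have hg' := (hg.mdifferentiableAt (by simp)).hasMFDerivAt
  have h : HasMFDerivAt (𝓡 n) 𝓘(ℝ, ℝ) (fun q ↦ inner ℝ (f q) (g q)) p _ :=
    ⟨hf'.1.inner hg'.1, hf'.2.inner ℝ hg'.2⟩
  refine (DFunLike.congr_fun h.mfderiv u).trans ?_
  simp only [writtenInExtChartAt, Function.comp_apply, extChartAt_to_inv]
  rfl

lemma mvfderiv_inner_const {g : M → EuclideanSpace ℝ (Fin N)}
    (hg : ContMDiffAt (𝓡 n) 𝓘(ℝ, EuclideanSpace ℝ (Fin N)) ∞ g p) (v : EuclideanSpace ℝ (Fin N))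
    (u : TangentSpace (𝓡 n) p) :
    mvfderiv (𝓡 n) (fun q ↦ inner ℝ v (g q)) p u = inner ℝ v (mvfderiv (𝓡 n) g p u) := by
  rw [mvfderiv_inner_euclidean contMDiffAt_const hg, mvfderiv_const]
  simp

lemma mvfderiv_sub_const (hx : ContMDiff (𝓡 n) 𝓘(ℝ, EuclideanSpace ℝ (Fin N)) ∞ x)
    (c : EuclideanSpace ℝ (Fin N)) (p : M) :
    mvfderiv (𝓡 n) (fun q ↦ x q - c) p = mvfderiv (𝓡 n) x p := by
  rw [mvfderiv_fun_sub ((hx p).mdifferentiableAt (by simp)) mdifferentiableAt_const,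
    mvfderiv_const, sub_zero]

variable [RiemannianBundle (fun x : M ↦ TangentSpace (𝓡 n) x)]

/-- Smooth isometric immersions into Euclidean space. -/
structure IsIsometricImmersion (x : M → EuclideanSpace ℝ (Fin N)) : Prop where
  smooth : ContMDiff (𝓡 n) 𝓘(ℝ, EuclideanSpace ℝ (Fin N)) ∞ x
  inner_mvfderiv : ∀ (p : M) (u v : TangentSpace (𝓡 n) p),
    inner ℝ (mvfderiv (𝓡 n) x p u) (mvfderiv (𝓡 n) x p v) = inner ℝ u v

lemma IsIsometricImmersion.sub_const (hx : IsIsometricImmersion (n := n) x)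
    (c : EuclideanSpace ℝ (Fin N)) : IsIsometricImmersion (n := n) fun p ↦ x p - c where
  smooth := hx.smooth.sub contMDiff_const
  inner_mvfderiv := by
    simp only [mvfderiv_sub_const hx.smooth]
    exact hx.inner_mvfderiv

variable {ι : Type*} [Fintype ι] (b : OrthonormalBasis ι ℝ (EuclideanSpace ℝ (Fin N)))

lemma inner_gradient_coordFunction (hx : ContMDiff (𝓡 n) 𝓘(ℝ, EuclideanSpace ℝ (Fin N)) ∞ x)
    (v : EuclideanSpace ℝ (Fin N)) (u : TangentSpace (𝓡 n) p) :
    inner ℝ (gradient (coordFunction x v) p) u = inner ℝ v (mvfderiv (𝓡 n) x p u) :=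
  (inner_gradient u).trans (mvfderiv_inner_const (hx p) v u)

lemma sum_inner_gradient_coordFunction_smul (hx : IsIsometricImmersion (n := n) x)
    (u : TangentSpace (𝓡 n) p) :
    ∑ i, inner ℝ (gradient (coordFunction x (b i)) p) u • gradient (coordFunction x (b i)) p
      = u := by
  refine ext_inner_right ℝ fun w ↦ ?_
  simp only [sum_inner, real_inner_smul_left, inner_gradient_coordFunction hx.smooth]
  rw [← hx.inner_mvfderiv, ← b.sum_inner_mul_inner]
  exact Finset.sum_congr rfl fun i _ ↦ by rw [real_inner_comm (b i) (mvfderiv (𝓡 n) x p u)]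

lemma sum_norm_gradient_coordFunction_sq (hx : IsIsometricImmersion (n := n) x) (p : M) :
    ∑ i, ‖gradient (n := n) (coordFunction x (b i)) p‖ ^ 2 = n := by
  have h := sum_bilin_eq_of_dual (sum_inner_gradient_coordFunction_smul b hx (p := p)) (frame p)
    (innerₗ (TangentSpace (𝓡 n) p))
  simp only [innerₗ_apply_apply, real_inner_self_eq_norm_sq, OrthonormalBasis.norm_eq_one] at h
  rw [h, one_pow, Finset.sum_const, nsmul_one, Finset.card_univ, Fintype.card_fin]
  exact congrArg Nat.cast (finrank_euclideanSpace_fin (𝕜 := ℝ) (n := n))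

lemma norm_gradient_coordFunction_le (hx : IsIsometricImmersion (n := n) x)
    (v : EuclideanSpace ℝ (Fin N)) (p : M) :
    ‖gradient (n := n) (coordFunction x v) p‖ ≤ ‖v‖ := by
  set z := gradient (n := n) (coordFunction x v) p
  have hz : ‖mvfderiv (𝓡 n) x p z‖ = ‖z‖ := by
    rw [← sq_eq_sq₀ (norm_nonneg _) (norm_nonneg _), ← real_inner_self_eq_norm_sq,
      ← real_inner_self_eq_norm_sq, hx.inner_mvfderiv]
  have h : ‖z‖ * ‖z‖ ≤ ‖v‖ * ‖z‖ := by
    calc ‖z‖ * ‖z‖ = inner ℝ v (mvfderiv (𝓡 n) x p z) := by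
          rw [← inner_gradient_coordFunction hx.smooth, real_inner_self_eq_norm_mul_norm]
      _ ≤ ‖v‖ * ‖z‖ := hz ▸ real_inner_le_norm _ _
  rcases (norm_nonneg z).eq_or_lt with h0 | h0
  · exact h0 ▸ norm_nonneg v
  · exact le_of_mul_le_mul_right h h0

variable [IsManifold (𝓡 n) ∞ M]
  {lc : CovariantDerivative (𝓡 n) (EuclideanSpace ℝ (Fin n)) (TangentSpace (𝓡 n) : M → Type _)}

lemma norm_meanCurvatureVector (x : M → EuclideanSpace ℝ (Fin N)) (p : M) :
    ‖meanCurvatureVector (n := n) x p‖ = n * meanCurvature (n := n) x p := by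
  rw [meanCurvature]
  rcases n.eq_zero_or_pos with rfl | hn
  · have hempty : IsEmpty (Fin (Module.finrank ℝ (TangentSpace (𝓡 0) p))) := by
      rw [show Module.finrank ℝ (TangentSpace (𝓡 0) p) = 0 from
        finrank_euclideanSpace_fin (𝕜 := ℝ) (n := 0)]
      infer_instance
    simp [meanCurvatureVector]
  · field_simp

lemma meanCurvature_sub_const (hx : ContMDiff (𝓡 n) 𝓘(ℝ, EuclideanSpace ℝ (Fin N)) ∞ x)
    (c : EuclideanSpace ℝ (Fin N)) (p : M) :
    meanCurvature (n := n) (fun q ↦ x q - c) p = meanCurvature (n := n) x p := by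
  simp only [meanCurvature, meanCurvatureVector, secondFundamentalForm, mvfderiv_sub_const hx]

/-- The covariant derivative `(∇_u dx) w` of the differential of a map to Euclidean space. -/
def hessian (lc : CovariantDerivative (𝓡 n) (EuclideanSpace ℝ (Fin n))
    (TangentSpace (𝓡 n) : M → Type _)) (x : M → EuclideanSpace ℝ (Fin N)) (p : M)
    (u w : TangentSpace (𝓡 n) p) : EuclideanSpace ℝ (Fin N) :=
  let W : Π q : M, TangentSpace (𝓡 n) q := FiberBundle.extend (EuclideanSpace ℝ (Fin n)) w
  mvfderiv (𝓡 n) (fun q ↦ mvfderiv (𝓡 n) x q (W q)) p u - mvfderiv (𝓡 n) x p (lc W p u)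

variable [IsContMDiffRiemannianBundle (𝓡 n) ∞ (EuclideanSpace ℝ (Fin n))
    (fun x : M ↦ TangentSpace (𝓡 n) x)]

lemma inner_hessian (hm : lc.IsMetricCompatible)
    (hx : ContMDiff (𝓡 n) 𝓘(ℝ, EuclideanSpace ℝ (Fin N)) ∞ x) (v : EuclideanSpace ℝ (Fin N))
    (u w : TangentSpace (𝓡 n) p) :
    inner ℝ v (hessian lc x p u w) = inner ℝ (lc (gradient (coordFunction x v)) p u) w := by
  have hW := isSmoothFieldAt_extend w
  have h := mvfderiv_inner hm (isSmoothField_gradient (contMDiff_coordFunction hx v) p) hW u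
  simp only [inner_gradient_coordFunction hx] at h
  rw [mvfderiv_inner_const (contMDiffAt_mvfderiv_apply hx hW)] at h
  rw [hessian, inner_sub_right, h, FiberBundle.extend_apply_self, add_sub_cancel_right]

lemma hessian_comm (ht : lc.torsion = 0) (hm : lc.IsMetricCompatible)
    (hx : ContMDiff (𝓡 n) 𝓘(ℝ, EuclideanSpace ℝ (Fin N)) ∞ x) (u w : TangentSpace (𝓡 n) p) :
    hessian lc x p u w = hessian lc x p w u :=
  ext_inner_left ℝ fun v ↦ by
    rw [inner_hessian hm hx, inner_hessian hm hx,
      inner_conn_gradient_comm ht hm (contMDiff_coordFunction hx v)]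

lemma inner_hessian_mvfderiv_skew (hm : lc.IsMetricCompatible)
    (hx : IsIsometricImmersion (n := n) x) (u w z : TangentSpace (𝓡 n) p) :
    inner ℝ (hessian lc x p u w) (mvfderiv (𝓡 n) x p z)
      = -inner ℝ (hessian lc x p u z) (mvfderiv (𝓡 n) x p w) := by
  have hw := isSmoothFieldAt_extend w
  have hz := isSmoothFieldAt_extend z
  have h := mvfderiv_inner_euclidean (contMDiffAt_mvfderiv_apply hx.smooth hw)
    (contMDiffAt_mvfderiv_apply hx.smooth hz) u
  simp only [hx.inner_mvfderiv, mvfderiv_inner hm hw hz, FiberBundle.extend_apply_self] at h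
  simp only [hessian, inner_sub_left, hx.inner_mvfderiv]
  rw [real_inner_comm _ w, real_inner_comm _ (mvfderiv (𝓡 n) x p w)] at h
  linarith

lemma inner_hessian_mvfderiv (ht : lc.torsion = 0) (hm : lc.IsMetricCompatible)
    (hx : IsIsometricImmersion (n := n) x) (u w z : TangentSpace (𝓡 n) p) :
    inner ℝ (hessian lc x p u w) (mvfderiv (𝓡 n) x p z) = 0 := by
  have hskew := inner_hessian_mvfderiv_skew (p := p) hm hx
  have hcomm := hessian_comm (p := p) ht hm hx.smooth
  have h : inner ℝ (hessian lc x p u w) (mvfderiv (𝓡 n) x p z)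
      = -inner ℝ (hessian lc x p u w) (mvfderiv (𝓡 n) x p z) := by
    conv_lhs => rw [hskew, hcomm u z, hskew z, hcomm z, hskew w, hcomm w, neg_neg]
  linarith

lemma secondFundamentalForm_eq_hessian (ht : lc.torsion = 0) (hm : lc.IsMetricCompatible)
    (hx : IsIsometricImmersion (n := n) x) (u w : TangentSpace (𝓡 n) p) :
    secondFundamentalForm x p u w = hessian lc x p u w := by
  set W : Π q : M, TangentSpace (𝓡 n) q := FiberBundle.extend (EuclideanSpace ℝ (Fin n)) w
  set T := LinearMap.range (mvfderiv (𝓡 n) x p).toLinearMap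
  have hnormal : hessian lc x p u w ∈ Tᗮ := by
    rw [Submodule.mem_orthogonal']
    rintro _ ⟨z, rfl⟩
    exact inner_hessian_mvfderiv ht hm hx u w z
  have htangent : mvfderiv (𝓡 n) x p (lc W p u) ∈ Tᗮᗮ :=
    T.le_orthogonal_orthogonal ⟨_, rfl⟩
  refine Submodule.eq_starProjection_of_mem_orthogonal' hnormal htangent ?_
  exact (sub_add_cancel _ _).symm

lemma laplacian_coordFunction (ht : lc.torsion = 0) (hm : lc.IsMetricCompatible)
    (hx : IsIsometricImmersion (n := n) x) (v : EuclideanSpace ℝ (Fin N)) (p : M) :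
    laplacian lc (coordFunction x v) p = inner ℝ v (meanCurvatureVector (n := n) x p) := by
  rw [meanCurvatureVector, inner_sum, laplacian, divergence,
    LinearMap.trace_eq_sum_inner _ (frame p)]
  refine Finset.sum_congr rfl fun i _ ↦ ?_
  rw [secondFundamentalForm_eq_hessian ht hm hx, inner_hessian hm hx.smooth]
  exact real_inner_comm _ _

lemma sum_laplacian_smul_gradient (ht : lc.torsion = 0) (hm : lc.IsMetricCompatible)
    (hx : IsIsometricImmersion (n := n) x) (p : M) :
    ∑ i, laplacian lc (coordFunction x (b i)) p • gradient (n := n) (coordFunction x (b i)) p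
      = 0 := by
  refine ext_inner_right ℝ fun w ↦ ?_
  simp only [sum_inner, real_inner_smul_left, inner_gradient_coordFunction hx.smooth,
    laplacian_coordFunction ht hm hx, inner_zero_left]
  simp only [real_inner_comm (meanCurvatureVector (n := n) x p)]
  rw [b.sum_inner_mul_inner]
  rw [meanCurvatureVector, sum_inner]
  exact Finset.sum_eq_zero fun i _ ↦ by
    rw [secondFundamentalForm_eq_hessian ht hm hx, inner_hessian_mvfderiv ht hm hx]

lemma sum_laplacian_sq (ht : lc.torsion = 0) (hm : lc.IsMetricCompatible)
    (hx : IsIsometricImmersion (n := n) x) (p : M) :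
    ∑ i, laplacian lc (coordFunction x (b i)) p ^ 2 = ‖meanCurvatureVector (n := n) x p‖ ^ 2 := by
  simp only [laplacian_coordFunction ht hm hx, b.sum_sq_inner_right]

lemma continuous_norm_meanCurvatureVector_sq
    (hs : CovariantDerivative.ContMDiffCovariantDerivative lc ∞) (ht : lc.torsion = 0)
    (hm : lc.IsMetricCompatible) (hx : IsIsometricImmersion (n := n) x) :
    Continuous fun p ↦ ‖meanCurvatureVector (n := n) x p‖ ^ 2 := by
  simp only [← sum_laplacian_sq (EuclideanSpace.basisFun (Fin N) ℝ) ht hm hx]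
  exact continuous_finsetSum _ fun i _ ↦ (contMDiff_divergence hs (isSmoothField_gradient
    (contMDiff_coordFunction hx.smooth _))).continuous.pow 2

lemma integral_norm_meanCurvatureVector_sq_mul_le [CompactSpace M] [MeasurableSpace M]
    [BorelSpace M]
    (hs : CovariantDerivative.ContMDiffCovariantDerivative lc ∞) (ht : lc.torsion = 0)
    (hm : lc.IsMetricCompatible) (hx : IsIsometricImmersion (n := n) x) {w : M → ℝ}
    (hw : Continuous w) (hw0 : ∀ p, 0 ≤ w p) :
    ∫ p, ‖meanCurvatureVector (n := n) x p‖ ^ 2 * w p ∂(riemannianVolume (n := n) M)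
      ≤ (n : ℝ) ^ 2 * (⨆ p, meanCurvature (n := n) x p ^ 2)
        * ∫ p, w p ∂(riemannianVolume (n := n) M) := by
  have hvector := continuous_norm_meanCurvatureVector_sq hs ht hm hx
  have hbdd : BddAbove (Set.range fun p ↦ meanCurvature (n := n) x p ^ 2) := by
    simp only [meanCurvature, div_pow]
    exact (isCompact_range (hvector.div_const _)).bddAbove
  rw [← integral_const_mul]
  refine integral_mono (integrable_of_continuous (hvector.mul hw))
    (integrable_of_continuous (continuous_const.mul hw)) fun p ↦
    mul_le_mul_of_nonneg_right ?_ (hw0 p)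
  rw [norm_meanCurvatureVector, mul_pow]
  exact mul_le_mul_of_nonneg_left (le_ciSup hbdd p) (sq_nonneg _)

end Immersions

/-! ### The Weitzenböck formula -/

section Clifford

variable {V A : Type*} [NormedAddCommGroup V] [InnerProductSpace ℝ V] [AddCommGroup A] [Module ℝ A]
  {c : V →ₗ[ℝ] A →ₗ[ℝ] A} (hc : ∀ v s, c v (c v s) = -(‖v‖ ^ 2 • s))

include hc

lemma clifford_anticomm (u w : V) (s : A) :
    c u (c w s) + c w (c u s) = -((2 * inner ℝ u w) • s) := by
  have h := hc (u + w) s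
  simp only [map_add, LinearMap.add_apply, hc u s, hc w s, norm_add_sq_real] at h
  linear_combination (norm := module) h

lemma sum_clifford_clifford {m : ℕ} (e : OrthonormalBasis (Fin m) ℝ V) (H : Fin m → Fin m → A) :
    ∑ i, ∑ j, c (e i) (c (e j) (H i j))
      = -∑ i, H i i + ∑ i, ∑ j ∈ Finset.Ioi i, c (e i) (c (e j) (H i j - H j i)) := by
  have split_row (i : Fin m) : ∑ j, c (e i) (c (e j) (H i j))
      = -H i i + (∑ j ∈ Finset.Ioi i, c (e i) (c (e j) (H i j))
        + ∑ j ∈ Finset.Iio i, c (e i) (c (e j) (H i j))) := by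
    have hdiag : c (e i) (c (e i) (H i i)) = -H i i := by simp [hc]
    rw [← hdiag, add_comm, ← Finset.sum_union (Finset.disjoint_Ioi_Iio i),
      ← Finset.sum_erase_add _ _ (Finset.mem_univ i)]
    congr 2
    ext j
    simp [lt_or_lt_iff_ne, eq_comm]
  have below_diagonal : ∑ i, ∑ j ∈ Finset.Iio i, c (e i) (c (e j) (H i j))
      = ∑ i, ∑ j ∈ Finset.Ioi i, -c (e i) (c (e j) (H j i)) := by
    rw [Finset.sum_comm' (t' := Finset.univ) (s' := fun j ↦ Finset.Ioi j) (by simp)]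
    refine Finset.sum_congr rfl fun i _ ↦ Finset.sum_congr rfl fun j hj ↦ ?_
    have h := clifford_anticomm hc (e i) (e j) (H j i)
    rw [e.inner_eq_zero (Finset.mem_Ioi.1 hj).ne, mul_zero, zero_smul, neg_zero] at h
    exact eq_neg_of_add_eq_zero_right h
  simp only [split_row, Finset.sum_add_distrib, Finset.sum_neg_distrib, below_diagonal, map_sub,
    Finset.sum_sub_distrib]
  abel

lemma sum_clifford_clifford_symm {m : ℕ} (e : OrthonormalBasis (Fin m) ℝ V) (L : V →ₗ[ℝ] V)
    (hL : L.IsSymmetric) (s : A) : ∑ i, c (e i) (c (L (e i)) s) = -(L.trace ℝ V • s) := by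
  have expand (i : Fin m) : c (e i) (c (L (e i)) s)
      = ∑ j, c (e i) (c (e j) (inner ℝ (e j) (L (e i)) • s)) := by
    conv_lhs => rw [← e.sum_repr' (L (e i))]
    simp only [map_sum, map_smul, LinearMap.sum_apply, LinearMap.smul_apply]
  have symm (i j : Fin m) : inner ℝ (e j) (L (e i)) = inner ℝ (e i) (L (e j)) := by
    rw [← hL, real_inner_comm]
  simp only [expand]
  rw [sum_clifford_clifford hc, LinearMap.trace_eq_sum_inner _ e, Finset.sum_smul, add_eq_left]
  refine Finset.sum_eq_zero fun i _ ↦ Finset.sum_eq_zero fun j _ ↦ ?_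
  rw [symm, sub_self, map_zero, map_zero]

end Clifford

section SecondDerivative

open scoped Topology

variable {n : ℕ} {M : Type*} [TopologicalSpace M] [ChartedSpace (EuclideanSpace ℝ (Fin n)) M]
  [IsManifold (𝓡 n) ∞ M]
  {F : Type*} [NormedAddCommGroup F] [NormedSpace ℝ F] {S : M → Type*}
  [TopologicalSpace (TotalSpace F S)] [∀ x, NormedAddCommGroup (S x)]
  [∀ x, InnerProductSpace ℝ (S x)] [FiberBundle F S] [VectorBundle ℝ F S]
  {lc : CovariantDerivative (𝓡 n) (EuclideanSpace ℝ (Fin n)) (TangentSpace (𝓡 n) : M → Type _)}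
  {cov : CovariantDerivative (𝓡 n) F S} {σ : Π p, S p}

lemma tensorialAt_secondDeriv (lc : CovariantDerivative (𝓡 n) (EuclideanSpace ℝ (Fin n))
    (TangentSpace (𝓡 n) : M → Type _))
    (hcov : CovariantDerivative.ContMDiffCovariantDerivative cov ∞) (hσ : IsSmooth n F σ) (p : M) :
    TensorialAt (𝓡 n) (EuclideanSpace ℝ (Fin n)) (fun V : Π q : M, TangentSpace (𝓡 n) q ↦
      cov (fun q ↦ cov σ q (V q)) p - (cov σ p).comp (lc V p)) p := by
  have hd {V : Π q : M, TangentSpace (𝓡 n) q}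
      (hV : MDifferentiableAt (𝓡 n) ((𝓡 n).prod 𝓘(ℝ, EuclideanSpace ℝ (Fin n)))
        (fun q ↦ TotalSpace.mk' (EuclideanSpace ℝ (Fin n)) q (V q)) p) :
      MDifferentiableAt (𝓡 n) ((𝓡 n).prod 𝓘(ℝ, F))
        (fun q ↦ TotalSpace.mk' F q (cov σ q (V q))) p := by
    have h := hcov.contMDiff.contMDiff (σ := σ) (contMDiffOn_univ.2 hσ)
    exact ((contMDiffOn_univ.1 h p).mdifferentiableAt (by simp)).clm_bundle_apply hV
  constructor
  · intro f V hf hV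
    have hsmul : (fun q ↦ cov σ q ((f • V) q)) = f • fun q ↦ cov σ q (V q) :=
      funext fun q ↦ (cov σ q).map_smul (f q) (V q)
    rw [hsmul, cov.isCovariantDerivativeOn.leibniz (x := p) (hd hV) hf,
      lc.isCovariantDerivativeOn.leibniz (x := p) hV hf]
    ext u
    simp only [ContinuousLinearMap.comp_add, ContinuousLinearMap.comp_smulₛₗ, Real.ringHom_apply,
      sub_apply, add_apply, smul_apply, ContinuousLinearMap.smulRight_apply,
      ContinuousLinearMap.comp_apply, map_smul, add_sub_add_right_eq_sub]
    module
  · intro V W hV hW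
    have hadd : (fun q ↦ cov σ q ((V + W) q))
        = (fun q ↦ cov σ q (V q)) + fun q ↦ cov σ q (W q) :=
      funext fun q ↦ map_add (cov σ q) (V q) (W q)
    rw [hadd, cov.isCovariantDerivativeOn.add (x := p) (hd hV) (hd hW),
      lc.isCovariantDerivativeOn.add (x := p) hV hW, ContinuousLinearMap.comp_add]
    abel

/-- The second covariant derivative of a section: `secondDeriv lc hcov hσ p w u` is
`∇²_{u,w} σ = ∇_u (∇_W σ) - ∇_{∇_u W} σ`, where `W` is a vector field near `p` with `W p = w`. -/
def secondDeriv (lc : CovariantDerivative (𝓡 n) (EuclideanSpace ℝ (Fin n))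
    (TangentSpace (𝓡 n) : M → Type _))
    (hcov : CovariantDerivative.ContMDiffCovariantDerivative cov ∞) (hσ : IsSmooth n F σ) (p : M) :
    TangentSpace (𝓡 n) p →L[ℝ] TangentSpace (𝓡 n) p →L[ℝ] S p :=
  TensorialAt.mkHom _ p (tensorialAt_secondDeriv lc hcov hσ p)

lemma conn_conn_apply (lc : CovariantDerivative (𝓡 n) (EuclideanSpace ℝ (Fin n))
    (TangentSpace (𝓡 n) : M → Type _))
    (hcov : CovariantDerivative.ContMDiffCovariantDerivative cov ∞) (hσ : IsSmooth n F σ) {p : M}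
    {V : Π q : M, TangentSpace (𝓡 n) q} (hV : IsSmoothFieldAt V p) (u : TangentSpace (𝓡 n) p) :
    cov (fun q ↦ cov σ q (V q)) p u
      = secondDeriv lc hcov hσ p (V p) u + cov σ p (lc V p u) := by
  have h := TensorialAt.mkHom_apply (tensorialAt_secondDeriv lc hcov hσ p)
    (hV.mdifferentiableAt (by simp))
  rw [secondDeriv, h, _root_.sub_apply]
  exact (sub_add_cancel _ _).symm

variable [RiemannianBundle (fun x : M ↦ TangentSpace (𝓡 n) x)]
  [IsContMDiffRiemannianBundle (𝓡 n) ∞ (EuclideanSpace ℝ (Fin n))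
    (fun x : M ↦ TangentSpace (𝓡 n) x)]

/-- The tensor `∑ᵢ zᵢ ⊗ z'ᵢ` of a pair of dual frames is parallel. -/
lemma sum_bilin_conn_coordFrame {W : Type*} [AddCommGroup W] [Module ℝ W]
    (hm : lc.IsMetricCompatible) (p : M) (u : TangentSpace (𝓡 n) p)
    (T : TangentSpace (𝓡 n) p →ₗ[ℝ] TangentSpace (𝓡 n) p →ₗ[ℝ] W) :
    ∑ i, (T (coordFrame p i p) (lc (dualCoordFrame p i) p u)
      + T (lc (coordFrame p i) p u) (dualCoordFrame p i p)) = 0 := by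
  have hp := mem_extChartAt_source (I := 𝓡 n) p
  have hz' (i : Fin n) := isSmoothFieldAt_dualCoordFrame hp i
  have hz (i : Fin n) : IsSmoothFieldAt (coordFrame p i) p := isSmoothFieldAt_coordField hp _
  have parallel (w : TangentSpace (𝓡 n) p) :
      ∑ i, (inner ℝ (lc (dualCoordFrame p i) p u) w • coordFrame p i p
        + inner ℝ (dualCoordFrame p i p) w • lc (coordFrame p i) p u) = 0 := by
    let W : Π q : M, TangentSpace (𝓡 n) q := FiberBundle.extend (EuclideanSpace ℝ (Fin n)) w
    have hW : IsSmoothFieldAt W p := isSmoothFieldAt_extend w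
    have hWp : W p = w := FiberBundle.extend_apply_self _ _
    have hcoef (i : Fin n) := (hz' i).inner_bundle hW
    have hexpand : lc W p u = ∑ i, lc (fun q ↦ inner ℝ (dualCoordFrame p i q) (W q) •
        coordFrame p i q) p u := by
      refine Eq.trans ?_ (conn_sum_apply _ (fun i ↦ (hcoef i).smul_section (hz i)) u)
      exact (DFunLike.congr_fun (conn_congr hW (mem_of_superset (extChartAt_source_mem_nhds p)
        fun q hq ↦ sum_inner_dualCoordFrame_smul hq (W q))) u).symm
    have hderiv (i : Fin n) := (conn_smul_apply (cov := lc) (hcoef i) (hz i) u).trans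
      (congrArg (fun t : ℝ ↦ _ + t • coordFrame p i p) (mvfderiv_inner hm (hz' i) hW u))
    simp only [hderiv, hWp, add_smul, Finset.sum_add_distrib,
      sum_inner_dualCoordFrame_smul hp] at hexpand
    rw [Finset.sum_add_distrib]
    linear_combination (norm := module) -hexpand
  have expand (v w : TangentSpace (𝓡 n) p) :
      T w v = ∑ k, T (inner ℝ v (frame p k) • w) (frame p k) := by
    conv_lhs => rw [← (frame p).sum_repr' v]
    simp only [map_sum, map_smul, LinearMap.smul_apply, real_inner_comm v]
  calc ∑ i, (T (coordFrame p i p) (lc (dualCoordFrame p i) p u)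
        + T (lc (coordFrame p i) p u) (dualCoordFrame p i p))
      = ∑ k, T (∑ i,
          (inner ℝ (lc (dualCoordFrame p i) p u) (frame p k) • coordFrame p i p
            + inner ℝ (dualCoordFrame p i p) (frame p k) • lc (coordFrame p i) p u))
          (frame p k) := by
        simp only [map_sum, map_add, LinearMap.sum_apply, LinearMap.add_apply]
        rw [Finset.sum_comm]
        exact Finset.sum_congr rfl fun i _ ↦
          (congrArg₂ (· + ·) (expand _ _) (expand _ _)).trans Finset.sum_add_distrib.symm
    _ = 0 := by simp only [parallel, map_zero, LinearMap.zero_apply, Finset.sum_const_zero]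

end SecondDerivative

section Dirac

open scoped Topology

variable {n : ℕ} {𝕜 : Type*} [RCLike 𝕜]
  {M : Type*} [TopologicalSpace M] [ChartedSpace (EuclideanSpace ℝ (Fin n)) M]
  [IsManifold (𝓡 n) ∞ M]
  [RiemannianBundle (fun x : M ↦ TangentSpace (𝓡 n) x)]
  [IsContMDiffRiemannianBundle (𝓡 n) ∞ (EuclideanSpace ℝ (Fin n))
    (fun x : M ↦ TangentSpace (𝓡 n) x)]
  {F : Type*} [NormedAddCommGroup F] [NormedSpace ℝ F] [FiniteDimensional ℝ F]
  {S : M → Type*} [TopologicalSpace (TotalSpace F S)] [∀ x, NormedAddCommGroup (S x)]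
  [∀ x, InnerProductSpace ℝ (S x)] [FiberBundle F S] [VectorBundle ℝ F S]
  [ContMDiffVectorBundle ∞ F S (𝓡 n)] [IsContMDiffRiemannianBundle (𝓡 n) ∞ F S]
  [∀ x, InnerProductSpace 𝕜 (S x)]
  (B : DiracBundle (n := n) 𝕜 M F S) {σ τ : Π p, S p} {f : M → ℝ}

namespace DiracBundle

/-- The second covariant derivative `B.secondDeriv hσ p w u = ∇²_{u,w} σ`. -/
abbrev secondDeriv (hσ : IsSmooth n F σ) (p : M) :
    TangentSpace (𝓡 n) p →L[ℝ] TangentSpace (𝓡 n) p →L[ℝ] S p :=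
  DiracEigenvalues.secondDeriv B.leviCivita B.conn_smooth hσ p

lemma curvature_eq (hσ : IsSmooth n F σ) (p : M) (u w : TangentSpace (𝓡 n) p) :
    B.curvature σ p u w = B.secondDeriv hσ p w u - B.secondDeriv hσ p u w := by
  let U : Π q : M, TangentSpace (𝓡 n) q := FiberBundle.extend (EuclideanSpace ℝ (Fin n)) u
  let W : Π q : M, TangentSpace (𝓡 n) q := FiberBundle.extend (EuclideanSpace ℝ (Fin n)) w
  have hU : IsSmoothFieldAt U p := isSmoothFieldAt_extend u
  have hW : IsSmoothFieldAt W p := isSmoothFieldAt_extend w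
  have hUp : U p = u := FiberBundle.extend_apply_self _ _
  have hWp : W p = w := FiberBundle.extend_apply_self _ _
  have htorsion := (B.leviCivita.torsion_eq_zero_iff.1 B.leviCivita_torsion)
    (hU.mdifferentiableAt (by simp)) (hW.mdifferentiableAt (by simp))
  rw [hUp, hWp] at htorsion
  change B.conn (fun q ↦ B.conn σ q (W q)) p u - B.conn (fun q ↦ B.conn σ q (U q)) p w
    - B.conn σ p (VectorField.mlieBracket (𝓡 n) U W p) = _
  rw [conn_conn_apply B.leviCivita B.conn_smooth hσ hW,
    conn_conn_apply B.leviCivita B.conn_smooth hσ hU, ← htorsion, map_sub, hUp, hWp]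
  abel

lemma dirac_eventuallyEq (σ : Π p, S p) (p : M) : ∀ᶠ q in 𝓝 p, B.dirac σ q =
    ∑ i, B.clifford q (coordFrame p i q) (B.conn σ q (dualCoordFrame p i q)) :=
  mem_of_superset (extChartAt_source_mem_nhds p) fun q hq ↦
    (sum_bilin_eq_of_dual (sum_inner_dualCoordFrame_smul hq) (frame q)
      ((B.clifford q).compl₂ (B.conn σ q).toLinearMap)).symm

lemma isSmoothAt_clifford_coordFrame (hσ : IsSmooth n F σ) (p : M) (i : Fin n) : IsSmoothAt n F
    (fun q ↦ B.clifford q (coordFrame p i q) (B.conn σ q (dualCoordFrame p i q))) p :=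
  B.clifford_smooth _ _ p (isSmoothFieldAt_coordField (mem_extChartAt_source p) _)
    (isSmoothAt_conn_apply B.conn_smooth hσ
      (isSmoothFieldAt_dualCoordFrame (mem_extChartAt_source p) i))

lemma isSmooth_dirac (hσ : IsSmooth n F σ) : IsSmooth n F (B.dirac σ) := fun p ↦
  (ContMDiffAt.sum_section fun i _ ↦
    B.isSmoothAt_clifford_coordFrame hσ p i).congr_of_eventuallyEq
      ((B.dirac_eventuallyEq σ p).mono fun q hq ↦ congrArg (TotalSpace.mk' F q) hq)

lemma conn_dirac (hσ : IsSmooth n F σ) (p : M) (u : TangentSpace (𝓡 n) p) :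
    B.conn (B.dirac σ) p u
      = ∑ i, B.clifford p (frame p i) (B.secondDeriv hσ p (frame p i) u) := by
  have hp := mem_extChartAt_source (I := 𝓡 n) p
  have hz (i : Fin n) : IsSmoothFieldAt (coordFrame p i) p := isSmoothFieldAt_coordField hp _
  have hz' (i : Fin n) := isSmoothFieldAt_dualCoordFrame hp i
  have hterm (i : Fin n) := B.isSmoothAt_clifford_coordFrame hσ p i
  have hleibniz (i : Fin n) : B.conn
      (fun q ↦ B.clifford q (coordFrame p i q) (B.conn σ q (dualCoordFrame p i q))) p u
      = B.clifford p (coordFrame p i p) (B.secondDeriv hσ p (dualCoordFrame p i p) u)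
        + (B.clifford p (coordFrame p i p) (B.conn σ p (B.leviCivita (dualCoordFrame p i) p u))
        + B.clifford p (B.leviCivita (coordFrame p i) p u)
          (B.conn σ p (dualCoordFrame p i p))) := by
    rw [B.conn_clifford _ _ p u (hz i) (isSmoothAt_conn_apply B.conn_smooth hσ (hz' i)),
      conn_conn_apply B.leviCivita B.conn_smooth hσ (hz' i), map_add]
    abel
  have hparallel := sum_bilin_conn_coordFrame B.leviCivita_metric p u
    ((B.clifford p).compl₂ (B.conn σ p).toLinearMap)
  have htrace := sum_bilin_eq_of_dual (sum_inner_dualCoordFrame_smul hp) (frame p)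
    ((B.clifford p).compl₂ ((B.secondDeriv hσ p).flip u).toLinearMap)
  rw [conn_congr (ContMDiffAt.sum_section fun i _ ↦ hterm i) (B.dirac_eventuallyEq σ p),
    conn_sum_apply _ hterm, Finset.sum_congr rfl fun i _ ↦ hleibniz i, Finset.sum_add_distrib]
  exact (congrArg₂ (· + ·) htrace hparallel).trans (add_zero _)

lemma dirac_dirac (hσ : IsSmooth n F σ) (p : M) : B.dirac (B.dirac σ) p
    = -∑ i, B.secondDeriv hσ p (frame p i) (frame p i) + B.curvatureMorphism σ p := by
  simp only [curvatureMorphism, B.curvature_eq hσ]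
  rw [dirac]
  simp only [B.conn_dirac hσ, map_sum]
  exact sum_clifford_clifford (B.clifford_sq p) (frame p)
    fun i j ↦ B.secondDeriv hσ p (frame p j) (frame p i)

lemma isSmooth_sum_secondDeriv [T2Space M] (hσ : IsSmooth n F σ) :
    IsSmooth n F fun q ↦ ∑ i, B.secondDeriv hσ q (frame q i) (frame q i) := by
  intro p
  obtain ⟨z, z', hz, hz', hdual⟩ := exists_dual_frames (n := n) p
  have hconn (i : Fin n) : IsSmooth n F fun q ↦ B.conn σ q (z' i q) :=
    fun q ↦ isSmoothAt_conn_apply B.conn_smooth hσ (hz' i q)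
  have hlc (i : Fin n) : IsSmoothField fun q ↦ B.leviCivita (z' i) q (z i q) :=
    fun q ↦ isSmoothAt_conn_apply B.leviCivita_smooth (hz' i) (hz i q)
  have hsmooth : IsSmoothAt n F (fun q ↦ ∑ i, (B.conn (fun r ↦ B.conn σ r (z' i r)) q (z i q)
      - B.conn σ q (B.leviCivita (z' i) q (z i q)))) p :=
    ContMDiffAt.sum_section fun i _ ↦
      (isSmoothAt_conn_apply B.conn_smooth (hconn i) (hz i p)).sub_section
        (isSmoothAt_conn_apply B.conn_smooth hσ (hlc i p))
  refine hsmooth.congr_of_eventuallyEq (hdual.mono fun q hq ↦ congrArg (TotalSpace.mk' F q) ?_)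
  refine (sum_bilin_eq_of_dual hq (frame q)
    (ContinuousLinearMap.toLinearMap₁₂ (B.secondDeriv hσ q).flip)).symm.trans
      (Finset.sum_congr rfl fun i _ ↦ ?_)
  rw [conn_conn_apply B.leviCivita B.conn_smooth hσ (hz' i q)]
  exact (add_sub_cancel_right _ _).symm

lemma isSmooth_curvatureMorphism [T2Space M] (hσ : IsSmooth n F σ) :
    IsSmooth n F (B.curvatureMorphism σ) := by
  have h : B.curvatureMorphism σ = fun q ↦ B.dirac (B.dirac σ) q
      + ∑ i, B.secondDeriv hσ q (frame q i) (frame q i) :=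
    funext fun q ↦ by rw [B.dirac_dirac hσ]; abel
  rw [h]
  exact ContMDiff.add_section (B.isSmooth_dirac (B.isSmooth_dirac hσ))
    (B.isSmooth_sum_secondDeriv hσ)

lemma dirac_add (hσ : IsSmooth n F σ) (hτ : IsSmooth n F τ) (p : M) :
    B.dirac (fun q ↦ σ q + τ q) p = B.dirac σ p + B.dirac τ p := by
  simp only [dirac, conn_add_apply (hσ p) (hτ p), map_add, Finset.sum_add_distrib]

lemma dirac_smul (hf : ContMDiff (𝓡 n) 𝓘(ℝ, ℝ) ∞ f) (hσ : IsSmooth n F σ) (p : M) :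
    B.dirac (fun q ↦ f q • σ q) p = B.clifford p (gradient f p) (σ p) + f p • B.dirac σ p := by
  simp only [dirac, gradient, conn_smul_apply (hf p) (hσ p), map_add, map_smul, map_sum,
    LinearMap.sum_apply, LinearMap.smul_apply, Finset.sum_add_distrib, Finset.smul_sum]
  exact add_comm _ _

lemma dirac_clifford_gradient (hf : ContMDiff (𝓡 n) 𝓘(ℝ, ℝ) ∞ f) (hσ : IsSmooth n F σ) (p : M) :
    B.dirac (fun q ↦ B.clifford q (gradient f q) (σ q)) p
      = -(laplacian B.leviCivita f p • σ p) - B.clifford p (gradient f p) (B.dirac σ p)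
        - (2 : ℝ) • B.conn σ p (gradient f p) := by
  have hleibniz (i) : B.clifford p (frame p i)
      (B.conn (fun q ↦ B.clifford q (gradient f q) (σ q)) p (frame p i))
      = B.clifford p (frame p i) (B.clifford p (B.leviCivita (gradient f) p (frame p i)) (σ p))
        - B.clifford p (gradient f p) (B.clifford p (frame p i) (B.conn σ p (frame p i)))
        - (2 : ℝ) • inner ℝ (frame p i) (gradient f p) • B.conn σ p (frame p i) := by
    rw [B.conn_clifford _ _ p _ (isSmoothField_gradient hf p) (hσ p), map_add]
    linear_combination (norm := module) clifford_anticomm (B.clifford_sq p) (frame p i)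
      (gradient f p) (B.conn σ p (frame p i))
  have hhessian : ∑ i, B.clifford p (frame p i)
      (B.clifford p (B.leviCivita (gradient f) p (frame p i)) (σ p))
      = -(laplacian B.leviCivita f p • σ p) :=
    sum_clifford_clifford_symm (B.clifford_sq p) (frame p)
      (B.leviCivita (gradient f) p).toLinearMap
      (fun u w ↦ (inner_conn_gradient_comm B.leviCivita_torsion B.leviCivita_metric hf u w).trans
        (real_inner_comm _ _)) (σ p)
  have hgradient : ∑ i, inner ℝ (frame p i) (gradient f p) • B.conn σ p (frame p i)
      = B.conn σ p (gradient f p) := by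
    conv_rhs => rw [← (frame p).sum_repr' (gradient f p)]
    simp only [map_sum, map_smul]
  rw [dirac, Finset.sum_congr rfl fun i _ ↦ hleibniz i, Finset.sum_sub_distrib,
    Finset.sum_sub_distrib, hhessian, ← map_sum, ← Finset.smul_sum, hgradient, dirac]

lemma dirac_dirac_smul (hf : ContMDiff (𝓡 n) 𝓘(ℝ, ℝ) ∞ f) (hσ : IsSmooth n F σ) (p : M) :
    B.dirac (B.dirac (fun q ↦ f q • σ q)) p
      = f p • B.dirac (B.dirac σ) p - (2 : ℝ) • B.conn σ p (gradient f p)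
        - laplacian B.leviCivita f p • σ p := by
  have hgrad : IsSmooth n F (fun q ↦ B.clifford q (gradient f q) (σ q)) :=
    fun q ↦ B.clifford_smooth _ _ q (isSmoothField_gradient hf q) (hσ q)
  have hD := B.isSmooth_dirac hσ
  rw [funext fun q ↦ B.dirac_smul hf hσ q,
    B.dirac_add (τ := fun q ↦ f q • B.dirac σ q) hgrad (hf.smul_section hD),
    B.dirac_clifford_gradient hf hσ, B.dirac_smul hf hD]
  module

end DiracBundle

end Dirac

/-! ### Integral formulas -/

section PointwiseInner

variable {𝕜 E : Type*} [RCLike 𝕜] [NormedAddCommGroup E] [InnerProductSpace ℝ E]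
  [InnerProductSpace 𝕜 E]

lemma real_inner_eq_re (s t : E) : inner ℝ s t = RCLike.re (inner 𝕜 s t) := by
  rw [real_inner_eq_norm_add_mul_self_sub_norm_mul_self_sub_norm_mul_self_div_two,
    re_inner_eq_norm_add_mul_self_sub_norm_mul_self_sub_norm_mul_self_div_two]

end PointwiseInner

lemma continuous_norm_sq {n : ℕ} {M : Type*} [TopologicalSpace M]
    [ChartedSpace (EuclideanSpace ℝ (Fin n)) M] {F : Type*} [NormedAddCommGroup F]
    [NormedSpace ℝ F] {S : M → Type*} [TopologicalSpace (TotalSpace F S)]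
    [∀ x, NormedAddCommGroup (S x)] [∀ x, InnerProductSpace ℝ (S x)] [FiberBundle F S]
    [VectorBundle ℝ F S] [IsContMDiffRiemannianBundle (𝓡 n) ∞ F S] {σ : Π p, S p}
    (hσ : IsSmooth n F σ) : Continuous fun p ↦ ‖σ p‖ ^ 2 := by
  simp only [← real_inner_self_eq_norm_sq]
  exact (ContMDiff.inner_bundle hσ hσ).continuous

section Integral

open scoped Topology

variable {n : ℕ} {𝕜 : Type*} [RCLike 𝕜]
  {M : Type*} [TopologicalSpace M] [ChartedSpace (EuclideanSpace ℝ (Fin n)) M]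
  [IsManifold (𝓡 n) ∞ M]
  [RiemannianBundle (fun x : M ↦ TangentSpace (𝓡 n) x)]
  [IsContMDiffRiemannianBundle (𝓡 n) ∞ (EuclideanSpace ℝ (Fin n))
    (fun x : M ↦ TangentSpace (𝓡 n) x)]
  {F : Type*} [NormedAddCommGroup F] [NormedSpace ℝ F] [FiniteDimensional ℝ F]
  {S : M → Type*} [TopologicalSpace (TotalSpace F S)] [∀ x, NormedAddCommGroup (S x)]
  [∀ x, InnerProductSpace ℝ (S x)] [FiberBundle F S] [VectorBundle ℝ F S]
  [ContMDiffVectorBundle ∞ F S (𝓡 n)] [IsContMDiffRiemannianBundle (𝓡 n) ∞ F S]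
  [∀ x, InnerProductSpace 𝕜 (S x)]
  (B : DiracBundle (n := n) 𝕜 M F S) {σ τ : Π p, S p} {f : M → ℝ}

namespace DiracBundle

lemma real_inner_clifford {p : M} (v : TangentSpace (𝓡 n) p) (s t : S p) :
    inner ℝ (B.clifford p v s) t = -inner ℝ s (B.clifford p v t) := by
  rw [real_inner_eq_re (𝕜 := 𝕜), real_inner_eq_re (𝕜 := 𝕜),
    eq_neg_of_add_eq_zero_left (B.clifford_skew p v s t), map_neg]

/-- The vector field dual to the 1-form `w ↦ ⟨σ, w · τ⟩`. -/
def cliffordField (σ τ : Π p, S p) (p : M) : TangentSpace (𝓡 n) p :=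
  ∑ i, inner ℝ (σ p) (B.clifford p (frame p i) (τ p)) • frame p i

lemma inner_cliffordField (σ τ : Π p, S p) {p : M} (w : TangentSpace (𝓡 n) p) :
    inner ℝ (B.cliffordField σ τ p) w = inner ℝ (σ p) (B.clifford p w (τ p)) := by
  conv_rhs => rw [← (frame p).sum_repr' w]
  simp only [cliffordField, sum_inner, map_sum, map_smul, LinearMap.sum_apply,
    LinearMap.smul_apply, inner_sum, inner_smul_left, inner_smul_right, RCLike.conj_to_real]
  exact Finset.sum_congr rfl fun _ _ ↦ mul_comm _ _

lemma isSmoothField_cliffordField (hσ : IsSmooth n F σ) (hτ : IsSmooth n F τ) :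
    IsSmoothField (B.cliffordField σ τ) := by
  intro p
  have hp := mem_extChartAt_source (I := 𝓡 n) p
  have hsmooth : IsSmoothFieldAt (fun q ↦ ∑ i,
      inner ℝ (σ q) (B.clifford q (dualCoordFrame p i q) (τ q)) • coordFrame p i q) p :=
    ContMDiffAt.sum_section fun i _ ↦ ContMDiffAt.smul_section
      ((hσ p).inner_bundle (B.clifford_smooth _ _ p (isSmoothFieldAt_dualCoordFrame hp i) (hτ p)))
      (isSmoothFieldAt_coordField hp _)
  refine hsmooth.congr_of_eventuallyEq ?_
  filter_upwards [extChartAt_source_mem_nhds (I := 𝓡 n) p] with q hq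
  conv_lhs => rw [← sum_inner_dualCoordFrame_smul hq (B.cliffordField σ τ q)]
  simp only [real_inner_comm _ (dualCoordFrame p _ q), inner_cliffordField]

lemma divergence_cliffordField (hσ : IsSmooth n F σ) (hτ : IsSmooth n F τ) (p : M) :
    divergence B.leviCivita (B.cliffordField σ τ) p
      = inner ℝ (σ p) (B.dirac τ p) - inner ℝ (B.dirac σ p) (τ p) := by
  have hconn (u w : TangentSpace (𝓡 n) p) :
      inner ℝ (B.leviCivita (B.cliffordField σ τ) p u) w
        = inner ℝ (B.conn σ p u) (B.clifford p w (τ p))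
          + inner ℝ (σ p) (B.clifford p w (B.conn τ p u)) := by
    let W : Π q : M, TangentSpace (𝓡 n) q := FiberBundle.extend (EuclideanSpace ℝ (Fin n)) w
    have hW : IsSmoothFieldAt W p := isSmoothFieldAt_extend w
    have hWp : W p = w := FiberBundle.extend_apply_self _ _
    have hleibniz := mvfderiv_inner B.leviCivita_metric
      (B.isSmoothField_cliffordField hσ hτ p) hW u
    simp only [inner_cliffordField] at hleibniz
    rw [mvfderiv_inner B.conn_metric (hσ p) (B.clifford_smooth _ _ p hW (hτ p)),
      B.conn_clifford _ _ p u hW (hτ p), inner_add_right, hWp] at hleibniz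
    linear_combination -hleibniz
  simp only [divergence_eq_sum_inner, hconn, dirac, sum_inner, inner_sum, real_inner_clifford,
    Finset.sum_neg_distrib, Finset.sum_add_distrib]
  ring

lemma inner_conn_gradient_inner_self (hσ : IsSmooth n F σ) {p : M} (u w : TangentSpace (𝓡 n) p) :
    inner ℝ (B.leviCivita (gradient fun q ↦ inner ℝ (σ q) (σ q)) p u) w
      = 2 * (inner ℝ (B.secondDeriv hσ p w u) (σ p)
        + inner ℝ (B.conn σ p w) (B.conn σ p u)) := by
  let W : Π q : M, TangentSpace (𝓡 n) q := FiberBundle.extend (EuclideanSpace ℝ (Fin n)) w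
  have hW : IsSmoothFieldAt W p := isSmoothFieldAt_extend w
  have hWp : W p = w := FiberBundle.extend_apply_self _ _
  have hconn : IsSmoothAt n F (fun q ↦ B.conn σ q (W q)) p :=
    isSmoothAt_conn_apply B.conn_smooth hσ hW
  have hleibniz := mvfderiv_inner B.leviCivita_metric
    (isSmoothField_gradient (ContMDiff.inner_bundle hσ hσ) p) hW u
  simp only [inner_gradient, fun q ↦ mvfderiv_inner B.conn_metric (hσ q) (hσ q)] at hleibniz
  rw [mvfderiv_fun_add ((hconn.inner_bundle (hσ p)).mdifferentiableAt (by simp))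
      (((hσ p).inner_bundle hconn).mdifferentiableAt (by simp)), _root_.add_apply,
    mvfderiv_inner B.conn_metric hconn (hσ p), mvfderiv_inner B.conn_metric (hσ p) hconn,
    conn_conn_apply B.leviCivita B.conn_smooth hσ hW, inner_add_left, inner_add_right, hWp,
    real_inner_comm _ (σ p), real_inner_comm _ (σ p), real_inner_comm (B.conn σ p w)] at hleibniz
  linear_combination -hleibniz

lemma laplacian_inner_self (hσ : IsSmooth n F σ) (p : M) :
    laplacian B.leviCivita (fun q ↦ inner ℝ (σ q) (σ q)) p
      = 2 * (inner ℝ (B.curvatureMorphism σ p) (σ p) - inner ℝ (B.dirac (B.dirac σ) p) (σ p)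
        + ∑ i, ‖B.conn σ p (frame p i)‖ ^ 2) := by
  rw [laplacian, divergence_eq_sum_inner,
    Finset.sum_congr rfl fun i _ ↦ B.inner_conn_gradient_inner_self hσ (frame p i) (frame p i),
    ← Finset.mul_sum, Finset.sum_add_distrib, B.dirac_dirac hσ, inner_add_left, inner_neg_left,
    sum_inner]
  simp only [real_inner_self_eq_norm_sq]
  ring

lemma continuous_sum_norm_conn_frame_sq (hσ : IsSmooth n F σ) :
    Continuous fun p ↦ ∑ i, ‖B.conn σ p (frame p i)‖ ^ 2 := by
  refine continuous_iff_continuousAt.2 fun p ↦ ?_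
  have hp := mem_extChartAt_source (I := 𝓡 n) p
  have hsmooth : ContMDiffAt (𝓡 n) 𝓘(ℝ, ℝ) ∞ (fun q ↦ ∑ i,
      inner ℝ (B.conn σ q (coordFrame p i q)) (B.conn σ q (dualCoordFrame p i q))) p :=
    contMDiffAt_finsetSum fun i _ ↦ ContMDiffAt.inner_bundle
      (isSmoothAt_conn_apply B.conn_smooth hσ (isSmoothFieldAt_coordField hp _))
      (isSmoothAt_conn_apply B.conn_smooth hσ (isSmoothFieldAt_dualCoordFrame hp i))
  refine hsmooth.continuousAt.congr ?_
  filter_upwards [extChartAt_source_mem_nhds (I := 𝓡 n) p] with q hq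
  simp only [← real_inner_self_eq_norm_sq]
  exact sum_bilin_eq_of_dual (sum_inner_dualCoordFrame_smul hq) (frame q)
    ((innerₗ (S q)).compl₁₂ (B.conn σ q).toLinearMap (B.conn σ q).toLinearMap)

variable [T2Space M] [CompactSpace M] [MeasurableSpace M] [BorelSpace M]

lemma integral_inner_dirac (hσ : IsSmooth n F σ) (hτ : IsSmooth n F τ) :
    ∫ p, inner ℝ (B.dirac σ p) (τ p) ∂(riemannianVolume (n := n) M)
      = ∫ p, inner ℝ (σ p) (B.dirac τ p) ∂(riemannianVolume (n := n) M) := by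
  have hdiv := integral_divergence B.leviCivita_smooth B.leviCivita_torsion B.leviCivita_metric
    (B.isSmoothField_cliffordField hσ hτ)
  simp only [B.divergence_cliffordField hσ hτ] at hdiv
  rw [integral_sub
    (integrable_of_continuous (ContMDiff.inner_bundle hσ (B.isSmooth_dirac hτ)).continuous)
    (integrable_of_continuous (ContMDiff.inner_bundle (B.isSmooth_dirac hσ) hτ).continuous)]
    at hdiv
  exact (sub_eq_zero.1 hdiv).symm

lemma integral_sum_norm_conn_frame_sq (hσ : IsSmooth n F σ) :
    ∫ p, ∑ i, ‖B.conn σ p (frame p i)‖ ^ 2 ∂(riemannianVolume (n := n) M)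
      = ∫ p, inner ℝ (B.dirac (B.dirac σ) p) (σ p) ∂(riemannianVolume (n := n) M)
        - ∫ p, inner ℝ (B.curvatureMorphism σ p) (σ p) ∂(riemannianVolume (n := n) M) := by
  have hgrad := isSmoothField_gradient (ContMDiff.inner_bundle hσ hσ)
  have hdirac := integrable_of_continuous (n := n)
    (ContMDiff.inner_bundle (B.isSmooth_dirac (B.isSmooth_dirac hσ)) hσ).continuous
  have hconn := integrable_of_continuous (n := n) (B.continuous_sum_norm_conn_frame_sq hσ)
  have hlaplacian : Integrable (laplacian B.leviCivita fun q ↦ inner ℝ (σ q) (σ q))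
      (riemannianVolume (n := n) M) :=
    integrable_of_continuous (contMDiff_divergence B.leviCivita_smooth hgrad).continuous
  have hzero : ∫ p, laplacian B.leviCivita (fun q ↦ inner ℝ (σ q) (σ q)) p
      ∂(riemannianVolume (n := n) M) = 0 :=
    integral_divergence B.leviCivita_smooth B.leviCivita_torsion B.leviCivita_metric hgrad
  have hcurvature (p : M) : inner ℝ (B.curvatureMorphism σ p) (σ p)
      = inner ℝ (B.dirac (B.dirac σ) p) (σ p) - ∑ i, ‖B.conn σ p (frame p i)‖ ^ 2
        + 2⁻¹ * laplacian B.leviCivita (fun q ↦ inner ℝ (σ q) (σ q)) p := by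
    rw [B.laplacian_inner_self hσ]
    ring
  rw [integral_congr_ae (.of_forall hcurvature), integral_add
    (f := fun p ↦ inner ℝ (B.dirac (B.dirac σ) p) (σ p) - ∑ i, ‖B.conn σ p (frame p i)‖ ^ 2)
    (hdirac.sub hconn) (hlaplacian.const_mul _), integral_sub hdirac hconn, integral_const_mul,
    hzero]
  ring

lemma integral_inner_commutator (hf : ContMDiff (𝓡 n) 𝓘(ℝ, ℝ) ∞ f) (hσ : IsSmooth n F σ) :
    ∫ p, inner ℝ (B.dirac (B.dirac fun q ↦ f q • σ q) p - f p • B.dirac (B.dirac σ) p)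
        (f p • σ p) ∂(riemannianVolume (n := n) M)
      = ∫ p, ‖gradient (n := n) f p‖ ^ 2 * ‖σ p‖ ^ 2 ∂(riemannianVolume (n := n) M) := by
  have hgrad := isSmoothField_gradient hf
  have hnorm : ContMDiff (𝓡 n) 𝓘(ℝ, ℝ) ∞ fun p ↦ inner ℝ (σ p) (σ p) :=
    ContMDiff.inner_bundle hσ hσ
  have hmul : ContMDiff (𝓡 n) 𝓘(ℝ, ℝ) ∞ fun p ↦ f p * inner ℝ (σ p) (σ p) := hf.mul hnorm
  have hfield : IsSmoothField fun p ↦ (f p * inner ℝ (σ p) (σ p)) • gradient f p :=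
    ContMDiff.smul_section hmul hgrad
  have hdiv := integral_divergence B.leviCivita_smooth B.leviCivita_torsion B.leviCivita_metric
    hfield
  have hpoint (p : M) : inner ℝ (B.dirac (B.dirac fun q ↦ f q • σ q) p
        - f p • B.dirac (B.dirac σ) p) (f p • σ p)
      = ‖gradient (n := n) f p‖ ^ 2 * ‖σ p‖ ^ 2
        - divergence B.leviCivita (fun p ↦ (f p * inner ℝ (σ p) (σ p)) • gradient f p) p := by
    rw [divergence_smul (hmul p) (hgrad p), B.dirac_dirac_smul hf hσ,
      mvfderiv_fun_mul ((hf p).mdifferentiableAt (by simp)) ((hnorm p).mdifferentiableAt (by simp))]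
    simp only [_root_.add_apply, _root_.smul_apply, smul_eq_mul]
    rw [mvfderiv_inner B.conn_metric (hσ p) (hσ p), ← inner_gradient, ← laplacian]
    simp only [inner_sub_left, inner_smul_left, inner_smul_right,
      RCLike.conj_to_real, real_inner_self_eq_norm_sq, real_inner_comm (B.conn σ p _) (σ p)]
    ring
  rw [funext hpoint, integral_sub _ (integrable_of_continuous
    (contMDiff_divergence B.leviCivita_smooth hfield).continuous), hdiv, sub_zero]
  exact integrable_of_continuous ((continuous_norm_sq hgrad).mul (continuous_norm_sq hσ))

end DiracBundle

end Integral

/-! ### The space of smooth sections -/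

lemma isSymmetric_of_re_inner {𝕜 W : Type*} [RCLike 𝕜] [SeminormedAddCommGroup W]
    [InnerProductSpace 𝕜 W] {T : W →ₗ[𝕜] W}
    (h : ∀ v w, RCLike.re (inner 𝕜 (T v) w) = RCLike.re (inner 𝕜 v (T w))) : T.IsSymmetric := by
  intro v w
  refine RCLike.ext (h v w) ?_
  have hI := h v ((RCLike.I : 𝕜) • w)
  rw [map_smul, inner_smul_right, inner_smul_right, RCLike.I_mul_re, RCLike.I_mul_re] at hI
  exact neg_injective hI

section Sections

variable {n : ℕ} {𝕜 : Type*} [RCLike 𝕜]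
  {M : Type*} [TopologicalSpace M] [ChartedSpace (EuclideanSpace ℝ (Fin n)) M]
  [IsManifold (𝓡 n) ∞ M]
  [RiemannianBundle (fun x : M ↦ TangentSpace (𝓡 n) x)]
  [IsContMDiffRiemannianBundle (𝓡 n) ∞ (EuclideanSpace ℝ (Fin n))
    (fun x : M ↦ TangentSpace (𝓡 n) x)]
  {F : Type*} [NormedAddCommGroup F] [NormedSpace ℝ F] [FiniteDimensional ℝ F]
  {S : M → Type*} [TopologicalSpace (TotalSpace F S)] [∀ x, NormedAddCommGroup (S x)]
  [∀ x, InnerProductSpace ℝ (S x)] [FiberBundle F S] [VectorBundle ℝ F S]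
  [ContMDiffVectorBundle ∞ F S (𝓡 n)] [IsContMDiffRiemannianBundle (𝓡 n) ∞ F S]
  [∀ x, InnerProductSpace 𝕜 (S x)]
  (B : DiracBundle (n := n) 𝕜 M F S) {σ τ : Π p, S p}

namespace DiracBundle

/-- The submodule of smooth sections. -/
def smoothSections : Submodule 𝕜 (Π p, S p) where
  carrier := {σ | IsSmooth n F σ}
  add_mem' hσ hτ := ContMDiff.add_section hσ hτ
  zero_mem' := Bundle.contMDiff_zeroSection ℝ S
  smul_mem' a σ hσ p := B.smul_smooth a σ p (hσ p)

/-- The smooth sections as a space with the `L²` inner product: a type synonym of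
`smoothSections`, which already carries the topology of pointwise convergence. -/
def SmoothSection : Type _ := B.smoothSections

instance : AddCommGroup B.SmoothSection := inferInstanceAs (AddCommGroup B.smoothSections)

instance : Module 𝕜 B.SmoothSection := inferInstanceAs (Module 𝕜 B.smoothSections)

/-- The Dirac operator on smooth sections. -/
def diracₗ : B.SmoothSection →ₗ[𝕜] B.SmoothSection where
  toFun σ := ⟨B.dirac σ.1, B.isSmooth_dirac σ.2⟩
  map_add' σ τ := Subtype.ext <| funext fun p ↦ B.dirac_add σ.2 τ.2 p
  map_smul' a σ := Subtype.ext <| funext fun p ↦ by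
    change B.dirac (fun q ↦ a • σ.1 q) p = a • B.dirac σ.1 p
    simp only [dirac, Finset.smul_sum, B.conn_smul a σ.1 p _ (σ.2 p), B.clifford_smul]

include B in
lemma continuous_inner (hσ : IsSmooth n F σ) (hτ : IsSmooth n F τ) :
    Continuous fun p ↦ inner 𝕜 (σ p) (τ p) := by
  have hI : IsSmooth n F fun p ↦ (RCLike.I : 𝕜) • σ p :=
    fun p ↦ B.smul_smooth RCLike.I σ p (hσ p)
  have hparts (p : M) : inner 𝕜 (σ p) (τ p) = ((inner ℝ (σ p) (τ p) : ℝ) : 𝕜)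
      + ((inner ℝ ((RCLike.I : 𝕜) • σ p) (τ p) : ℝ) : 𝕜) * RCLike.I := by
    rw [real_inner_eq_re (𝕜 := 𝕜), real_inner_eq_re (𝕜 := 𝕜), inner_smul_left]
    conv_lhs => rw [← RCLike.re_add_im (inner 𝕜 (σ p) (τ p))]
    simp
  rw [funext hparts]
  have hre := (ContMDiff.inner_bundle hσ hτ).continuous
  have him := (ContMDiff.inner_bundle hI hτ).continuous
  fun_prop

section Eigensections

variable {B} [MeasurableSpace M] {ev : ℕ → ℝ} {φ : ℕ → Π p, S p}
  (hφ : B.IsSpectralResolution ev φ)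

/-- The eigensections of a spectral resolution as elements of the space of smooth sections. -/
def IsSpectralResolution.eigensection (j : ℕ) : B.SmoothSection := ⟨φ j, hφ.smooth j⟩

lemma IsSpectralResolution.diracₗ_diracₗ_eigensection [∀ p, IsScalarTower ℝ 𝕜 (S p)] (j : ℕ) :
    B.diracₗ (B.diracₗ (hφ.eigensection j)) = (ev j : 𝕜) • hφ.eigensection j :=
  Subtype.ext <| funext fun p ↦
    (hφ.eigen j p).trans (RCLike.real_smul_eq_coe_smul (K := 𝕜) (ev j) (φ j p))

end Eigensections

variable [CompactSpace M] [MeasurableSpace M] [BorelSpace M]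

include B in
lemma integrable_inner (hσ : IsSmooth n F σ) (hτ : IsSmooth n F τ) :
    Integrable (fun p ↦ inner 𝕜 (σ p) (τ p)) (riemannianVolume (n := n) M) :=
  integrable_of_continuous (B.continuous_inner hσ hτ)

/-- The `L²` inner product on smooth sections. -/
abbrev innerProductCore : PreInnerProductSpace.Core 𝕜 B.SmoothSection where
  inner σ τ := ∫ p, inner 𝕜 (σ.1 p) (τ.1 p) ∂(riemannianVolume (n := n) M)
  conj_inner_symm σ τ := by
    rw [← integral_conj]
    simp only [inner_conj_symm]
  re_inner_nonneg σ := by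
    rw [← integral_re (B.integrable_inner σ.2 σ.2)]
    exact integral_nonneg fun p ↦ inner_self_nonneg
  add_left σ τ υ := by
    rw [← integral_add (B.integrable_inner σ.2 υ.2) (B.integrable_inner τ.2 υ.2)]
    simp only [← inner_add_left]
    rfl
  smul_left σ τ r := by
    rw [← integral_const_mul]
    simp only [← inner_smul_left]
    rfl

instance : SeminormedAddCommGroup B.SmoothSection :=
  InnerProductSpace.Core.toSeminormedAddCommGroup (c := B.innerProductCore)

instance : InnerProductSpace 𝕜 B.SmoothSection := InnerProductSpace.ofCore B.innerProductCore

variable {B}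

lemma inner_eq_integral (σ τ : B.SmoothSection) :
    inner 𝕜 σ τ = ∫ p, inner 𝕜 (σ.1 p) (τ.1 p) ∂(riemannianVolume (n := n) M) := rfl

lemma re_inner_eq_integral (σ τ : B.SmoothSection) :
    RCLike.re (inner 𝕜 σ τ) = ∫ p, inner ℝ (σ.1 p) (τ.1 p) ∂(riemannianVolume (n := n) M) := by
  rw [inner_eq_integral, ← integral_re (B.integrable_inner σ.2 τ.2)]
  exact integral_congr_ae (.of_forall fun p ↦ (real_inner_eq_re _ _).symm)

lemma norm_sq_eq_integral (σ : B.SmoothSection) :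
    ‖σ‖ ^ 2 = ∫ p, ‖σ.1 p‖ ^ 2 ∂(riemannianVolume (n := n) M) := by
  rw [← inner_self_eq_norm_sq (𝕜 := 𝕜), re_inner_eq_integral]
  simp only [real_inner_self_eq_norm_sq]

lemma ofReal_norm_sq_eq_lintegral (σ : B.SmoothSection) :
    ENNReal.ofReal (‖σ‖ ^ 2) = ∫⁻ p, ‖σ.1 p‖ₑ ^ 2 ∂(riemannianVolume (n := n) M) := by
  rw [norm_sq_eq_integral, ofReal_integral_eq_lintegral_ofReal
    (integrable_of_continuous (continuous_norm_sq σ.2)) (.of_forall fun p ↦ sq_nonneg _)]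
  simp only [ENNReal.ofReal_pow (norm_nonneg _), ofReal_norm]

variable (B) in
lemma isSymmetric_diracₗ [T2Space M] : B.diracₗ.IsSymmetric :=
  isSymmetric_of_re_inner fun σ τ ↦ by
    rw [re_inner_eq_integral, re_inner_eq_integral]
    exact B.integral_inner_dirac σ.2 τ.2

variable {ev : ℕ → ℝ} {φ : ℕ → Π p, S p} (hφ : B.IsSpectralResolution ev φ)

include hφ

lemma IsSpectralResolution.orthonormal_eigensection : Orthonormal 𝕜 hφ.eigensection :=
  orthonormal_iff_ite.2 hφ.orthonormal

lemma IsSpectralResolution.mem_closure_span (σ : B.SmoothSection) :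
    σ ∈ closure (Submodule.span 𝕜 (Set.range hφ.eigensection) : Set B.SmoothSection) := by
  refine Metric.mem_closure_iff.2 fun ε hε ↦ ?_
  have hmeas : Measurable[inferInstance, borel (TotalSpace F S)]
      (fun p ↦ TotalSpace.mk' F p (σ.1 p)) := by
    borelize (TotalSpace F S)
    exact (ContMDiff.continuous σ.2).measurable
  obtain ⟨s, a, h⟩ := hφ.dense σ.1 hmeas
    ((ofReal_norm_sq_eq_lintegral σ).symm ▸ ENNReal.ofReal_lt_top)
    (ENNReal.ofReal (ε ^ 2)) (by positivity)
  refine ⟨∑ j ∈ s, a j • hφ.eigensection j, Submodule.sum_mem _ fun j _ ↦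
    Submodule.smul_mem _ _ (Submodule.subset_span ⟨j, rfl⟩), ?_⟩
  have happly (p : M) : (σ - ∑ j ∈ s, a j • hφ.eigensection j).1 p
      = σ.1 p - ∑ j ∈ s, a j • φ j p := by
    change σ.1 p - (∑ j ∈ s, a j • (⟨φ j, hφ.smooth j⟩ : B.smoothSections)).1 p = _
    rw [Submodule.coe_sum, Finset.sum_apply]
    rfl
  simp only [← happly] at h
  rw [← ofReal_norm_sq_eq_lintegral, ENNReal.ofReal_lt_ofReal_iff (by positivity)] at h
  rw [dist_eq_norm]
  exact lt_of_pow_lt_pow_left₀ 2 hε.le h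

end DiracBundle

end Sections

/-! ### Trial sections -/

section Trial

variable {n : ℕ} {𝕜 : Type*} [RCLike 𝕜]
  {M : Type*} [TopologicalSpace M] [ChartedSpace (EuclideanSpace ℝ (Fin n)) M]
  [IsManifold (𝓡 n) ∞ M]
  [RiemannianBundle (fun x : M ↦ TangentSpace (𝓡 n) x)]
  [IsContMDiffRiemannianBundle (𝓡 n) ∞ (EuclideanSpace ℝ (Fin n))
    (fun x : M ↦ TangentSpace (𝓡 n) x)]
  {F : Type*} [NormedAddCommGroup F] [NormedSpace ℝ F] [FiniteDimensional ℝ F]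
  {S : M → Type*} [TopologicalSpace (TotalSpace F S)] [∀ x, NormedAddCommGroup (S x)]
  [∀ x, InnerProductSpace ℝ (S x)] [FiberBundle F S] [VectorBundle ℝ F S]
  [ContMDiffVectorBundle ∞ F S (𝓡 n)] [IsContMDiffRiemannianBundle (𝓡 n) ∞ F S]
  [∀ x, InnerProductSpace 𝕜 (S x)]
  {B : DiracBundle (n := n) 𝕜 M F S} {f g : M → ℝ}

namespace DiracBundle

/-- The product of a smooth section and a smooth function. -/
def SmoothSection.mulFun (σ : B.SmoothSection) (hf : ContMDiff (𝓡 n) 𝓘(ℝ, ℝ) ∞ f) :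
    B.SmoothSection :=
  ⟨fun p ↦ f p • σ.1 p, hf.smul_section σ.2⟩

/-- The commutator `[D², f] = D² f - f D²` applied to a smooth section. -/
def SmoothSection.commutator (σ : B.SmoothSection) (hf : ContMDiff (𝓡 n) 𝓘(ℝ, ℝ) ∞ f) :
    B.SmoothSection :=
  B.diracₗ (B.diracₗ (σ.mulFun hf)) - SmoothSection.mulFun (B.diracₗ (B.diracₗ σ)) hf

lemma SmoothSection.commutator_apply (σ : B.SmoothSection) (hf : ContMDiff (𝓡 n) 𝓘(ℝ, ℝ) ∞ f)
    (p : M) : (σ.commutator hf).1 p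
      = -((2 : ℝ) • B.conn σ.1 p (gradient f p) + laplacian B.leviCivita f p • σ.1 p) := by
  change B.dirac (B.dirac fun q ↦ f q • σ.1 q) p - f p • B.dirac (B.dirac σ.1) p = _
  rw [B.dirac_dirac_smul hf σ.2]
  abel

variable [CompactSpace M] [MeasurableSpace M] [BorelSpace M]

lemma SmoothSection.norm_commutator_sq (σ : B.SmoothSection)
    (hf : ContMDiff (𝓡 n) 𝓘(ℝ, ℝ) ∞ f) :
    ‖σ.commutator hf‖ ^ 2 = ∫ p, ‖(2 : ℝ) • B.conn σ.1 p (gradient f p)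
      + laplacian B.leviCivita f p • σ.1 p‖ ^ 2 ∂(riemannianVolume (n := n) M) := by
  simp only [norm_sq_eq_integral, σ.commutator_apply hf, norm_neg]

lemma SmoothSection.re_inner_commutator_mulFun [T2Space M] (σ : B.SmoothSection)
    (hf : ContMDiff (𝓡 n) 𝓘(ℝ, ℝ) ∞ f) :
    RCLike.re (inner 𝕜 (σ.commutator hf) (σ.mulFun hf))
      = ∫ p, ‖gradient (n := n) f p‖ ^ 2 * ‖σ.1 p‖ ^ 2 ∂(riemannianVolume (n := n) M) :=
  (re_inner_eq_integral _ _).trans (B.integral_inner_commutator hf σ.2)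

variable {ev : ℕ → ℝ} {φ : ℕ → Π p, S p} (hφ : B.IsSpectralResolution ev φ)

include hφ in
lemma IsSpectralResolution.integral_norm_sq (j : ℕ) :
    ∫ p, ‖φ j p‖ ^ 2 ∂(riemannianVolume (n := n) M) = 1 := by
  refine (norm_sq_eq_integral (hφ.eigensection j)).symm.trans ?_
  rw [hφ.orthonormal_eigensection.norm_eq_one, one_pow]

variable [∀ p, IsScalarTower ℝ 𝕜 (S p)]

lemma SmoothSection.inner_mulFun (σ : B.SmoothSection) (hf : ContMDiff (𝓡 n) 𝓘(ℝ, ℝ) ∞ f) :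
    inner 𝕜 σ (σ.mulFun hf)
      = ((∫ p, f p * ‖σ.1 p‖ ^ 2 ∂(riemannianVolume (n := n) M) : ℝ) : 𝕜) := by
  rw [inner_eq_integral, ← integral_ofReal]
  refine integral_congr_ae (.of_forall fun p ↦ ?_)
  change inner 𝕜 (σ.1 p) (f p • σ.1 p) = _
  rw [RCLike.real_smul_eq_coe_smul (K := 𝕜), inner_smul_right, inner_self_eq_norm_sq_to_K]
  push_cast
  rfl

lemma SmoothSection.inner_mulFun_mulFun (σ : B.SmoothSection)
    (hf : ContMDiff (𝓡 n) 𝓘(ℝ, ℝ) ∞ f) (hg : ContMDiff (𝓡 n) 𝓘(ℝ, ℝ) ∞ g) :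
    inner 𝕜 (σ.mulFun hf) (σ.mulFun hg)
      = ((∫ p, f p * g p * ‖σ.1 p‖ ^ 2 ∂(riemannianVolume (n := n) M) : ℝ) : 𝕜) := by
  refine Eq.trans (integral_congr_ae (.of_forall fun p ↦ ?_)) (σ.inner_mulFun (hf.mul hg))
  change inner 𝕜 (f p • σ.1 p) (g p • σ.1 p) = inner 𝕜 (σ.1 p) ((f p * g p) • σ.1 p)
  simp only [RCLike.real_smul_eq_coe_smul (K := 𝕜), inner_smul_left, inner_smul_right,
    RCLike.conj_ofReal, RCLike.ofReal_mul, mul_assoc]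
  exact mul_left_comm _ _ _

include hφ

lemma IsSpectralResolution.inner_commutator_eigensection [T2Space M]
    (hf : ContMDiff (𝓡 n) 𝓘(ℝ, ℝ) ∞ f) (j k : ℕ) :
    inner 𝕜 (hφ.eigensection k) ((hφ.eigensection j).commutator hf)
      = ((ev k - ev j : ℝ) : 𝕜)
        * inner 𝕜 (hφ.eigensection k) ((hφ.eigensection j).mulFun hf) := by
  have hsymm := B.isSymmetric_diracₗ
  have hmul : SmoothSection.mulFun ((ev j : 𝕜) • hφ.eigensection j) hf
      = (ev j : 𝕜) • (hφ.eigensection j).mulFun hf :=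
    Subtype.ext <| funext fun p ↦ (smul_comm (f p) (ev j : 𝕜) (φ j p))
  rw [SmoothSection.commutator, inner_sub_right, ← hsymm, ← hsymm,
    hφ.diracₗ_diracₗ_eigensection, hφ.diracₗ_diracₗ_eigensection, hmul, inner_smul_left,
    inner_smul_right, RCLike.conj_ofReal, RCLike.ofReal_sub, sub_mul]

theorem IsSpectralResolution.sum_eigenvalue_sub_le [T2Space M] {ι : Type*} [Fintype ι]
    {f : ι → M → ℝ} (hf : ∀ i, ContMDiff (𝓡 n) 𝓘(ℝ, ℝ) ∞ (f i))
    (hmean : ∀ i, ∫ p, f i p * ‖φ 0 p‖ ^ 2 ∂(riemannianVolume (n := n) M) = 0)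
    (horth : Pairwise fun i j ↦
      ∫ p, f i p * f j p * ‖φ 0 p‖ ^ 2 ∂(riemannianVolume (n := n) M) = 0)
    (hgrad : ∀ i p, ‖gradient (n := n) (f i) p‖ ≤ 1) {m : ℕ}
    (hsum : ∀ p, ∑ i, ‖gradient (n := n) (f i) p‖ ^ 2 = m) :
    ∑ k ∈ Finset.range m, (ev (k + 1) - ev 0)
      ≤ ∑ i, ∫ p, ‖(2 : ℝ) • B.conn (φ 0) p (gradient (f i) p)
        + laplacian B.leviCivita (f i) p • φ 0 p‖ ^ 2 ∂(riemannianVolume (n := n) M) := by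
  have hnorm : Continuous fun p ↦ ‖φ 0 p‖ ^ 2 := continuous_norm_sq (hφ.smooth 0)
  have hgradient (i : ι) := isSmoothField_gradient (hf i)
  have hint (i : ι) : Integrable (fun p ↦ ‖gradient (n := n) (f i) p‖ ^ 2 * ‖φ 0 p‖ ^ 2)
      (riemannianVolume (n := n) M) :=
    integrable_of_continuous ((continuous_norm_sq (hgradient i)).mul hnorm)
  have hinner (i : ι) : RCLike.re (inner 𝕜 ((hφ.eigensection 0).commutator (hf i))
        ((hφ.eigensection 0).mulFun (hf i)))
      = ∫ p, ‖gradient (n := n) (f i) p‖ ^ 2 * ‖φ 0 p‖ ^ 2 ∂(riemannianVolume (n := n) M) :=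
    (hφ.eigensection 0).re_inner_commutator_mulFun (hf i)
  refine (sum_eigenvalue_le_sum_norm_sq hφ.orthonormal_eigensection (μ := fun k ↦ ev k - ev 0)
    (ψ := fun i ↦ (hφ.eigensection 0).mulFun (hf i))
    (fun _ _ hkl ↦ sub_le_sub_right (hφ.monotone hkl) _) (fun i ↦ hφ.mem_closure_span _)
    (fun i k ↦ hφ.inner_commutator_eigensection (hf i) 0 k) (fun i j hij ↦ ?_) (fun i ↦ ?_)
    (fun i ↦ ?_) (fun i ↦ ?_) ?_).trans_eq
    (Finset.sum_congr rfl fun i _ ↦ (hφ.eigensection 0).norm_commutator_sq (hf i))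
  · exact ((hφ.eigensection 0).inner_mulFun_mulFun (hf i) (hf j)).trans
      ((congrArg _ (horth hij)).trans RCLike.ofReal_zero)
  · exact ((hφ.eigensection 0).inner_mulFun (hf i)).trans
      ((congrArg _ (hmean i)).trans RCLike.ofReal_zero)
  · exact (hinner i).symm ▸ integral_nonneg fun p ↦ mul_nonneg (sq_nonneg _) (sq_nonneg _)
  · refine (hinner i).trans_le ((integral_mono (hint i) (integrable_of_continuous hnorm)
      fun p ↦ ?_).trans_eq (hφ.integral_norm_sq 0))
    exact mul_le_of_le_one_left (sq_nonneg _) (pow_le_one₀ (norm_nonneg _) (hgrad i p))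
  · rw [Finset.sum_congr rfl fun i _ ↦ hinner i, ← integral_finsetSum _ fun i _ ↦ hint i]
    simp only [← Finset.sum_mul, hsum]
    rw [integral_const_mul]
    exact (congrArg _ (hφ.integral_norm_sq 0)).trans (mul_one _)

end DiracBundle

end Trial

section PrincipalAxes

variable {X : Type*} [MeasurableSpace X] {μ : Measure X}

lemma integral_inner_sub_integral_smul_mul {E : Type*} [NormedAddCommGroup E]
    [InnerProductSpace ℝ E] [CompleteSpace E] {w : X → ℝ} {x : X → E} (hw : Integrable w μ)
    (hx : Integrable (fun p ↦ w p • x p) μ) (hone : ∫ p, w p ∂μ = 1) (v : E) :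
    ∫ p, inner ℝ v (x p - ∫ q, w q • x q ∂μ) * w p ∂μ = 0 := by
  have hconst (c : E) : Integrable (fun p ↦ w p • c) μ := hw.smul_const c
  have hzero : ∫ p, w p • (x p - ∫ q, w q • x q ∂μ) ∂μ = 0 := by
    simp only [smul_sub]
    rw [integral_sub hx (hconst _), integral_smul_const, hone, one_smul, sub_self]
  have hint : Integrable (fun p ↦ w p • (x p - ∫ q, w q • x q ∂μ)) μ := by
    simp only [smul_sub]
    exact hx.sub (hconst _)
  simp only [mul_comm _ (w _), ← inner_smul_right]
  rw [integral_inner hint, hzero, inner_zero_right]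

variable {N : ℕ} {w : X → ℝ} {y : X → EuclideanSpace ℝ (Fin N)}

/-- The second moment operator `v ↦ ∫ w ⟨v, y⟩ y` of a vector-valued function `y` weighted by
`w`. -/
def secondMoment (hy : ∀ v, Integrable (fun p ↦ (inner ℝ v (y p) * w p) • y p) μ) :
    EuclideanSpace ℝ (Fin N) →ₗ[ℝ] EuclideanSpace ℝ (Fin N) where
  toFun v := ∫ p, (inner ℝ v (y p) * w p) • y p ∂μ
  map_add' v v' := by
    rw [← integral_add (hy v) (hy v')]
    simp only [inner_add_left, add_mul, add_smul]
  map_smul' a v := by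
    rw [RingHom.id_apply, ← integral_smul]
    simp only [real_inner_smul_left, mul_assoc, mul_smul]

variable (hy : ∀ v, Integrable (fun p ↦ (inner ℝ v (y p) * w p) • y p) μ)

lemma inner_secondMoment (u v : EuclideanSpace ℝ (Fin N)) :
    inner ℝ u (secondMoment hy v) = ∫ p, inner ℝ u (y p) * inner ℝ v (y p) * w p ∂μ := by
  refine (integral_inner (hy v) u).symm.trans (integral_congr_ae (.of_forall fun p ↦ ?_))
  simp only [inner_smul_right]
  ring

lemma isSymmetric_secondMoment : (secondMoment hy).IsSymmetric := fun u v ↦ by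
  rw [real_inner_comm, inner_secondMoment, inner_secondMoment]
  simp only [mul_comm (inner ℝ u _)]

include hy in
lemma exists_orthonormalBasis_integral_eq_zero :
    ∃ b : OrthonormalBasis (Fin N) ℝ (EuclideanSpace ℝ (Fin N)), Pairwise fun i j ↦
      ∫ p, inner ℝ (b i) (y p) * inner ℝ (b j) (y p) * w p ∂μ = 0 := by
  have hsymm := isSymmetric_secondMoment hy
  refine ⟨hsymm.eigenvectorBasis finrank_euclideanSpace_fin, fun i j hij ↦ ?_⟩
  refine (inner_secondMoment hy _ _).symm.trans ?_
  rw [hsymm.apply_eigenvectorBasis, inner_smul_right,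
    OrthonormalBasis.inner_eq_zero _ hij, mul_zero]

end PrincipalAxes

section Immersed

variable {n N : ℕ} {𝕜 : Type*} [RCLike 𝕜]
  {M : Type*} [TopologicalSpace M] [ChartedSpace (EuclideanSpace ℝ (Fin n)) M]
  [IsManifold (𝓡 n) ∞ M]
  [RiemannianBundle (fun x : M ↦ TangentSpace (𝓡 n) x)]
  [IsContMDiffRiemannianBundle (𝓡 n) ∞ (EuclideanSpace ℝ (Fin n))
    (fun x : M ↦ TangentSpace (𝓡 n) x)]
  {F : Type*} [NormedAddCommGroup F] [NormedSpace ℝ F] [FiniteDimensional ℝ F]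
  {S : M → Type*} [TopologicalSpace (TotalSpace F S)] [∀ x, NormedAddCommGroup (S x)]
  [∀ x, InnerProductSpace ℝ (S x)] [FiberBundle F S] [VectorBundle ℝ F S]
  [ContMDiffVectorBundle ∞ F S (𝓡 n)] [IsContMDiffRiemannianBundle (𝓡 n) ∞ F S]
  [∀ x, InnerProductSpace 𝕜 (S x)]
  {x : M → EuclideanSpace ℝ (Fin N)} {σ : Π p, S p}

namespace DiracBundle

variable (B : DiracBundle (n := n) 𝕜 M F S) {ι : Type*} [Fintype ι]
  (b : OrthonormalBasis ι ℝ (EuclideanSpace ℝ (Fin N)))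

lemma sum_norm_conn_gradient_add_laplacian_sq (hx : IsIsometricImmersion (n := n) x) (p : M) :
    ∑ i, ‖(2 : ℝ) • B.conn σ p (gradient (coordFunction x (b i)) p)
        + laplacian B.leviCivita (coordFunction x (b i)) p • σ p‖ ^ 2
      = 4 * ∑ j, ‖B.conn σ p (frame p j)‖ ^ 2
        + ‖meanCurvatureVector (n := n) x p‖ ^ 2 * ‖σ p‖ ^ 2 := by
  have hconn : ∑ i, ‖B.conn σ p (gradient (coordFunction x (b i)) p)‖ ^ 2
      = ∑ j, ‖B.conn σ p (frame p j)‖ ^ 2 := by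
    simp only [← real_inner_self_eq_norm_sq]
    exact sum_bilin_eq_of_dual (sum_inner_gradient_coordFunction_smul b hx) (frame p)
      ((innerₗ (S p)).compl₁₂ (B.conn σ p).toLinearMap (B.conn σ p).toLinearMap)
  have hcross : ∑ i, inner ℝ (B.conn σ p (gradient (coordFunction x (b i)) p))
      (laplacian B.leviCivita (coordFunction x (b i)) p • σ p) = 0 := by
    simp only [inner_smul_right, ← real_inner_smul_left, ← map_smul, ← sum_inner, ← map_sum]
    rw [sum_laplacian_smul_gradient b B.leviCivita_torsion B.leviCivita_metric hx, map_zero,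
      inner_zero_left]
  simp only [norm_add_sq_real, norm_smul, mul_pow, real_inner_smul_left, Finset.sum_add_distrib,
    ← Finset.mul_sum, ← Finset.sum_mul, hconn, hcross, Real.norm_eq_abs, sq_abs,
    sum_laplacian_sq b B.leviCivita_torsion B.leviCivita_metric hx]
  ring

variable [CompactSpace M] [MeasurableSpace M] [BorelSpace M]

lemma sum_integral_norm_conn_gradient_add_laplacian_sq_le [T2Space M]
    (hx : IsIsometricImmersion (n := n) x) (hσ : IsSmooth n F σ) :
    ∑ i, ∫ p, ‖(2 : ℝ) • B.conn σ p (gradient (coordFunction x (b i)) p)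
        + laplacian B.leviCivita (coordFunction x (b i)) p • σ p‖ ^ 2
        ∂(riemannianVolume (n := n) M)
      ≤ 4 * (∫ p, inner ℝ (B.dirac (B.dirac σ) p) (σ p) ∂(riemannianVolume (n := n) M)
          - ∫ p, inner ℝ (B.curvatureMorphism σ p) (σ p) ∂(riemannianVolume (n := n) M))
        + (n : ℝ) ^ 2 * (⨆ p, meanCurvature (n := n) x p ^ 2)
          * ∫ p, ‖σ p‖ ^ 2 ∂(riemannianVolume (n := n) M) := by
  have hsection (i : ι) : IsSmooth n F fun p ↦
      (2 : ℝ) • B.conn σ p (gradient (coordFunction x (b i)) p)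
        + laplacian B.leviCivita (coordFunction x (b i)) p • σ p := by
    have hgrad := isSmoothField_gradient (contMDiff_coordFunction hx.smooth (b i))
    exact ContMDiff.add_section (ContMDiff.smul_section contMDiff_const
        fun p ↦ isSmoothAt_conn_apply B.conn_smooth hσ (hgrad p))
      (ContMDiff.smul_section (contMDiff_divergence B.leviCivita_smooth hgrad) hσ)
  have hconn : Integrable (fun p ↦ 4 * ∑ j, ‖B.conn σ p (frame p j)‖ ^ 2)
      (riemannianVolume (n := n) M) :=
    (integrable_of_continuous (B.continuous_sum_norm_conn_frame_sq hσ)).const_mul 4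
  have hcurvature : Integrable (fun p ↦ ‖meanCurvatureVector (n := n) x p‖ ^ 2 * ‖σ p‖ ^ 2)
      (riemannianVolume (n := n) M) :=
    integrable_of_continuous ((continuous_norm_meanCurvatureVector_sq B.leviCivita_smooth
      B.leviCivita_torsion B.leviCivita_metric hx).mul (continuous_norm_sq hσ))
  rw [← integral_finsetSum _ fun i _ ↦ integrable_of_continuous (continuous_norm_sq (hsection i))]
  simp only [B.sum_norm_conn_gradient_add_laplacian_sq b hx]
  rw [integral_add hconn hcurvature, integral_const_mul, B.integral_sum_norm_conn_frame_sq hσ]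
  gcongr
  exact integral_norm_meanCurvatureVector_sq_mul_le B.leviCivita_smooth B.leviCivita_torsion
    B.leviCivita_metric hx (continuous_norm_sq hσ) fun p ↦ sq_nonneg _

variable {B} {ev : ℕ → ℝ} {φ : ℕ → Π p, S p} (hφ : B.IsSpectralResolution ev φ)

include hφ

lemma IsSpectralResolution.integral_inner_dirac_dirac (j : ℕ) :
    ∫ p, inner ℝ (B.dirac (B.dirac (φ j)) p) (φ j p) ∂(riemannianVolume (n := n) M) = ev j := by
  simp only [hφ.eigen, real_inner_smul_left, real_inner_self_eq_norm_sq]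
  rw [integral_const_mul, hφ.integral_norm_sq, mul_one]

theorem IsSpectralResolution.sum_eigenvalue_sub_le_of_immersion [T2Space M]
    [∀ p, IsScalarTower ℝ 𝕜 (S p)] (hx : IsIsometricImmersion (n := n) x) :
    ∑ k ∈ Finset.range n, (ev (k + 1) - ev 0)
      ≤ 4 * (ev 0 - ∫ p, inner ℝ (B.curvatureMorphism (φ 0) p) (φ 0 p)
          ∂(riemannianVolume (n := n) M))
        + (n : ℝ) ^ 2 * ⨆ p, meanCurvature (n := n) x p ^ 2 := by
  have hnorm : Continuous fun p ↦ ‖φ 0 p‖ ^ 2 := continuous_norm_sq (hφ.smooth 0)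
  have hcont : Continuous x := hx.smooth.continuous
  set c := ∫ p, ‖φ 0 p‖ ^ 2 • x p ∂(riemannianVolume (n := n) M)
  have hy := hx.sub_const c
  have hmean (v : EuclideanSpace ℝ (Fin N)) := integral_inner_sub_integral_smul_mul
    (integrable_of_continuous (n := n) hnorm)
    (integrable_of_continuous (hnorm.smul hcont)) (hφ.integral_norm_sq 0) v
  obtain ⟨b, hb⟩ := exists_orthonormalBasis_integral_eq_zero
    (μ := riemannianVolume (n := n) M) (w := fun p ↦ ‖φ 0 p‖ ^ 2) (y := fun p ↦ x p - c)
    fun v ↦ integrable_of_continuous (by fun_prop)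
  have htrial := hφ.sum_eigenvalue_sub_le (fun i ↦ contMDiff_coordFunction hy.smooth (b i))
    (fun i ↦ hmean (b i)) hb
    (fun i p ↦ (norm_gradient_coordFunction_le hy (b i) p).trans_eq (b.norm_eq_one i))
    (sum_norm_gradient_coordFunction_sq b hy)
  have hbound := B.sum_integral_norm_conn_gradient_add_laplacian_sq_le b hy (hφ.smooth 0)
  simp only [meanCurvature_sub_const hx.smooth, hφ.integral_inner_dirac_dirac,
    hφ.integral_norm_sq, mul_one] at hbound
  exact htrial.trans hbound

end DiracBundle

end Immersed

end DiracEigenvalues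

end

open DiracEigenvalues in
theorem theorem4p1_general {𝕜 : Type*} [RCLike 𝕜] {n N : ℕ}
    {M : Type*} [TopologicalSpace M] [T2Space M] [CompactSpace M]
    [ChartedSpace (EuclideanSpace ℝ (Fin n)) M] [IsManifold (𝓡 n) ∞ M]
    [RiemannianBundle (fun x : M ↦ TangentSpace (𝓡 n) x)]
    [IsContMDiffRiemannianBundle (𝓡 n) ∞ (EuclideanSpace ℝ (Fin n))
      (fun x : M ↦ TangentSpace (𝓡 n) x)]
    [MeasurableSpace M] [BorelSpace M]
    (x : M → EuclideanSpace ℝ (Fin N)) (hx : IsIsometricImmersion (n := n) x)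
    {F : Type*} [NormedAddCommGroup F] [NormedSpace ℝ F] [FiniteDimensional ℝ F]
    {S : M → Type*} [TopologicalSpace (TotalSpace F S)] [∀ p, NormedAddCommGroup (S p)]
    [∀ p, InnerProductSpace ℝ (S p)] [FiberBundle F S] [VectorBundle ℝ F S]
    [ContMDiffVectorBundle ∞ F S (𝓡 n)] [IsContMDiffRiemannianBundle (𝓡 n) ∞ F S]
    [∀ p, InnerProductSpace 𝕜 (S p)] [∀ p, IsScalarTower ℝ 𝕜 (S p)]
    (B : DiracBundle (n := n) 𝕜 M F S)
    (ev : ℕ → ℝ) (φ : ℕ → ∀ p, S p) (hφ : B.IsSpectralResolution ev φ) (R : ℝ)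
    (hR : R ≤ RCLike.re (∫ p, inner 𝕜 (B.curvatureMorphism (φ 0) p) (φ 0 p)
      ∂(riemannianVolume (n := n) M)))
    (η : ℕ → ℝ)
    (hη : ∀ i, η i = ev i
      + 1 / 4 * (n : ℝ) ^ 2 * (⨆ p, meanCurvature (n := n) x p ^ 2) - R) :
    ∑ i ∈ Finset.range n, (η (i + 1) - η 0) ≤ 4 * η 0 := by
  have hcurvature := hR.trans_eq <| DiracBundle.re_inner_eq_integral (B := B)
    ⟨_, B.isSmooth_curvatureMorphism (hφ.smooth 0)⟩ ⟨_, hφ.smooth 0⟩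
  have hbound := hφ.sum_eigenvalue_sub_le_of_immersion hx
  simp only [hη, sub_sub_sub_cancel_right, add_sub_add_right_eq_sub]
  linarith

theorem theorem4p1 {𝕜 : Type*} [RCLike 𝕜] {n N : ℕ}
    {M : Type*} [TopologicalSpace M] [T2Space M] [CompactSpace M]
    [ChartedSpace (EuclideanSpace ℝ (Fin n)) M] [IsManifold (𝓡 n) ∞ M]
    [RiemannianBundle (fun x : M ↦ TangentSpace (𝓡 n) x)]
    [IsContMDiffRiemannianBundle (𝓡 n) ∞ (EuclideanSpace ℝ (Fin n))
      (fun x : M ↦ TangentSpace (𝓡 n) x)]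
    [MeasurableSpace M] [BorelSpace M]
    (x : M → EuclideanSpace ℝ (Fin N))
    (hx : DiracEigenvalues.IsIsometricEmbedding (n := n) x)
    {F : Type*} [NormedAddCommGroup F] [NormedSpace ℝ F] [FiniteDimensional ℝ F]
    {S : M → Type*} [TopologicalSpace (TotalSpace F S)] [∀ p, NormedAddCommGroup (S p)]
    [∀ p, InnerProductSpace ℝ (S p)] [FiberBundle F S] [VectorBundle ℝ F S]
    [ContMDiffVectorBundle ∞ F S (𝓡 n)] [IsContMDiffRiemannianBundle (𝓡 n) ∞ F S]
    [∀ p, InnerProductSpace 𝕜 (S p)] [∀ p, IsScalarTower ℝ 𝕜 (S p)]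
    (B : DiracEigenvalues.DiracBundle (n := n) 𝕜 M F S)
    (ev : ℕ → ℝ) (φ : ℕ → ∀ p, S p) (hφ : B.IsSpectralResolution ev φ)
    (R : ℝ)
    (hR : ∀ i, R ≤ RCLike.re (∫ p, inner 𝕜 (B.curvatureMorphism (φ i) p) (φ i p)
      ∂(DiracEigenvalues.riemannianVolume (n := n) M)))
    (η : ℕ → ℝ)
    (hη : ∀ i, η i = ev i
      + 1 / 4 * (n : ℝ) ^ 2 * (⨆ p, DiracEigenvalues.meanCurvature (n := n) x p ^ 2) - R) :
    ∑ i ∈ Finset.range n, (η (i + 1) - η 0) ≤ 4 * η 0 :=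
  theorem4p1_general x ⟨hx.smooth, hx.inner_mvfderiv⟩ B ev φ hφ R (hR 0) η hη
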